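/- Let $G=SU(2,1)=\{g\in SL(3,\mathbb C): {}^t\bar g I_{2,1} g=I_{2,1}\}$ with $I_{2,1}=\mathrm{diag}(1,1,-1)$, let $\mathfrak g$ be its Lie algebra, and put $B(X,Y)=-\mathrm{Re}\,\mathrm{tr}(XY)$ for $X,Y\in\mathfrak g$. Let $K=\{\mathrm{diag}(A,(\det A)^{-1}):A\in U(2)\}\cong U(2)$ and $H=\{\mathrm{diag}(z,z,z^{-2}):|z|=1\}\cong S^1$, so that $H\subset K\subset G$, with Lie algebras $\mathfrak h_0\subset\mathfrak k\subset\mathfrak g$. Let $\mathfrak h_1=\mathfrak h_0^{\perp}\cap\mathfrak k$ and $\mathfrak h_2=\mathfrak k^{\perp}$, orthogonal complements with respect to $B$, so that $\mathfrak g=\mathfrak h_0\oplus\mathfrak h_1\oplus\mathfrak h_2$; write $X=X_0+X_1+X_2$ accordingly. Let $-1<t<-\frac35$ and $$\eta(t)=\frac{-3t^2-2t+5-\sqrt{45t^4+12t^3-50t^2+12t+45}}{16(t+1)}.$$ Then $\frac{1+t}{8}<\eta(t)$. Moreover, there are a unique $G$-invariant semi-Riemannian metric $g$ on $M=G/H$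 which on $T_{eH}M=\mathfrak g/\mathfrak h_0$ is given by $(X,Y)=(1+t)B(X_1,Y_1)+B(X_2,Y_2)$, and a unique $G$-invariant semi-Riemannian metric $h$ on $G/K$ which on $T_{eK}(G/K)=\mathfrak g/\mathfrak k$ is given by $B(X_2,Y_2)$. The metric $h$ is negative definite ($(G/K,-h)$ is the complex hyperbolic plane $\mathbb{CH}^2$), and the following hold. 1. For all $k$ with $\frac{1+t}{8}<k<\eta(t)$, we have $k>0$, and $(M,g)$ satisfies $R\ge k$, that is, $g(R(u,v)v,u)\ge k\,(g(u,u)g(v,v)-g(u,v)^2)$ for all tangent vectors $u,v$ at a common point, where $R(u,v)=\nabla_u\nabla_v-\nabla_v\nabla_u-\nabla_{[u,v]}$ is the curvature tensor of $g$. 2. $(M,g)$ is geodesically complete: every geodesic defined on an open interval extends to a geodesic defined on $\mathbb R$. 3. The projection $\pi:(M,g)\to(G/K,h)=(\mathbb{CH}^2,-g_{\mathbb{CH}^2})$ is a semi-Riemannian submersion, and $g$ is positive definite on the tangent spaces of its fibers. 4. The horizontal distribution of $\pi$, $p\mapsto(\ker d\pi_p)^{\perp}$, is not integrable. 5. Every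 fiber of $\pi$ is homeomorphic to $K/H=U(2)/S^1$ and has finite fundamental group. -/

import Mathlib

open scoped Matrix Manifold ContDiff Topology ComplexConjugate

noncomputable section

/-! ### Semi-Riemannian geometry -/

section Geometry

variable (E : Type*) [NormedAddCommGroup E] [NormedSpace ℝ E]
  (M : Type*) [TopologicalSpace M] [ChartedSpace E M] [IsManifold 𝓘(ℝ, E) ∞ M]

/-- A smooth semi-Riemannian metric: a smooth symmetric nondegenerate `(0,2)`-tensor field. -/
structure SemiRiemannianMetric where
  form (p : M) : TangentSpace 𝓘(ℝ, E) p →L[ℝ] TangentSpace 𝓘(ℝ, E) p →L[ℝ] ℝ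
  symm (p : M) (u w : TangentSpace 𝓘(ℝ, E) p) : form p u w = form p w u
  nondegenerate (p : M) (u : TangentSpace 𝓘(ℝ, E) p) (h : ∀ w, form p u w = 0) : u = 0
  contMDiff : ContMDiff 𝓘(ℝ, E) (𝓘(ℝ, E).prod 𝓘(ℝ, E →L[ℝ] E →L[ℝ] ℝ)) ∞
    (fun p => Bundle.TotalSpace.mk' (E →L[ℝ] E →L[ℝ] ℝ)
      (E := fun p : M => TangentSpace 𝓘(ℝ, E) p →L[ℝ] TangentSpace 𝓘(ℝ, E) p →L[ℝ] ℝ) p (form p))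

variable {E}

/-- The Christoffel symbols at `x` of a field `G` of nondegenerate bilinear forms on (an open
subset of) the vector space `E`: the vector `Γ = Γ(u, w)` such that
`2 G(Γ, z) = ∂_u G(w, z) + ∂_w G(u, z) - ∂_z G(u, w)` for all `z`. -/
def christoffel (G : E → E →L[ℝ] E →L[ℝ] ℝ) (x u w : E) : E :=
  (G x).inverse ((1 / 2 : ℝ) • (fderiv ℝ G x u w + fderiv ℝ G x w u
    - ((fderiv ℝ G x).flip u).flip w))

/-- The curvature tensor `R(u, v)w` at `x` of a field `G` of nondegenerate bilinear forms on (an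
open subset of) the vector space `E`, that is, the value of
`∇_u ∇_v w - ∇_v ∇_u w` for the constant vector fields `u, v, w` and the Levi-Civita
connection `∇`. -/
def curvatureCoord (G : E → E →L[ℝ] E →L[ℝ] ℝ) (x u v w : E) : E :=
  fderiv ℝ (fun y => christoffel G y v w) x u - fderiv ℝ (fun y => christoffel G y u w) x v
    + christoffel G x u (christoffel G x v w) - christoffel G x v (christoffel G x u w)

variable {M}

namespace SemiRiemannianMetric

variable (g : SemiRiemannianMetric E M)

/-- The metric in a chart `φ`, i.e. its pullback by the inverse of `φ`. -/
def inChart (φ : OpenPartialHomeomorph M E) (x : E) : E →L[ℝ] E →L[ℝ] ℝ :=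
  let b : E →L[ℝ] E →L[ℝ] ℝ := g.form (φ.symm x)
  let A : E →L[ℝ] E := mfderiv 𝓘(ℝ, E) 𝓘(ℝ, E) φ.symm x
  b.bilinearComp A A

/-- The curvature tensor, with the sign convention
`R(u, v) = ∇_u ∇_v - ∇_v ∇_u - ∇_[u, v]`. The tangent space at `p` is the model vector space `E`,
by means of the preferred chart at `p`, so that we use the expression in this chart. -/
def curvature (p : M) (u v w : TangentSpace 𝓘(ℝ, E) p) : TangentSpace 𝓘(ℝ, E) p :=
  curvatureCoord (E := E) (g.inChart (chartAt E p)) (chartAt E p p) u v w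

/-- The curvature condition `R ≥ k`. -/
def CurvatureGE (k : ℝ) : Prop :=
  ∀ (p : M) (u v : TangentSpace 𝓘(ℝ, E) p),
    k * (g.form p u u * g.form p v v - g.form p u v ^ 2) ≤ g.form p (g.curvature p u v v) u

/-- The covariant acceleration `∇_{γ'} γ'` of a smooth curve at the time `s`, in the preferred chart
at `γ s`. -/
def acceleration (γ : ℝ → M) (s : ℝ) : TangentSpace 𝓘(ℝ, E) (γ s) :=
  let φ := chartAt E (γ s)
  deriv (deriv (fun r => φ (γ r))) s + christoffel (g.inChart φ) (φ (γ s))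
    (deriv (fun r => φ (γ r)) s) (deriv (fun r => φ (γ r)) s)

/-- The restriction of `γ` to the open set `J` is a geodesic. -/
def IsGeodesicOn (γ : ℝ → M) (J : Set ℝ) : Prop :=
  ContMDiffOn 𝓘(ℝ, ℝ) 𝓘(ℝ, E) ∞ γ J ∧ ∀ s ∈ J, g.acceleration γ s = 0

/-- Geodesic completeness: every geodesic on an open interval extends to a geodesic defined on the
whole real line. -/
def GeodesicallyComplete : Prop :=
  ∀ (J : Set ℝ) (γ : ℝ → M), IsOpen J → J.OrdConnected → g.IsGeodesicOn γ J →
    ∃ γ' : ℝ → M, g.IsGeodesicOn γ' Set.univ ∧ Set.EqOn γ γ' J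

end SemiRiemannianMetric

/-- A distribution (given by subspaces `D p` of the tangent spaces) is integrable if through each
point there passes an integral manifold, i.e. an immersed submanifold the tangent spaces of which
are the subspaces `D p`. -/
def IsIntegrableDistribution (D : ∀ p : M, Submodule ℝ (TangentSpace 𝓘(ℝ, E) p)) : Prop :=
  ∀ p : M, ∃ (d : ℕ) (U : Set (EuclideanSpace ℝ (Fin d))) (f : EuclideanSpace ℝ (Fin d) → M),
    IsOpen U ∧ 0 ∈ U ∧ f 0 = p ∧ ContMDiffOn 𝓘(ℝ, EuclideanSpace ℝ (Fin d)) 𝓘(ℝ, E) ∞ f U ∧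
    ∀ x ∈ U, Function.Injective (mfderiv 𝓘(ℝ, EuclideanSpace ℝ (Fin d)) 𝓘(ℝ, E) f x) ∧
      LinearMap.range (mfderiv 𝓘(ℝ, EuclideanSpace ℝ (Fin d)) 𝓘(ℝ, E) f x).toLinearMap = D (f x)

variable (F : Type*) [NormedAddCommGroup F] [NormedSpace ℝ F]
  {B : Type*} [TopologicalSpace B] [ChartedSpace F B] [IsManifold 𝓘(ℝ, F) ∞ B]

/-- The horizontal space at `p` of a map `π`: the orthogonal complement of the tangent space
`ker (dπ)_p` of the fiber through `p`. -/
def horizontalSpace (g : SemiRiemannianMetric E M) (π : M → B) (p : M) :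
    Submodule ℝ (TangentSpace 𝓘(ℝ, E) p) where
  carrier := {u | ∀ w, mfderiv 𝓘(ℝ, E) 𝓘(ℝ, F) π p w = 0 → g.form p u w = 0}
  zero_mem' := by simp
  add_mem' := by
    intro a b ha hb w hw
    rw [map_add, _root_.add_apply, ha w hw, hb w hw, add_zero]
  smul_mem' := by
    intro c a ha w hw
    rw [map_smul, _root_.smul_apply, ha w hw, smul_zero]

variable {F}

/-- Semi-Riemannian submersions. -/
structure IsSemiRiemannianSubmersion (g : SemiRiemannianMetric E M) (h : SemiRiemannianMetric F B)
    (π : M → B) : Prop where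
  surjective : Function.Surjective π
  isSubmersion : Manifold.IsSubmersion 𝓘(ℝ, E) 𝓘(ℝ, F) ∞ π
  /-- The metric is nondegenerate on the fibers. -/
  fiber (p : M) (u : TangentSpace 𝓘(ℝ, E) p) (hu : mfderiv 𝓘(ℝ, E) 𝓘(ℝ, F) π p u = 0)
    (hh : ∀ w, mfderiv 𝓘(ℝ, E) 𝓘(ℝ, F) π p w = 0 → g.form p u w = 0) : u = 0
  /-- The differential is isometric on the horizontal spaces. -/
  isometric (p : M) (u w : TangentSpace 𝓘(ℝ, E) p) (hu : u ∈ horizontalSpace F g π p)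
    (hw : w ∈ horizontalSpace F g π p) :
    h.form (π p) (mfderiv 𝓘(ℝ, E) 𝓘(ℝ, F) π p u) (mfderiv 𝓘(ℝ, E) 𝓘(ℝ, F) π p w) = g.form p u w

/-- Invariance of a metric under the action of a group. -/
def IsInvariantMetric (G : Type*) [Group G] [MulAction G M] (g : SemiRiemannianMetric E M) : Prop :=
  ∀ (a : G) (p : M) (u w : TangentSpace 𝓘(ℝ, E) p),
    g.form (a • p) (mfderiv 𝓘(ℝ, E) 𝓘(ℝ, E) (fun q : M => a • q) p u)
      (mfderiv 𝓘(ℝ, E) 𝓘(ℝ, E) (fun q : M => a • q) p w) = g.form p u w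

/-- The velocity at time `0` of a curve through `p`. -/
def velocity (γ : ℝ → M) (p : M) (_ : γ 0 = p) : TangentSpace 𝓘(ℝ, E) p :=
  (mfderiv 𝓘(ℝ, ℝ) 𝓘(ℝ, E) γ 0 (1 : ℝ) : E)

end Geometry

/-! ### The homogeneous spaces -/


/-- The matrix `I_{2,1}`. -/
def I21 : Matrix (Fin 3) (Fin 3) ℂ := Matrix.diagonal ![1, 1, -1]

/-- The group `SU(2,1)`. -/
def SU21 : Subgroup (Matrix.SpecialLinearGroup (Fin 3) ℂ) where
  carrier := {g | (g : Matrix (Fin 3) (Fin 3) ℂ)ᴴ * I21 * (g : Matrix (Fin 3) (Fin 3) ℂ) = I21}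
  one_mem' := by simp
  mul_mem' := by
    intro a b ha hb
    simp only [Set.mem_ofPred_eq, Matrix.SpecialLinearGroup.coe_mul, Matrix.conjTranspose_mul]
      at ha hb ⊢
    calc _ = (b : Matrix (Fin 3) (Fin 3) ℂ)ᴴ * ((a : Matrix (Fin 3) (Fin 3) ℂ)ᴴ * I21 * a) * b := by
          simp only [Matrix.mul_assoc]
      _ = _ := by rw [ha, hb]
  inv_mem' := by
    intro a ha
    simp only [Set.mem_ofPred_eq] at ha ⊢
    have h1 : (a : Matrix (Fin 3) (Fin 3) ℂ) * (a⁻¹ : Matrix.SpecialLinearGroup (Fin 3) ℂ) = 1 := by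
      rw [← Matrix.SpecialLinearGroup.coe_mul]; simp
    have h2 : ((a⁻¹ : Matrix.SpecialLinearGroup (Fin 3) ℂ) : Matrix (Fin 3) (Fin 3) ℂ)ᴴ *
        (a : Matrix (Fin 3) (Fin 3) ℂ)ᴴ = 1 := by
      rw [← Matrix.conjTranspose_mul, h1]; simp
    calc _ = ((a⁻¹ : Matrix.SpecialLinearGroup (Fin 3) ℂ) : Matrix (Fin 3) (Fin 3) ℂ)ᴴ *
          ((a : Matrix (Fin 3) (Fin 3) ℂ)ᴴ * I21 * (a : Matrix (Fin 3) (Fin 3) ℂ)) *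
          (a⁻¹ : Matrix.SpecialLinearGroup (Fin 3) ℂ) := by rw [ha]
      _ = (((a⁻¹ : Matrix.SpecialLinearGroup (Fin 3) ℂ) : Matrix (Fin 3) (Fin 3) ℂ)ᴴ *
          (a : Matrix (Fin 3) (Fin 3) ℂ)ᴴ) * I21 *
          ((a : Matrix (Fin 3) (Fin 3) ℂ) * (a⁻¹ : Matrix.SpecialLinearGroup (Fin 3) ℂ)) := by
          simp only [Matrix.mul_assoc]
      _ = _ := by rw [h1, h2]; simp

/-- The underlying matrix of an element of `SU(2,1)`. -/
def toMat (g : SU21) : Matrix (Fin 3) (Fin 3) ℂ := (g : Matrix.SpecialLinearGroup (Fin 3) ℂ)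

theorem toMat_mul (a b : SU21) : toMat (a * b) = toMat a * toMat b := rfl

theorem toMat_one : toMat 1 = 1 := rfl

theorem toMat_injective : Function.Injective toMat := fun _ _ h =>
  Subtype.ext (Subtype.ext h)

theorem continuous_toMat : Continuous toMat :=
  continuous_subtype_val.comp continuous_subtype_val

theorem toMat_isom (g : SU21) : (toMat g)ᴴ * I21 * toMat g = I21 := g.2

theorem det_toMat (g : SU21) : (toMat g).det = 1 := g.1.2

/-- The element of `SU(2,1)` with a given matrix. -/
def ofMat (m : Matrix (Fin 3) (Fin 3) ℂ) (hd : m.det = 1) (hm : mᴴ * I21 * m = I21) : SU21 :=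
  ⟨⟨m, hd⟩, hm⟩

theorem toMat_ofMat (m : Matrix (Fin 3) (Fin 3) ℂ) (hd : m.det = 1) (hm : mᴴ * I21 * m = I21) :
    toMat (ofMat m hd hm) = m := rfl

/-- The block matrix `diag(A, (det A)⁻¹)`. -/
def kMat (A : Matrix (Fin 2) (Fin 2) ℂ) : Matrix (Fin 3) (Fin 3) ℂ :=
  !![A 0 0, A 0 1, 0; A 1 0, A 1 1, 0; 0, 0, A.det⁻¹]

theorem kMat_one : kMat 1 = 1 := by
  ext i j
  fin_cases i <;> fin_cases j <;> simp [kMat]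

theorem kMat_mul (A B : Matrix (Fin 2) (Fin 2) ℂ) : kMat (A * B) = kMat A * kMat B := by
  ext i j
  fin_cases i <;> fin_cases j <;>
    simp [kMat, Matrix.mul_apply, Fin.sum_univ_three, Fin.sum_univ_two, mul_comm]

theorem det_kMat (A : Matrix (Fin 2) (Fin 2) ℂ) (h : A.det ≠ 0) : (kMat A).det = 1 := by
  have h2 : (kMat A).det = A.det * A.det⁻¹ := by
    rw [Matrix.det_fin_three, Matrix.det_fin_two A]
    simp [kMat, Matrix.det_fin_two A]
    ring
  rw [h2, mul_inv_cancel₀ h]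

theorem kMat_isom (A : Matrix (Fin 2) (Fin 2) ℂ) (h : star A * A = 1) :
    (kMat A)ᴴ * I21 * kMat A = I21 := by
  have hd : star A.det * A.det = 1 := by
    have := congrArg Matrix.det h
    rwa [Matrix.det_mul, Matrix.star_eq_conjTranspose, Matrix.det_conjTranspose,
      Matrix.det_one] at this
  have hd' : (starRingEnd ℂ (A.det))⁻¹ * (A.det)⁻¹ = 1 := by
    rw [← mul_inv]
    change (star A.det * A.det)⁻¹ = 1
    rw [hd, inv_one]
  have h00 := congrFun (congrFun h 0) 0
  have h01 := congrFun (congrFun h 0) 1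
  have h10 := congrFun (congrFun h 1) 0
  have h11 := congrFun (congrFun h 1) 1
  simp [Matrix.mul_apply, Fin.sum_univ_two] at h00 h01 h10 h11
  ext i j
  fin_cases i <;> fin_cases j <;>
    simp [kMat, I21, Matrix.mul_apply, Fin.sum_univ_three, Matrix.diagonal_apply] <;> assumption

/-- The embedding `A ↦ diag(A, (det A)⁻¹)` of `U(2)` in `SU(2,1)`. -/
def kEmb : Matrix.unitaryGroup (Fin 2) ℂ →* SU21 where
  toFun A := ofMat (kMat (A : Matrix (Fin 2) (Fin 2) ℂ))
    (det_kMat _ (Matrix.UnitaryGroup.det_isUnit A).ne_zero)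
    (kMat_isom _ (Matrix.mem_unitaryGroup_iff'.1 A.2))
  map_one' := toMat_injective kMat_one
  map_mul' A B := toMat_injective (kMat_mul A B)

theorem toMat_kEmb (A : Matrix.unitaryGroup (Fin 2) ℂ) : toMat (kEmb A) = kMat A := rfl

/-- The matrix `diag(z, z, z⁻²)`. -/
def circleMat (z : ℂ) : Matrix (Fin 3) (Fin 3) ℂ := !![z, 0, 0; 0, z, 0; 0, 0, (z ^ 2)⁻¹]

theorem conj_mul_circle (z : Circle) : conj (z : ℂ) * z = 1 := by
  rw [mul_comm, Complex.mul_conj, Circle.normSq_coe]; simp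

/-- The embedding `z ↦ diag(z, z, z⁻²)` of the circle in `SU(2,1)`. -/
def circleEmb : Circle →* SU21 where
  toFun z := ofMat (circleMat z)
    (by
      have h : (z : ℂ) ≠ 0 := Circle.coe_ne_zero z
      rw [Matrix.det_fin_three]
      simp [circleMat]
      field_simp)
    (by
      have h := conj_mul_circle z
      have h' : ((conj (z : ℂ)) ^ 2)⁻¹ * ((z : ℂ) ^ 2)⁻¹ = 1 := by
        rw [← mul_inv, ← mul_pow, h]; simp
      ext i j
      fin_cases i <;> fin_cases j <;>
        simp [circleMat, I21, Matrix.mul_apply, Fin.sum_univ_three, Matrix.diagonal_apply, h, h'])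
  map_one' := by
    apply toMat_injective
    change circleMat 1 = 1
    ext i j
    fin_cases i <;> fin_cases j <;> simp [circleMat]
  map_mul' z w := by
    apply toMat_injective
    change circleMat (z * w) = circleMat z * circleMat w
    ext i j
    fin_cases i <;> fin_cases j <;>
      simp [circleMat, Matrix.mul_apply, Fin.sum_univ_three, mul_comm, mul_pow]

theorem toMat_circleEmb (z : Circle) : toMat (circleEmb z) = circleMat z := rfl

/-- The maximal compact subgroup `K ≅ U(2)` of `SU(2,1)`. -/
def subK : Subgroup SU21 := kEmb.range

/-- The circle `H = {diag(z, z, z⁻²) : |z| = 1}`. -/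
def subH : Subgroup SU21 := circleEmb.range

theorem subH_le_subK : subH ≤ subK := by
  rintro _ ⟨z, rfl⟩
  have h := conj_mul_circle z
  refine ⟨⟨Matrix.diagonal ![(z : ℂ), z], ?_⟩, toMat_injective ?_⟩
  · rw [Matrix.mem_unitaryGroup_iff']
    ext i j
    fin_cases i <;> fin_cases j <;> simp [Matrix.mul_apply, Matrix.diagonal_apply, h]
  · rw [toMat_kEmb, toMat_circleEmb]
    ext i j
    fin_cases i <;> fin_cases j <;> simp [kMat, circleMat, sq]

/-- `SU(2,1)/S¹`. -/
abbrev SpaceM : Type := SU21 ⧸ subH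

/-- `SU(2,1)/U(2)`. -/
abbrev SpaceB : Type := SU21 ⧸ subK

/-- The positive definite element of `SU(2,1)` with last column `(p, q, √(1 + |p|² + |q|²))`. -/
def boostMat (p q : ℂ) : Matrix (Fin 3) (Fin 3) ℂ :=
  let r : ℂ := (Real.sqrt (1 + Complex.normSq p + Complex.normSq q) : ℝ)
  !![1 + p * conj p / (1 + r), p * conj q / (1 + r), p;
     q * conj p / (1 + r), 1 + q * conj q / (1 + r), q;
     conj p, conj q, r]

theorem boost_aux (p q : ℂ) :
    ∃ r : ℝ, Real.sqrt (1 + Complex.normSq p + Complex.normSq q) = r ∧ 0 < r ∧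
      (r : ℂ) ^ 2 = 1 + p * conj p + q * conj q ∧ (1 + (r : ℂ)) ≠ 0 := by
  have h0 : 0 < 1 + Complex.normSq p + Complex.normSq q := by
    have := Complex.normSq_nonneg p
    have := Complex.normSq_nonneg q
    linarith
  refine ⟨_, rfl, Real.sqrt_pos.2 h0, ?_, ?_⟩
  · rw [← Complex.ofReal_pow, Real.sq_sqrt h0.le]
    simp [Complex.mul_conj]
  · have := Real.sqrt_nonneg (1 + Complex.normSq p + Complex.normSq q)
    norm_cast
    linarith

theorem boostMat_mul_neg (p q : ℂ) : boostMat (-p) (-q) * boostMat p q = 1 := by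
  obtain ⟨r, hr, hr0, hr2, hr1⟩ := boost_aux p q
  ext i j
  fin_cases i <;> fin_cases j <;>
    simp [boostMat, Matrix.mul_apply, Fin.sum_univ_three, hr] <;> field_simp <;>
    first
    | linear_combination (-(p * conj p)) * hr2
    | linear_combination (-(p * conj q)) * hr2
    | linear_combination (-p) * hr2
    | linear_combination (-(q * conj p)) * hr2
    | linear_combination (-(q * conj q)) * hr2
    | linear_combination (-q) * hr2
    | linear_combination (conj p) * hr2
    | linear_combination (conj q) * hr2
    | linear_combination hr2

/-- The matrix `boostMat p q` as an element of `SU(2,1)`. -/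
def boost (p q : ℂ) : SU21 := ofMat (boostMat p q)
  (by
    obtain ⟨r, hr, hr0, hr2, hr1⟩ := boost_aux p q
    rw [Matrix.det_fin_three]
    simp [boostMat, hr]
    field_simp
    linear_combination (1 + (r : ℂ)) * hr2)
  (by
    have h : (boostMat p q)ᴴ * I21 = I21 * boostMat (-p) (-q) := by
      ext i j
      fin_cases i <;> fin_cases j <;>
        simp [boostMat, I21, Matrix.mul_apply, Matrix.diagonal_apply, mul_comm]
    rw [h, Matrix.mul_assoc, boostMat_mul_neg, Matrix.mul_one])

theorem toMat_boost (p q : ℂ) : toMat (boost p q) = boostMat p q := rfl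

theorem boost_neg_mul (p q : ℂ) : boost (-p) (-q) * boost p q = 1 :=
  toMat_injective (boostMat_mul_neg p q)

theorem boost_inv (p q : ℂ) : (boost p q)⁻¹ = boost (-p) (-q) :=
  inv_eq_of_mul_eq_one_left (boost_neg_mul p q)

/-- The scalar normalizing a unit quaternion. -/
def rotScale (s : ℝ) (w : ℂ) : ℝ := (Real.sqrt (1 + s ^ 2 + Complex.normSq w))⁻¹

/-- The element of `SU(2)` which is a positive multiple of `1 + [[i s, -w̄], [w, -i s]]`. -/
def rotMat (s : ℝ) (w : ℂ) : Matrix (Fin 2) (Fin 2) ℂ :=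
  !![rotScale s w * (1 + Complex.I * s), -(rotScale s w * conj w);
     rotScale s w * w, rotScale s w * (1 - Complex.I * s)]

theorem rot_aux (s : ℝ) (w : ℂ) :
    0 < rotScale s w ∧ (rotScale s w : ℂ) ^ 2 * (1 + s ^ 2 + w * conj w) = 1 := by
  have h0 : 0 < 1 + s ^ 2 + Complex.normSq w := by
    have := Complex.normSq_nonneg w
    positivity
  refine ⟨inv_pos.2 (Real.sqrt_pos.2 h0), ?_⟩
  have h : rotScale s w ^ 2 * (1 + s ^ 2 + Complex.normSq w) = 1 := by
    rw [rotScale, inv_pow, Real.sq_sqrt h0.le, inv_mul_cancel₀ h0.ne']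
  rw [Complex.mul_conj]
  exact_mod_cast h

theorem rotMat_unitary (s : ℝ) (w : ℂ) : rotMat s w ∈ Matrix.unitaryGroup (Fin 2) ℂ := by
  obtain ⟨-, h⟩ := rot_aux s w
  rw [Matrix.mem_unitaryGroup_iff']
  have hI : Complex.I ^ 2 = -1 := Complex.I_sq
  ext i j
  fin_cases i <;> fin_cases j <;>
    simp [rotMat, Matrix.mul_apply, Fin.sum_univ_two] <;>
    first
    | ring1
    | linear_combination h - (rotScale s w : ℂ) ^ 2 * (s : ℂ) ^ 2 * hI

theorem det_rotMat (s : ℝ) (w : ℂ) : (rotMat s w).det = 1 := by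
  obtain ⟨-, h⟩ := rot_aux s w
  have hI : Complex.I ^ 2 = -1 := Complex.I_sq
  rw [Matrix.det_fin_two]
  simp [rotMat]
  linear_combination h - (rotScale s w : ℂ) ^ 2 * (s : ℂ) ^ 2 * hI

/-- The element `diag(rotMat s w, 1)` of `SU(2,1)`. -/
def rot (s : ℝ) (w : ℂ) : SU21 := kEmb ⟨rotMat s w, rotMat_unitary s w⟩

theorem toMat_rot (s : ℝ) (w : ℂ) : toMat (rot s w) = kMat (rotMat s w) := rfl

/-- The model vector space of `SU(2,1)/U(2)`. -/
abbrev ModelB : Type := ℂ × ℂ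

/-- The model vector space of `SU(2,1)/S¹`. -/
abbrev ModelM : Type := (ℂ × ℂ) × (ℝ × ℂ)

/-- A smooth slice through the identity, transversal to the cosets of the circle `H`. -/
def slice (x : ModelM) : SU21 := boost x.1.1 x.1.2 * rot x.2.1 x.2.2

/-- The function on matrices inducing the coordinate on `SU(2,1)/U(2)`. -/
def vCoord (F : Matrix (Fin 3) (Fin 3) ℂ) : ModelB :=
  (F 0 2 * (conj (F 2 2) / (‖F 2 2‖ : ℝ)), F 1 2 * (conj (F 2 2) / (‖F 2 2‖ : ℝ)))

/-- On `SU(2,1)`: the `U(2)`-part of the polar decomposition. -/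
def kPart (F : Matrix (Fin 3) (Fin 3) ℂ) : Matrix (Fin 3) (Fin 3) ℂ :=
  boostMat (-(vCoord F).1) (-(vCoord F).2) * F

/-- The trace of the upper left block of `kPart F`. -/
def kTrace (F : Matrix (Fin 3) (Fin 3) ℂ) : ℂ := kPart F 0 0 + kPart F 1 1

/-- The function on matrices inducing the coordinates near the base point of `SU(2,1)/S¹`. -/
def coords (F : Matrix (Fin 3) (Fin 3) ℂ) : ModelM :=
  (vCoord F, (((kPart F 0 0 - kPart F 1 1) / kTrace F).im, 2 * kPart F 1 0 / kTrace F))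

theorem vCoord_boost (p q : ℂ) : vCoord (boostMat p q) = (p, q) := by
  obtain ⟨r, hr, hr0, hr2, hr1⟩ := boost_aux p q
  have : (r : ℂ) ≠ 0 := by exact_mod_cast hr0.ne'
  simp [vCoord, boostMat, hr, abs_of_pos hr0, this]

theorem entries_of_isom (g : SU21) :
    (conj (toMat g 0 2) * toMat g 0 2 + conj (toMat g 1 2) * toMat g 1 2
      - conj (toMat g 2 2) * toMat g 2 2 = -1) ∧
    (conj (toMat g 0 0) * toMat g 0 2 + conj (toMat g 1 0) * toMat g 1 2
      - conj (toMat g 2 0) * toMat g 2 2 = 0) ∧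
    (conj (toMat g 0 1) * toMat g 0 2 + conj (toMat g 1 1) * toMat g 1 2
      - conj (toMat g 2 1) * toMat g 2 2 = 0) := by
  have h := toMat_isom g
  have h0 := congrFun (congrFun h 2) 2
  have h1 := congrFun (congrFun h 0) 2
  have h2 := congrFun (congrFun h 1) 2
  simp [I21, Matrix.mul_apply, Fin.sum_univ_three, Matrix.diagonal_apply] at h0 h1 h2
  refine ⟨?_, ?_, ?_⟩
  · linear_combination h0
  · linear_combination h1
  · linear_combination h2

theorem toMat_22_ne (g : SU21) : toMat g 2 2 ≠ 0 := by
  intro h0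
  obtain ⟨h, -, -⟩ := entries_of_isom g
  rw [h0, ← Complex.normSq_eq_conj_mul_self, ← Complex.normSq_eq_conj_mul_self] at h
  have h' : Complex.normSq (toMat g 0 2) + Complex.normSq (toMat g 1 2) = -1 := by
    have := congrArg Complex.re h
    simpa using this
  have := Complex.normSq_nonneg (toMat g 0 2)
  have := Complex.normSq_nonneg (toMat g 1 2)
  linarith

/-- An element of `SU(2,1)` with last column proportional to the last basis vector lies in `K`. -/
theorem mem_subK_of_entries (k : SU21) (h0 : toMat k 0 2 = 0) (h1 : toMat k 1 2 = 0) :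
    ∃ A : Matrix.unitaryGroup (Fin 2) ℂ, kEmb A = k := by
  obtain ⟨-, e1, e2⟩ := entries_of_isom k
  have hne := toMat_22_ne k
  simp only [h0, h1, mul_zero, zero_sub, neg_eq_zero, mul_eq_zero, hne, or_false, add_zero,
    map_eq_zero] at e1 e2
  have hd := det_toMat k
  rw [Matrix.det_fin_three] at hd
  simp only [h0, h1, e1, e2] at hd
  have h := toMat_isom k
  have h00 := congrFun (congrFun h 0) 0
  have h01 := congrFun (congrFun h 0) 1
  have h10 := congrFun (congrFun h 1) 0
  have h11 := congrFun (congrFun h 1) 1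
  simp [I21, Matrix.mul_apply, Fin.sum_univ_three, Matrix.diagonal_apply, e1, e2] at h00 h01 h10 h11
  refine ⟨⟨!![toMat k 0 0, toMat k 0 1; toMat k 1 0, toMat k 1 1], ?_⟩, toMat_injective ?_⟩
  · rw [Matrix.mem_unitaryGroup_iff']
    ext i j
    fin_cases i <;> fin_cases j <;>
      simp [Matrix.mul_apply, Fin.sum_univ_two] <;> assumption
  · rw [toMat_kEmb]
    ext i j
    fin_cases i <;> fin_cases j <;> simp [kMat, h0, h1, e1, e2]
    apply inv_eq_of_mul_eq_one_right
    linear_combination hd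

/-- The polar decomposition of `SU(2,1)`. -/
theorem polar (g : SU21) : ∃ A : Matrix.unitaryGroup (Fin 2) ℂ,
    boost (vCoord (toMat g)).1 (vCoord (toMat g)).2 * kEmb A = g := by
  obtain ⟨e0, -, -⟩ := entries_of_isom g
  have hne := toMat_22_ne g
  set F := toMat g with hF
  have hn : (‖F 2 2‖ : ℂ) ≠ 0 := by simpa using hne
  have hnn : (‖F 2 2‖ : ℂ) ^ 2 = conj (F 2 2) * F 2 2 := by
    rw [Complex.conj_mul']
  have hr : Real.sqrt (1 + Complex.normSq (vCoord F).1 + Complex.normSq (vCoord F).2)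
      = ‖F 2 2‖ := by
    rw [Real.sqrt_eq_iff_mul_self_eq_of_pos (by simpa using hne)]
    have : (‖F 2 2‖ * ‖F 2 2‖ : ℂ) =
        1 + (Complex.normSq (vCoord F).1 : ℂ) + (Complex.normSq (vCoord F).2 : ℂ) := by
      rw [← Complex.mul_conj, ← Complex.mul_conj]
      simp [vCoord]
      field_simp
      linear_combination ((‖F 2 2‖ : ℂ) ^ 2 - 1 + conj (F 2 2) * F 2 2) * hnn -
        (conj (F 2 2) * F 2 2) * e0
    exact_mod_cast this
  have hn1 : (1 + (‖F 2 2‖ : ℂ)) ≠ 0 := by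
    have := norm_nonneg (F 2 2)
    norm_cast
    linarith
  have key : ∃ A : Matrix.unitaryGroup (Fin 2) ℂ,
      kEmb A = boost (-(vCoord F).1) (-(vCoord F).2) * g := by
    apply mem_subK_of_entries
    · rw [toMat_mul, toMat_boost, ← hF]
      simp only [boostMat, Matrix.mul_apply, Fin.sum_univ_three, Complex.normSq_neg, hr]
      simp [vCoord]
      field_simp
      linear_combination (F 0 2) * ((1 + (‖F 2 2‖ : ℂ) - conj (F 2 2) * F 2 2) * hnn +
        (conj (F 2 2) * F 2 2) * e0)
    · rw [toMat_mul, toMat_boost, ← hF]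
      simp only [boostMat, Matrix.mul_apply, Fin.sum_univ_three, Complex.normSq_neg, hr]
      simp [vCoord]
      field_simp
      linear_combination (F 1 2) * ((1 + (‖F 2 2‖ : ℂ) - conj (F 2 2) * F 2 2) * hnn +
        (conj (F 2 2) * F 2 2) * e0)
  obtain ⟨A, hA⟩ := key
  refine ⟨A, ?_⟩
  rw [hA, ← boost_inv, mul_inv_cancel_left]

theorem vCoord_mul_block (F D : Matrix (Fin 3) (Fin 3) ℂ) (h0 : D 0 2 = 0) (h1 : D 1 2 = 0)
    (h2 : conj (D 2 2) * D 2 2 = 1) : vCoord (F * D) = vCoord F := by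
  have hn : ‖D 2 2‖ = 1 := by
    rw [Complex.conj_mul'] at h2
    have h3 : ‖D 2 2‖ ^ 2 = 1 := by exact_mod_cast h2
    nlinarith [norm_nonneg (D 2 2)]
  have e : ∀ i, (F * D) i 2 = F i 2 * D 2 2 := by
    intro i
    simp [Matrix.mul_apply, Fin.sum_univ_three, h0, h1]
  simp only [vCoord, e, map_mul, norm_mul, hn, mul_one]
  ext1
  · linear_combination (F 0 2 * (conj (F 2 2) / (‖F 2 2‖ : ℂ))) * h2
  · linear_combination (F 1 2 * (conj (F 2 2) / (‖F 2 2‖ : ℂ))) * h2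

theorem vCoord_mul_kEmb (g : SU21) (A : Matrix.unitaryGroup (Fin 2) ℂ) :
    vCoord (toMat (g * kEmb A)) = vCoord (toMat g) := by
  rw [toMat_mul]
  have h0 : toMat (kEmb A) 0 2 = 0 := by rw [toMat_kEmb]; simp [kMat]
  have h1 : toMat (kEmb A) 1 2 = 0 := by rw [toMat_kEmb]; simp [kMat]
  refine vCoord_mul_block _ _ h0 h1 ?_
  obtain ⟨h, -, -⟩ := entries_of_isom (kEmb A)
  rw [h0, h1] at h
  linear_combination -h

theorem kPart_mul_circle (F : Matrix (Fin 3) (Fin 3) ℂ) (z : Circle) :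
    vCoord (F * circleMat z) = vCoord F ∧ kPart (F * circleMat z) 0 0 = kPart F 0 0 * z ∧
      kPart (F * circleMat z) 1 1 = kPart F 1 1 * z ∧
      kPart (F * circleMat z) 1 0 = kPart F 1 0 * z := by
  have hv : vCoord (F * circleMat z) = vCoord F := by
    apply vCoord_mul_block
    · simp [circleMat]
    · simp [circleMat]
    · have h := conj_mul_circle z
      simp only [circleMat, Matrix.of_apply, Matrix.cons_val', Matrix.cons_val, map_inv₀, map_pow]
      rw [← mul_inv, ← mul_pow, h]; simp
  have hk : kPart (F * circleMat z) = kPart F * circleMat z := by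
    rw [kPart, hv, ← Matrix.mul_assoc, kPart]
  rw [hk]
  refine ⟨hv, ?_, ?_, ?_⟩ <;> simp [Matrix.mul_apply, Fin.sum_univ_three, circleMat]

theorem kTrace_mul_circle (F : Matrix (Fin 3) (Fin 3) ℂ) (z : Circle) :
    kTrace (F * circleMat z) = kTrace F * z := by
  obtain ⟨-, h0, h1, -⟩ := kPart_mul_circle F z
  rw [kTrace, kTrace, h0, h1, add_mul]

theorem coords_mul_circle (F : Matrix (Fin 3) (Fin 3) ℂ) (z : Circle) :
    coords (F * circleMat z) = coords F := by
  obtain ⟨hv, h0, h1, h2⟩ := kPart_mul_circle F z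
  have hz : (z : ℂ) ≠ 0 := Circle.coe_ne_zero z
  simp only [coords, hv, h0, h1, h2, kTrace_mul_circle, ← sub_mul, ← mul_assoc,
    mul_div_mul_right _ _ hz]

theorem kPart_boost_mul (p q : ℂ) (A : Matrix.unitaryGroup (Fin 2) ℂ) :
    kPart (toMat (boost p q * kEmb A)) = kMat A := by
  have hv : vCoord (toMat (boost p q * kEmb A)) = (p, q) := by
    rw [vCoord_mul_kEmb, toMat_boost, vCoord_boost]
  rw [kPart, hv, toMat_mul, toMat_boost, ← Matrix.mul_assoc, boostMat_mul_neg, Matrix.one_mul,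
    toMat_kEmb]

theorem vCoord_slice (x : ModelM) : vCoord (toMat (slice x)) = x.1 := by
  rw [slice, rot, vCoord_mul_kEmb, toMat_boost, vCoord_boost]

theorem kTrace_slice (x : ModelM) : kTrace (toMat (slice x)) = 2 * rotScale x.2.1 x.2.2 := by
  rw [kTrace, slice, rot, kPart_boost_mul]
  simp [kMat, rotMat]
  ring

theorem kTrace_slice_ne (x : ModelM) : kTrace (toMat (slice x)) ≠ 0 := by
  rw [kTrace_slice]
  have := (rot_aux x.2.1 x.2.2).1
  simp [this.ne']

theorem coords_slice (x : ModelM) : coords (toMat (slice x)) = x := by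
  have hv := vCoord_slice x
  have ht := kTrace_slice x
  have hn : (rotScale x.2.1 x.2.2 : ℂ) ≠ 0 := by
    have := (rot_aux x.2.1 x.2.2).1
    simp [this.ne']
  rw [coords, hv, ht]
  rw [slice, rot, kPart_boost_mul]
  obtain ⟨⟨p, q⟩, s, w⟩ := x
  have e1 : (rotScale s w * (1 + Complex.I * s) - rotScale s w * (1 - Complex.I * s)) /
      (2 * rotScale s w : ℂ) = Complex.I * s := by
    simp only at hn
    field_simp
    ring
  have e2 : 2 * (rotScale s w * w) / (2 * rotScale s w : ℂ) = w := by
    simp only at hn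
    field_simp
  simp only [kMat, rotMat, Matrix.of_apply, Matrix.cons_val', e1, e2,
    Matrix.cons_val_zero, Matrix.cons_val_one]
  simp

/-- A unitary `2 × 2`-matrix with nonzero trace is a scalar multiple of a matrix `rotMat s w`. -/
theorem unitary_eq (A : Matrix.unitaryGroup (Fin 2) ℂ) (h : A.1 0 0 + A.1 1 1 ≠ 0) :
    ∃ z : Circle, kEmb A = rot ((A.1 0 0 - A.1 1 1) / (A.1 0 0 + A.1 1 1)).im
      (2 * A.1 1 0 / (A.1 0 0 + A.1 1 1)) * circleEmb z := by
  obtain ⟨A, hA⟩ := A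
  have hu := Matrix.mem_unitaryGroup_iff'.1 hA
  have hu' := Matrix.mem_unitaryGroup_iff.1 hA
  have hdd : A.det * conj A.det = 1 := by
    have := congrArg Matrix.det hu'
    rwa [Matrix.det_mul, Matrix.star_eq_conjTranspose, Matrix.det_conjTranspose,
      Matrix.det_one] at this
  have h00 := congrFun (congrFun hu 0) 0
  have k00 := congrFun (congrFun hu' 0) 0
  have k10 := congrFun (congrFun hu' 1) 0
  have k01 := congrFun (congrFun hu' 0) 1
  have k11 := congrFun (congrFun hu' 1) 1
  have hd := Matrix.det_fin_two A
  simp only at h ⊢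
  simp only [Matrix.star_eq_conjTranspose, Matrix.mul_apply, Matrix.conjTranspose_apply,
    Fin.sum_univ_two, RCLike.star_def, Matrix.one_apply_eq, ne_eq, one_ne_zero, not_false_eq_true,
    zero_ne_one, Matrix.one_apply_ne] at h00 k00 k10 k01 k11
  generalize hdet : A.det = δ at *
  generalize ha : A 0 0 = a at *
  generalize hb : A 0 1 = b at *
  generalize hc : A 1 0 = c at *
  generalize hdd' : A 1 1 = d at *
  have e1 : d = conj a * δ := by
    rw [hd]
    linear_combination (-d) * k00 + b * k10
  have e2 : b = -(conj c * δ) := by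
    rw [hd]
    linear_combination d * k01 - b * k11
  have hT : conj (a + d) * δ = a + d := by
    rw [e1]
    simp only [map_add, map_mul, Complex.conj_conj]
    linear_combination a * hdd
  have hD : conj (a - d) * δ = -(a - d) := by
    rw [e1]
    simp only [map_sub, map_mul, Complex.conj_conj]
    linear_combination -a * hdd
  have hsum : (a + d) * conj (a + d) + (a - d) * conj (a - d) + 4 * (c * conj c) = 4 := by
    have : d * conj d = a * conj a := by
      rw [e1]
      simp only [map_mul, Complex.conj_conj]
      linear_combination (a * conj a) * hdd
    simp only [map_add, map_sub]
    linear_combination 2 * this + 4 * h00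
  have hδ : δ ≠ 0 := left_ne_zero_of_mul_eq_one hdd
  generalize hTT : a + d = T at *
  generalize hDD : a - d = D at *
  have hTc : conj T ≠ 0 := by simpa using h
  have hN : (‖T‖ : ℂ) ≠ 0 := by simpa using h
  have hNN : (‖T‖ : ℂ) ^ 2 = conj T * T := by rw [Complex.conj_mul']
  have hs : Complex.I * ((D / T).im : ℂ) = D / T := by
    have hcj : conj (D / T) = -(D / T) := by
      rw [map_div₀, div_eq_iff hTc]
      field_simp
      apply mul_right_cancel₀ hδ
      linear_combination T * hD + D * hT
    have hre : (D / T).re = 0 := by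
      have := congrArg Complex.re hcj
      simp only [Complex.conj_re, Complex.neg_re] at this
      linarith
    apply Complex.ext <;> simp [hre]
  have hDc : D * conj T = - (T * conj D) := by
    apply mul_right_cancel₀ hδ
    linear_combination D * hT + T * hD
  have hn : (rotScale (D / T).im (2 * c / T) : ℂ) = ‖T‖ / 2 := by
    have hT0 : 0 < ‖T‖ := by simpa using h
    have : Real.sqrt (1 + (D / T).im ^ 2 + Complex.normSq (2 * c / T)) = 2 / ‖T‖ := by
      rw [Real.sqrt_eq_iff_mul_self_eq_of_pos (by positivity)]
      have : (2 / ‖T‖ * (2 / ‖T‖) : ℂ) =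
          1 + ((D / T).im : ℂ) ^ 2 + (Complex.normSq (2 * c / T) : ℂ) := by
        have hs2 : ((D / T).im : ℂ) ^ 2 = -(D / T) ^ 2 := by
          have h2 := congrArg (fun x => x ^ 2) hs
          simp only [mul_pow, Complex.I_sq] at h2
          linear_combination -h2
        rw [hs2, ← Complex.mul_conj]
        have : (2 / ‖T‖ * (2 / ‖T‖) : ℂ) = 4 / (conj T * T) := by
          rw [← hNN]; field_simp; norm_num
        rw [this]
        simp only [map_div₀, map_mul, map_ofNat]
        field_simp
        linear_combination (-T) * hsum + D * hDc
      exact_mod_cast this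
    rw [rotScale, this]
    simp
  have hz : T / ‖T‖ ∈ Submonoid.unitSphere ℂ := by
    simp [Submonoid.unitSphere, h]
  obtain ⟨z, hzz⟩ : ∃ z : Circle, (z : ℂ) = T / ‖T‖ := ⟨⟨_, hz⟩, rfl⟩
  refine ⟨z, toMat_injective ?_⟩
  have hz2 : (T / ‖T‖ : ℂ) ^ 2 = δ := by
    rw [div_pow, hNN]
    field_simp
    linear_combination -hT
  rw [toMat_mul, toMat_rot, toMat_kEmb, toMat_circleEmb]
  simp only [kMat, circleMat, det_rotMat, hzz, hz2]
  ext i j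
  fin_cases i <;> fin_cases j <;>
    simp [rotMat, Matrix.mul_apply, Fin.sum_univ_three, hn, hs, ha, hb, hc, hdd', hdet]
  · field_simp
    linear_combination hTT + hDD
  · rw [Complex.conj_ofNat]
    field_simp
    linear_combination conj T * e2 - conj c * hT
  · field_simp
  · field_simp
    linear_combination hTT - hDD

theorem exists_slice (g : SU21) (h : kTrace (toMat g) ≠ 0) :
    ∃ z : Circle, g = slice (coords (toMat g)) * circleEmb z := by
  obtain ⟨A, hA⟩ := polar g
  have hk : kPart (toMat g) = kMat A := by
    conv_lhs => rw [← hA]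
    rw [kPart_boost_mul]
  have ht : kTrace (toMat g) = A.1 0 0 + A.1 1 1 := by
    rw [kTrace, hk]; simp [kMat]
  rw [ht] at h
  obtain ⟨z, hz⟩ := unitary_eq A h
  refine ⟨z, ?_⟩
  rw [slice, coords, ht, hk, mul_assoc]
  simp only [kMat, Matrix.of_apply, Matrix.cons_val', Matrix.cons_val_zero, Matrix.cons_val_one]
  rw [← hz, hA]

section Smoothness

variable {X : Type*} [NormedAddCommGroup X] [NormedSpace ℝ X]

theorem contDiffAt_of_entries {f : X → ℂ} {x : X} (h : ContDiffAt ℝ ∞ f x) :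
    ContDiffAt ℝ ∞ (fun y => conj (f y)) x :=
  Complex.conjCLE.contDiff.contDiffAt.comp x h

theorem contDiffAt_ofReal {f : X → ℝ} {x : X} (h : ContDiffAt ℝ ∞ f x) :
    ContDiffAt ℝ ∞ (fun y => (f y : ℂ)) x :=
  Complex.ofRealCLM.contDiff.contDiffAt.comp x h

theorem contDiffAt_boost {p q : X → ℂ} {x : X} (hp : ContDiffAt ℝ ∞ p x)
    (hq : ContDiffAt ℝ ∞ q x) (i j : Fin 3) :
    ContDiffAt ℝ ∞ (fun y => boostMat (p y) (q y) i j) x := by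
  obtain ⟨r, hr, hr0, -, hr1⟩ := boost_aux (p x) (q x)
  have hns : ∀ {f : X → ℂ}, ContDiffAt ℝ ∞ f x →
      ContDiffAt ℝ ∞ (fun y => Complex.normSq (f y)) x := by
    intro f hf
    simp only [Complex.normSq_eq_norm_sq]
    exact hf.norm_sq ℝ
  have hR : ContDiffAt ℝ ∞ (fun y => ((Real.sqrt (1 + Complex.normSq (p y) +
      Complex.normSq (q y)) : ℝ) : ℂ)) x := by
    apply contDiffAt_ofReal
    apply ContDiffAt.sqrt
    · exact (contDiffAt_const.add (hns hp)).add (hns hq)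
    · intro h0
      rw [h0, Real.sqrt_zero] at hr
      exact hr0.ne hr
  have hR1 : ContDiffAt ℝ ∞ (fun y => (1 + ((Real.sqrt (1 + Complex.normSq (p y) +
      Complex.normSq (q y)) : ℝ) : ℂ))⁻¹) x := by
    apply ContDiffAt.inv (contDiffAt_const.add hR)
    rwa [hr]
  have hpc := contDiffAt_of_entries hp
  have hqc := contDiffAt_of_entries hq
  fin_cases i <;> fin_cases j <;> simp only [boostMat, div_eq_mul_inv] <;> simp <;> fun_prop

theorem contDiffAt_mul {F D : X → Matrix (Fin 3) (Fin 3) ℂ} {x : X}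
    (hF : ∀ i j, ContDiffAt ℝ ∞ (fun y => F y i j) x)
    (hD : ∀ i j, ContDiffAt ℝ ∞ (fun y => D y i j) x) (i j : Fin 3) :
    ContDiffAt ℝ ∞ (fun y => (F y * D y) i j) x := by
  simp only [Matrix.mul_apply]
  exact ContDiffAt.sum fun k _ => (hF i k).mul (hD k j)

theorem contDiffAt_slice (x : ModelM) (i j : Fin 3) :
    ContDiffAt ℝ ∞ (fun y : ModelM => toMat (slice y) i j) x := by
  simp only [slice, toMat_mul, toMat_boost, toMat_rot]
  apply contDiffAt_mul
  · intro i j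
    apply contDiffAt_boost <;> fun_prop
  · intro i j
    have hn : ContDiffAt ℝ ∞ (fun y : ModelM => (rotScale y.2.1 y.2.2 : ℂ)) x := by
      apply contDiffAt_ofReal
      have h0 := (rot_aux x.2.1 x.2.2).1
      unfold rotScale at h0 ⊢
      rw [inv_pos] at h0
      refine ContDiffAt.fun_inv ?_ h0.ne'
      apply ContDiffAt.sqrt
      · simp only [Complex.normSq_eq_norm_sq]
        have : ContDiffAt ℝ ∞ (fun y : ModelM => ‖y.2.2‖ ^ 2) x := by
          apply ContDiffAt.norm_sq ℝ
          fun_prop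
        fun_prop
      · exact (Real.sqrt_pos.1 h0).ne'
    have hs : ContDiffAt ℝ ∞ (fun y : ModelM => (y.2.1 : ℂ)) x := by
      apply contDiffAt_ofReal
      fun_prop
    have hw : ContDiffAt ℝ ∞ (fun y : ModelM => conj (y.2.2)) x := by
      apply contDiffAt_of_entries
      fun_prop
    fin_cases i <;> fin_cases j <;> simp only [kMat, det_rotMat] <;> simp [rotMat] <;> fun_prop

theorem contDiffAt_vCoord {F : X → Matrix (Fin 3) (Fin 3) ℂ} {x : X}
    (hF : ∀ i j, ContDiffAt ℝ ∞ (fun y => F y i j) x) (h0 : F x 2 2 ≠ 0) :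
    ContDiffAt ℝ ∞ (fun y => vCoord (F y)) x := by
  have hn : ContDiffAt ℝ ∞ (fun y => ((‖F y 2 2‖ : ℝ) : ℂ)⁻¹) x := by
    apply ContDiffAt.inv
    · exact contDiffAt_ofReal ((hF 2 2).norm ℝ h0)
    · simpa using h0
  have hc := contDiffAt_of_entries (hF 2 2)
  have h02 := hF 0 2
  have h12 := hF 1 2
  simp only [vCoord, div_eq_mul_inv]
  fun_prop

theorem contDiffAt_kPart {F : X → Matrix (Fin 3) (Fin 3) ℂ} {x : X}
    (hF : ∀ i j, ContDiffAt ℝ ∞ (fun y => F y i j) x) (h0 : F x 2 2 ≠ 0) (i j : Fin 3) :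
    ContDiffAt ℝ ∞ (fun y => kPart (F y) i j) x := by
  have hv := contDiffAt_vCoord hF h0
  apply contDiffAt_mul _ hF
  intro i j
  apply contDiffAt_boost
  · exact hv.fst.neg
  · exact hv.snd.neg

theorem contDiffAt_coords {F : X → Matrix (Fin 3) (Fin 3) ℂ} {x : X}
    (hF : ∀ i j, ContDiffAt ℝ ∞ (fun y => F y i j) x) (h0 : F x 2 2 ≠ 0)
    (h1 : kTrace (F x) ≠ 0) :
    ContDiffAt ℝ ∞ (fun y => coords (F y)) x := by
  have hk := contDiffAt_kPart hF h0
  have h00 := hk 0 0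
  have h11 := hk 1 1
  have h10 := hk 1 0
  have ht : ContDiffAt ℝ ∞ (fun y => (kTrace (F y))⁻¹) x := (h00.add h11).inv h1
  apply (contDiffAt_vCoord hF h0).prodMk
  apply ContDiffAt.prodMk
  · have : ContDiffAt ℝ ∞ (fun y => (kPart (F y) 0 0 - kPart (F y) 1 1) / kTrace (F y)) x := by
      simp only [div_eq_mul_inv]
      fun_prop
    exact Complex.imCLM.contDiff.contDiffAt.comp x this
  · simp only [div_eq_mul_inv]
    fun_prop

end Smoothness

theorem contDiffAt_entry (x : Fin 3 → Fin 3 → ℂ) (i j : Fin 3) :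
    ContDiffAt ℝ ∞ (fun y : Fin 3 → Fin 3 → ℂ => Matrix.of y i j) x := by
  simp only [Matrix.of_apply]
  fun_prop

theorem continuousAt_vCoord (g : SU21) : ContinuousAt (fun a : SU21 => vCoord (toMat a)) g := by
  have h := (contDiffAt_vCoord (contDiffAt_entry (toMat g)) (toMat_22_ne g)).continuousAt
  exact ContinuousAt.comp (f := toMat) (g := vCoord) h continuous_toMat.continuousAt

theorem continuousAt_coords (g : SU21) (h1 : kTrace (toMat g) ≠ 0) :
    ContinuousAt (fun a : SU21 => coords (toMat a)) g := by
  have h := (contDiffAt_coords (contDiffAt_entry (toMat g)) (toMat_22_ne g) h1).continuousAt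
  exact ContinuousAt.comp (f := toMat) (g := coords) h continuous_toMat.continuousAt

theorem continuous_kTrace : Continuous (fun a : SU21 => kTrace (toMat a)) := by
  rw [continuous_iff_continuousAt]
  intro g
  have hk := contDiffAt_kPart (contDiffAt_entry (toMat g)) (toMat_22_ne g)
  have h := ((hk 0 0).add (hk 1 1)).continuousAt
  exact ContinuousAt.comp (f := toMat) (g := kTrace) h continuous_toMat.continuousAt

theorem continuous_ofMat {X : Type*} [TopologicalSpace X] {f : X → SU21}
    (h : ∀ i j, Continuous fun x => toMat (f x) i j) : Continuous f := by
  have h1 : Continuous fun x => ofMat (toMat (f x)) (det_toMat (f x)) (toMat_isom (f x)) :=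
    Continuous.subtype_mk (Continuous.subtype_mk (continuous_matrix h) _) _
  exact h1.congr fun x => toMat_injective rfl

theorem continuous_slice : Continuous slice :=
  continuous_ofMat fun i j =>
    continuous_iff_continuousAt.2 fun x => (contDiffAt_slice x i j).continuousAt

theorem continuous_boost : Continuous fun x : ModelB => boost x.1 x.2 :=
  continuous_ofMat fun i j =>
    continuous_iff_continuousAt.2 fun x => (contDiffAt_boost (p := fun y : ModelB => y.1)
      (q := fun y : ModelB => y.2) (by fun_prop) (by fun_prop) i j).continuousAt

/-- The coordinates near the base point, as a function on the quotient. -/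
def coordsQ : SpaceM → ModelM :=
  Quotient.lift (fun g : SU21 => coords (toMat g)) (by
    intro a b hab
    obtain ⟨z, hz⟩ := QuotientGroup.leftRel_apply.1 hab
    have hb : b = a * circleEmb z := by rw [hz, mul_inv_cancel_left]
    simp only [hb, toMat_mul, toMat_circleEmb, coords_mul_circle])

theorem coordsQ_mk (g : SU21) : coordsQ (g : SpaceM) = coords (toMat g) := rfl

/-- The domain of the coordinates near the base point. -/
def chartDomain : Set SpaceM := (fun g : SU21 => (g : SpaceM)) '' {g | kTrace (toMat g) ≠ 0}

theorem mk_mem_chartDomain (g : SU21) : (g : SpaceM) ∈ chartDomain ↔ kTrace (toMat g) ≠ 0 := by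
  refine ⟨?_, fun h => ⟨g, h, rfl⟩⟩
  rintro ⟨a, ha, hag⟩
  obtain ⟨z, hz⟩ := QuotientGroup.eq.1 hag
  have hb : g = a * circleEmb z := by rw [hz, mul_inv_cancel_left]
  rw [hb, toMat_mul, toMat_circleEmb, kTrace_mul_circle]
  exact mul_ne_zero ha (Circle.coe_ne_zero z)

/-- The coordinate system of `SU(2,1)/S¹` around the base point: its inverse is
`x ↦ slice x · H`. -/
def baseChart : OpenPartialHomeomorph SpaceM ModelM where
  toFun := coordsQ
  invFun x := (slice x : SpaceM)
  source := chartDomain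
  target := Set.univ
  map_source' _ _ := Set.mem_univ _
  map_target' x _ := (mk_mem_chartDomain _).2 (kTrace_slice_ne x)
  left_inv' := by
    rintro _ ⟨g, hg, rfl⟩
    obtain ⟨z, hz⟩ := exists_slice g hg
    change (slice (coords (toMat g)) : SpaceM) = g
    conv_rhs => rw [hz]
    rw [QuotientGroup.mk_mul_of_mem]
    exact ⟨z, rfl⟩
  right_inv' x _ := coords_slice x
  open_source := by
    apply QuotientGroup.isOpenMap_coe
    exact continuous_kTrace.isOpen_preimage _ isOpen_ne
  open_target := isOpen_univ
  continuousOn_toFun := by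
    rintro _ ⟨g, hg, rfl⟩
    apply ContinuousAt.continuousWithinAt
    rw [← QuotientGroup.isOpenQuotientMap_mk.continuousAt_comp_iff]
    exact continuousAt_coords g hg
  continuousOn_invFun :=
    (QuotientGroup.continuous_mk.comp continuous_slice).continuousOn

/-- The translate of the base chart by `a`: its inverse is `x ↦ a · slice x · H`. -/
def chartM (a : SU21) : OpenPartialHomeomorph SpaceM ModelM :=
  (Homeomorph.smul a⁻¹).toOpenPartialHomeomorph.trans baseChart

theorem mk_mem_chartM_source (a g : SU21) :
    (g : SpaceM) ∈ (chartM a).source ↔ kTrace (toMat (a⁻¹ * g)) ≠ 0 := by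
  rw [← mk_mem_chartDomain]
  simp [chartM, baseChart]

theorem chartM_mk (a g : SU21) : chartM a (g : SpaceM) = coords (toMat (a⁻¹ * g)) := rfl

theorem chartM_symm (a : SU21) (x : ModelM) : (chartM a).symm x = (a * slice x : SU21) := by
  change (a⁻¹)⁻¹ • (slice x : SpaceM) = _
  rw [inv_inv]
  rfl

theorem mem_chartM_out (p : SpaceM) : p ∈ (chartM p.out).source := by
  have h1 : slice 0 = 1 := by
    apply toMat_injective
    rw [slice, toMat_mul, toMat_boost, toMat_rot, toMat_one]
    ext i j
    fin_cases i <;> fin_cases j <;>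
      simp [boostMat, kMat, rotMat, rotScale, Matrix.mul_apply, Fin.sum_univ_three,
        Matrix.det_fin_two]
  have h2 := kTrace_slice_ne 0
  rw [h1] at h2
  have key : ∀ g : SU21, (g : SpaceM) ∈ (chartM g).source := by
    intro g
    rwa [mk_mem_chartM_source, inv_mul_cancel]
  have h : (p.out : SpaceM) = p := Quotient.out_eq p
  have h3 := key p.out
  rwa [h] at h3

/-- The usual smooth structure of the homogeneous space `SU(2,1)/S¹`: the inverses of the charts are
the maps `x ↦ a · slice x · H`, where `slice : ModelM → SU(2,1)` is smooth, and `coords` is a smooth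
`H`-invariant left inverse of `slice`. So a function on an open subset of `SU(2,1)/S¹` is smooth if
and only if its composition with the projection from `SU(2,1)` is. -/
instance chartedSpaceM : ChartedSpace ModelM SpaceM where
  atlas := Set.range chartM
  chartAt p := chartM p.out
  mem_chart_source := mem_chartM_out
  chart_mem_atlas p := ⟨p.out, rfl⟩

/-- The changes of charts are smooth. -/
instance isManifoldM : IsManifold (modelWithCornersSelf ℝ ModelM) ∞ SpaceM := by
  apply isManifold_of_contDiffOn
  rintro _ _ ⟨a, rfl⟩ ⟨b, rfl⟩
  intro x hx
  apply ContDiffAt.contDiffWithinAt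
  have hx' : kTrace (toMat (b⁻¹ * (a * slice x))) ≠ 0 := by
    have : (chartM a).symm x ∈ (chartM b).source := by
      have h := hx
      simp at h
      exact h.2
    rwa [chartM_symm, mk_mem_chartM_source] at this
  have heq : (modelWithCornersSelf ℝ ModelM ∘ ((chartM a).symm.trans (chartM b)) ∘
      (modelWithCornersSelf ℝ ModelM).symm) =
      fun y => coords (toMat (b⁻¹ * (a * slice y))) := by
    funext y
    simp only [Function.comp_apply, modelWithCornersSelf_coe, modelWithCornersSelf_coe_symm, id,
      OpenPartialHomeomorph.coe_trans, chartM_symm, chartM_mk]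
  rw [heq]
  refine contDiffAt_coords ?_ (toMat_22_ne _) hx'
  simp only [toMat_mul]
  exact contDiffAt_mul (fun _ _ => contDiffAt_const)
    (contDiffAt_mul (fun _ _ => contDiffAt_const) (contDiffAt_slice x))

/-- The global coordinate on `SU(2,1)/U(2)`; its inverse is `(p, q) ↦ boost p q · K`. -/
def homeoB : SpaceB ≃ₜ ModelB where
  toFun := Quotient.lift (fun g : SU21 => vCoord (toMat g)) (by
    intro a b hab
    obtain ⟨A, hA⟩ := QuotientGroup.leftRel_apply.1 hab
    have hb : b = a * kEmb A := by rw [hA, mul_inv_cancel_left]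
    simp only [hb, vCoord_mul_kEmb])
  invFun x := (boost x.1 x.2 : SpaceB)
  left_inv := by
    intro p
    obtain ⟨g, rfl⟩ := QuotientGroup.mk_surjective p
    obtain ⟨A, hA⟩ := polar g
    change (boost (vCoord (toMat g)).1 (vCoord (toMat g)).2 : SpaceB) = g
    conv_rhs => rw [← hA]
    rw [QuotientGroup.mk_mul_of_mem]
    exact ⟨A, rfl⟩
  right_inv x := vCoord_boost x.1 x.2
  continuous_toFun := by
    rw [continuous_iff_continuousAt]
    intro p
    obtain ⟨g, rfl⟩ := QuotientGroup.mk_surjective p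
    rw [← QuotientGroup.isOpenQuotientMap_mk.continuousAt_comp_iff]
    exact continuousAt_vCoord g
  continuous_invFun := QuotientGroup.continuous_mk.comp continuous_boost

/-- The usual smooth structure of the homogeneous space `SU(2,1)/U(2)`, given by one global chart
(`boost` is smooth, and `vCoord` is a smooth `K`-invariant left inverse of it). -/
instance chartedSpaceB : ChartedSpace ModelB SpaceB :=
  homeoB.toOpenPartialHomeomorph.singletonChartedSpace rfl

instance isManifoldB : IsManifold (modelWithCornersSelf ℝ ModelB) ∞ SpaceB :=
  homeoB.toOpenPartialHomeomorph.isManifold_singleton rfl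

/-- The projection `SU(2,1)/S¹ → SU(2,1)/U(2)`. -/
def projMB : SpaceM → SpaceB := Subgroup.quotientMapOfLE subH_le_subK

/-! ### Lie algebras and the invariant metrics -/

/-- The Lie algebra of a closed subgroup `L` of `SU(2,1)`: the matrices `X` such that `exp (s X)`
lies in `L` for all real `s`. -/
def lieAlg (L : Subgroup SU21) : Set (Matrix (Fin 3) (Fin 3) ℂ) :=
  {X | ∀ s : ℝ, ∃ a ∈ L, toMat a = NormedSpace.exp (s • X)}

/-- The form `B(X, Y) = -Re tr (XY)`. -/
def formB (X Y : Matrix (Fin 3) (Fin 3) ℂ) : ℝ := -(Matrix.trace (X * Y)).re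

/-- `𝔥₀`, the Lie algebra of `H`. -/
def lieH0 : Set (Matrix (Fin 3) (Fin 3) ℂ) := lieAlg subH

/-- `𝔥₁`, the orthogonal complement of `𝔥₀` in the Lie algebra of `K`. -/
def lieH1 : Set (Matrix (Fin 3) (Fin 3) ℂ) :=
  {X ∈ lieAlg subK | ∀ Z ∈ lieAlg subH, formB X Z = 0}

/-- `𝔥₂`, the orthogonal complement of the Lie algebra of `K` in the Lie algebra of `SU(2,1)`. -/
def lieH2 : Set (Matrix (Fin 3) (Fin 3) ℂ) :=
  {X ∈ lieAlg ⊤ | ∀ Z ∈ lieAlg subK, formB X Z = 0}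

/-- `c` is the one-parameter subgroup of `SU(2,1)` generated by `X`. -/
def IsOneParam (c : ℝ → SU21) (X : Matrix (Fin 3) (Fin 3) ℂ) : Prop :=
  ∀ s : ℝ, toMat (c s) = NormedSpace.exp (s • X)

theorem IsOneParam.zero {c : ℝ → SU21} {X : Matrix (Fin 3) (Fin 3) ℂ} (h : IsOneParam c X) :
    c 0 = 1 := by
  apply toMat_injective
  rw [h 0, zero_smul, NormedSpace.exp_zero, toMat_one]

/-- The vector at the base point of `SU(2,1)/L` represented by the generator of a one-parameter
subgroup `c`, i.e. the velocity of the curve `s ↦ c(s) L`. -/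
def generatorAt {E : Type*} [NormedAddCommGroup E] [NormedSpace ℝ E] (L : Subgroup SU21)
    [ChartedSpace E (SU21 ⧸ L)] {c : ℝ → SU21} {X : Matrix (Fin 3) (Fin 3) ℂ}
    (h : IsOneParam c X) : TangentSpace 𝓘(ℝ, E) ((1 : SU21) : SU21 ⧸ L) :=
  velocity (fun s => (c s : SU21 ⧸ L)) ((1 : SU21) : SU21 ⧸ L) (by rw [h.zero])

/-- `g` is the `SU(2,1)`-invariant metric on `SU(2,1)/S¹` which is induced by
`(1 + t) B(X₁, Y₁) + B(X₂, Y₂)` at the base point. -/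
structure IsMetricM (t : ℝ) (g : SemiRiemannianMetric ModelM SpaceM) : Prop where
  invariant : IsInvariantMetric SU21 g
  base (X₀ X₁ X₂ Y₀ Y₁ Y₂ : Matrix (Fin 3) (Fin 3) ℂ)
    (hX₀ : X₀ ∈ lieH0) (hX₁ : X₁ ∈ lieH1) (hX₂ : X₂ ∈ lieH2)
    (hY₀ : Y₀ ∈ lieH0) (hY₁ : Y₁ ∈ lieH1) (hY₂ : Y₂ ∈ lieH2)
    (c d : ℝ → SU21) (hc : IsOneParam c (X₀ + X₁ + X₂)) (hd : IsOneParam d (Y₀ + Y₁ + Y₂)) :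
    g.form ((1 : SU21) : SpaceM) (generatorAt subH hc) (generatorAt subH hd)
      = (1 + t) * formB X₁ Y₁ + formB X₂ Y₂

/-- `h` is the `SU(2,1)`-invariant metric on `SU(2,1)/U(2)` which is induced by `B` at the base
point. -/
structure IsMetricB (h : SemiRiemannianMetric ModelB SpaceB) : Prop where
  invariant : IsInvariantMetric SU21 h
  base (X₀ X₂ Y₀ Y₂ : Matrix (Fin 3) (Fin 3) ℂ)
    (hX₀ : X₀ ∈ lieAlg subK) (hX₂ : X₂ ∈ lieH2) (hY₀ : Y₀ ∈ lieAlg subK) (hY₂ : Y₂ ∈ lieH2)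
    (c d : ℝ → SU21) (hc : IsOneParam c (X₀ + X₂)) (hd : IsOneParam d (Y₀ + Y₂)) :
    h.form ((1 : SU21) : SpaceB) (generatorAt subK hc) (generatorAt subK hd) = formB X₂ Y₂

/-- The upper bound `η(t)` for the curvature bound. -/
def etaBound (t : ℝ) : ℝ :=
  (-3 * t ^ 2 - 2 * t + 5 - Real.sqrt (45 * t ^ 4 + 12 * t ^ 3 - 50 * t ^ 2 + 12 * t + 45)) /
    (16 * (t + 1))

end

/-!
The statements about the metric are reduced to algebra in the Lie algebra by means of the
Maurer–Cartan form `g⁻¹ dg`. The charts of `M = SU(2,1)/S¹` are `a · slice x · H ↦ x`; let `mc` be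
the pullback of this form by `slice`, and `mcM` its component in `𝔥₂ ⊕ 𝔥₁`. Changing the chart
changes `mcM` only by the action `rho` of the isotropy group (`projM_gauge`), which preserves the
form `formQ c`, `c = 1 + t`. Hence the forms `formQ c (mcM x u) (mcM x v)` in the charts fit
together to an invariant metric, the only one with the given value at the base point
(`exists_isFormQ`, `IsMetricM.isFormQ`), and this is its expression in every chart
(`inChart_chartM`). The same argument gives the metric on `SU(2,1)/U(2)` (`exists_isFormP`).

*Curvature.* Let `nomizu c X` be the endomorphism of `𝔥₂ ⊕ 𝔥₁` by which `X` acts in the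
Levi-Civita connection. It is skew and torsion-free, so that the Maurer–Cartan equation
`fderiv_mc` gives the Christoffel symbols (`mcM_christoffel`), and the curvature is
`[Λ(X), Λ(Y)] - Λ([X, Y])` with `Λ = nomizu c` (`mcM_curvatureCoord`). The inequality `R ≥ k` is
then a polynomial inequality for two vectors `u`, `v` (`curvAlg_ge`). Let `n` be half the bracket
of their parts in `𝔥₁`, let `P` and `-τ` be the parts in `𝔥₁` and `𝔥₀` of the bracket of their
parts in `𝔥₂`, and let `ξ` be the squared norm of the component of `u ∧ v` in `𝔥₁ ⊗ 𝔥₂`. Then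
`g(R(u,v)v,u) = 2c |n|² + (2 - 3c/2) |P|² + 6 τ² + (6c - 3c²) n·P - (c²/2) ξ`, and
`g(u,u) g(v,v) - g(u,v)²` is `4c² |n|² + 4 |P|² - 4c ξ`. As `u ∧ v` is decomposable, `ξ + n·P` is
a sum of squares; for `k ≥ c/8` it enters with a nonnegative coefficient, and what is left is a
binary quadratic form in `n` and `P`, which is nonnegative for `k < η(t)` (`etaBound_spec`).

*Completeness.* The momentum `g · inertia(u) · g⁻¹` of a vector `u` at `g H` is conserved exactly
along geodesics: its derivative along a curve is the momentum of the acceleration, by Euler's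
equation (`bracket_inertia`, `IsFormQ.hasDerivAt_momentumAlong`). Now the curve
`b exp(r M) exp(r Z) H` with `M = c v₁ + v₂` and `Z = (1 - c) v₁` has constant momentum and the
initial vector `v`, and it is defined for all `r` (`momentumAlong_geodesicLift`). Curves of the
same constant momentum are integral curves of one vector field, so they agree if they meet
(`eqOn_of_momentumAlong`). Hence every geodesic is part of one of these curves.

*Submersion.* The differential of the projection is the component in `𝔥₂`, up to the isotropy
group of `SU(2,1)/U(2)` (`mfderiv_projMB`); so the vertical and horizontal spaces correspond to
`𝔥₁` and `𝔥₂`. On an integral manifold of the horizontal distribution the `𝔥₁`-component of the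
Maurer–Cartan form would vanish, and then by the Maurer–Cartan equation so would that of
`[𝔥₂, 𝔥₂]`, which is not the case (`not_integrable_horizontal`).

*Fibers.* The fibers are orbits `a K H`, homeomorphic to `K/H` by compactness
(`nonempty_fiber_homeomorph`). The map `SU(2) → K/H` is a covering with two sheets
(`SphereC2.isQuotientCoveringMap_toKH`), and `SU(2)`, the unit sphere in `ℂ²`, is simply
connected: a loop can be approximated by a smooth loop, which misses a point, and the complement
of a point is contractible (`simplyConnectedSpace_sphere`).
-/

noncomputable section

/-! ### Linear algebra of the Lie algebra -/

/-- The `3 × 3` complex matrices. -/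
abbrev Mat : Type := Matrix (Fin 3) (Fin 3) ℂ

/-- The element of `𝔰𝔲(2,1)` with components `((p, q), (s, w)) ∈ 𝔥₂ ⊕ 𝔥₁` and `θ ∈ 𝔥₀`. -/
def lieMat (u : ModelM) (θ : ℝ) : Mat :=
  !![Complex.I * (u.2.1 + θ), -conj u.2.2, u.1.1;
     u.2.2, Complex.I * (-u.2.1 + θ), u.1.2;
     conj u.1.1, conj u.1.2, -(2 * Complex.I * θ)]

/-- The matrices of the Lie algebra `𝔰𝔲(2,1)`. -/
def IsLie (X : Mat) : Prop := Xᴴ * I21 + I21 * X = 0 ∧ X.trace = 0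

/-- The projection of `𝔰𝔲(2,1)` to `𝔥₂ ⊕ 𝔥₁`, in the coordinates of `lieMat`. -/
def projM : Mat →L[ℝ] ModelM :=
  LinearMap.toContinuousLinearMap
    { toFun := fun X => ((X 0 2, X 1 2), (((X 0 0).im - (X 1 1).im) / 2, X 1 0))
      map_add' := by
        intro X Y
        simp only [Matrix.add_apply, Complex.add_im, Prod.mk_add_mk, Prod.mk.injEq, true_and,
          and_true]
        ring
      map_smul' := by
        intro r X
        simp only [Matrix.smul_apply, Complex.smul_im, Prod.smul_mk, RingHom.id_apply,
          Prod.mk.injEq, true_and, and_true, smul_eq_mul]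
        ring }

theorem projM_apply (X : Mat) :
    projM X = ((X 0 2, X 1 2), (((X 0 0).im - (X 1 1).im) / 2, X 1 0)) := rfl

theorem projM_lieMat (u : ModelM) (θ : ℝ) : projM (lieMat u θ) = u := by
  obtain ⟨⟨p, q⟩, s, w⟩ := u
  simp [projM_apply, lieMat]

theorem isLie_lieMat (u : ModelM) (θ : ℝ) : IsLie (lieMat u θ) := by
  obtain ⟨⟨p, q⟩, s, w⟩ := u
  constructor
  · ext i j
    fin_cases i <;> fin_cases j <;>
      simp [lieMat, I21, Matrix.mul_apply, Matrix.diagonal_apply, Complex.conj_ofNat]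
  · simp [Matrix.trace_fin_three, lieMat]
    ring

/-- Every element of the Lie algebra is determined by its coordinates. -/
theorem IsLie.eq_lieMat {X : Mat} (h : IsLie X) : X = lieMat (projM X) (-(X 2 2).im / 2) := by
  obtain ⟨h, ht⟩ := h
  have e : ∀ i j, (Xᴴ * I21 + I21 * X) i j = 0 := fun i j => by rw [h]; rfl
  have e00 := e 0 0
  have e01 := e 0 1
  have e02 := e 0 2
  have e11 := e 1 1
  have e12 := e 1 2
  have e22 := e 2 2
  simp [I21, Matrix.mul_apply, Matrix.diagonal_apply, Complex.ext_iff]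
    at e00 e01 e02 e11 e12 e22
  simp [Matrix.trace_fin_three, Complex.ext_iff] at ht
  ext i j
  fin_cases i <;> fin_cases j <;>
    simp [projM_apply, lieMat, Complex.ext_iff] <;> constructor <;> linarith

/-- All coordinates of an element of `𝔰𝔲(2,1)`. -/
def lieCoord : Mat →ₗ[ℝ] ModelM × ℝ where
  toFun X := (projM X, -(X 2 2).im / 2)
  map_add' X Y := by
    simp only [map_add, Matrix.add_apply, Complex.add_im, Prod.mk_add_mk]
    congr 1
    ring
  map_smul' r X := by
    simp only [map_smul, Matrix.smul_apply, Complex.smul_im, Prod.smul_mk, RingHom.id_apply,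
      smul_eq_mul]
    congr 1
    ring

theorem lieCoord_apply (X : Mat) : lieCoord X = (projM X, -(X 2 2).im / 2) := rfl

theorem lieCoord_lieMat (u : ModelM) (θ : ℝ) : lieCoord (lieMat u θ) = (u, θ) := by
  rw [lieCoord_apply, projM_lieMat]
  simp [lieMat]

/-- The bracket of `𝔰𝔲(2,1)` in coordinates. -/
def lieBracket (X Y : ModelM × ℝ) : ModelM × ℝ :=
  lieCoord (lieMat X.1 X.2 * lieMat Y.1 Y.2 - lieMat Y.1 Y.2 * lieMat X.1 X.2)

/-- The metric on the tangent spaces of `SU(2,1)/S¹`, i.e. the form `c B(X₁, Y₁) + B(X₂, Y₂)` in the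
coordinates of `lieMat`. -/
def formQ (c : ℝ) : ModelM →L[ℝ] ModelM →L[ℝ] ℝ :=
  LinearMap.toContinuousBilinearMap (LinearMap.mk₂ ℝ
    (fun u v : ModelM => 2 * c * (u.2.1 * v.2.1 + (u.2.2.re * v.2.2.re + u.2.2.im * v.2.2.im))
      - 2 * ((u.1.1.re * v.1.1.re + u.1.1.im * v.1.1.im)
        + (u.1.2.re * v.1.2.re + u.1.2.im * v.1.2.im)))
    (by intros; simp; ring) (by intros; simp; ring) (by intros; simp; ring)
    (by intros; simp; ring))

theorem formQ_apply (c : ℝ) (u v : ModelM) : formQ c u v =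
    2 * c * (u.2.1 * v.2.1 + (u.2.2.re * v.2.2.re + u.2.2.im * v.2.2.im))
      - 2 * ((u.1.1.re * v.1.1.re + u.1.1.im * v.1.1.im)
        + (u.1.2.re * v.1.2.re + u.1.2.im * v.1.2.im)) := rfl

theorem formQ_symm (c : ℝ) (u v : ModelM) : formQ c u v = formQ c v u := by
  simp only [formQ_apply]; ring

theorem formQ_nondegenerate {c : ℝ} (hc : 0 < c) (u : ModelM) (h : ∀ v, formQ c u v = 0) :
    u = 0 := by
  obtain ⟨⟨p, q⟩, s, w⟩ := u
  have h1 : 2 * (c * (s ^ 2 + w.re ^ 2 + w.im ^ 2)) +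
      2 * (p.re ^ 2 + p.im ^ 2 + q.re ^ 2 + q.im ^ 2) = 0 := by
    rw [← h ((-p, -q), (s, w))]
    simp only [formQ_apply, Complex.neg_re, Complex.neg_im]
    ring
  have h2 : 0 ≤ c * (s ^ 2 + w.re ^ 2 + w.im ^ 2) := by positivity
  have h3 : 0 ≤ p.re ^ 2 + p.im ^ 2 + q.re ^ 2 + q.im ^ 2 := by positivity
  have h4 : c * (s ^ 2 + w.re ^ 2 + w.im ^ 2) = 0 := by linarith
  have h5 : s ^ 2 + w.re ^ 2 + w.im ^ 2 = 0 := by simpa [hc.ne'] using h4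
  have h6 : p.re ^ 2 + p.im ^ 2 + q.re ^ 2 + q.im ^ 2 = 0 := by linarith
  have key : ∀ {x r : ℝ}, 0 ≤ r → x ^ 2 + r = 0 → x = 0 := fun {x r} h0 h =>
    (pow_eq_zero_iff two_ne_zero).1 (le_antisymm (by linarith) (sq_nonneg x))
  have e1 : s = 0 := key (r := w.re ^ 2 + w.im ^ 2) (by positivity) (by linarith)
  have e2 : w.re = 0 := key (r := s ^ 2 + w.im ^ 2) (by positivity) (by linarith)
  have e3 : w.im = 0 := key (r := s ^ 2 + w.re ^ 2) (by positivity) (by linarith)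
  have e4 : p.re = 0 := key (r := p.im ^ 2 + q.re ^ 2 + q.im ^ 2) (by positivity) (by linarith)
  have e5 : p.im = 0 := key (r := p.re ^ 2 + q.re ^ 2 + q.im ^ 2) (by positivity) (by linarith)
  have e6 : q.re = 0 := key (r := p.re ^ 2 + p.im ^ 2 + q.im ^ 2) (by positivity) (by linarith)
  have e7 : q.im = 0 := key (r := p.re ^ 2 + p.im ^ 2 + q.re ^ 2) (by positivity) (by linarith)
  simp [Complex.ext_iff, Prod.ext_iff, e1, e2, e3, e4, e5, e6, e7]

/-- The action of `h = diag(z, z, z⁻²)` on `𝔥₂ ⊕ 𝔥₁` by `X ↦ h⁻¹ X h`. -/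
def rho (z : Circle) : ModelM →L[ℝ] ModelM :=
  LinearMap.toContinuousLinearMap
    { toFun := fun u => ((conj (z : ℂ) ^ 3 * u.1.1, conj (z : ℂ) ^ 3 * u.1.2), u.2)
      map_add' := by
        intro u v
        simp [mul_add]
      map_smul' := by
        intro r u
        simp [mul_left_comm] }

theorem rho_apply (z : Circle) (u : ModelM) :
    rho z u = ((conj (z : ℂ) ^ 3 * u.1.1, conj (z : ℂ) ^ 3 * u.1.2), u.2) := rfl

/-- The isotropy group `H` acts by isometries, so that the form extends to an invariant metric on
`SU(2,1)/S¹`. -/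
theorem formQ_rho (c : ℝ) (z : Circle) (u v : ModelM) :
    formQ c (rho z u) (rho z v) = formQ c u v := by
  have h3 : conj (conj (z : ℂ) ^ 3) * (conj (z : ℂ) ^ 3) = 1 := by
    have h := conj_mul_circle z
    simp only [map_pow, Complex.conj_conj]
    rw [← mul_pow, mul_comm, h, one_pow]
  obtain ⟨⟨p, q⟩, s, w⟩ := u
  obtain ⟨⟨p', q'⟩, s', w'⟩ := v
  simp only [formQ_apply, rho_apply]
  generalize conj (z : ℂ) ^ 3 = e at h3
  have h4 := congrArg Complex.re h3
  simp only [Complex.mul_re, Complex.mul_im, Complex.conj_re, Complex.conj_im, Complex.one_re]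
    at h4 ⊢
  linear_combination (-2) * (p.re * p'.re + p.im * p'.im + q.re * q'.re + q.im * q'.im) * h4

theorem rho_injective (z : Circle) : Function.Injective (rho z) := by
  rintro ⟨⟨p, q⟩, b⟩ ⟨⟨p', q'⟩, b'⟩ h
  simpa [rho_apply] using h

theorem rho_surjective (z : Circle) : Function.Surjective (rho z) :=
  LinearMap.injective_iff_surjective (f := (rho z : ModelM →ₗ[ℝ] ModelM)).1 (rho_injective z)

/-- The Levi-Civita connection of the invariant metric as a map
`Λ : 𝔤 → End(𝔥₂ ⊕ 𝔥₁)`. In terms of the components,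
`Λ(X) Y = ½ [X₁, Y₁] + ½ [X₂, Y₂]₁ + (1 - c/2) [X₁, Y₂] + (c/2) [X₂, Y₁] + [X₀, Y₂]`. -/
def nomizu (c : ℝ) : (ModelM × ℝ) →L[ℝ] ModelM →L[ℝ] ModelM :=
  LinearMap.toContinuousBilinearMap (LinearMap.mk₂ ℝ
    (fun (X : ModelM × ℝ) (v : ModelM) =>
      (((1 - c / 2 : ℝ) • (X.1.2.1 • (Complex.I * v.1.1) - conj X.1.2.2 * v.1.2)
        - (c / 2) • (v.2.1 • (Complex.I * X.1.1.1) - conj v.2.2 * X.1.1.2)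
        + (3 * X.2) • (Complex.I * v.1.1),
        (1 - c / 2 : ℝ) • (X.1.2.2 * v.1.1 - X.1.2.1 • (Complex.I * v.1.2))
        - (c / 2) • (v.2.2 * X.1.1.1 - v.2.1 • (Complex.I * X.1.1.2))
        + (3 * X.2) • (Complex.I * v.1.2)),
       ((X.1.2.2 * conj v.2.2).im + ((X.1.1.1 * conj v.1.1).im - (X.1.1.2 * conj v.1.2).im) / 2,
        v.2.1 • (Complex.I * X.1.2.2) - X.1.2.1 • (Complex.I * v.2.2)
          + (1 / 2 : ℝ) • (X.1.1.2 * conj v.1.1 - v.1.2 * conj X.1.1.1))))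
    (by intros; ext <;> simp <;> ring) (by intros; ext <;> simp <;> ring)
    (by intros; ext <;> simp <;> ring) (by intros; ext <;> simp <;> ring))

theorem nomizu_apply (c : ℝ) (X : ModelM × ℝ) (v : ModelM) : nomizu c X v =
      (((1 - c / 2 : ℝ) • (X.1.2.1 • (Complex.I * v.1.1) - conj X.1.2.2 * v.1.2)
        - (c / 2) • (v.2.1 • (Complex.I * X.1.1.1) - conj v.2.2 * X.1.1.2)
        + (3 * X.2) • (Complex.I * v.1.1),
        (1 - c / 2 : ℝ) • (X.1.2.2 * v.1.1 - X.1.2.1 • (Complex.I * v.1.2))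
        - (c / 2) • (v.2.2 * X.1.1.1 - v.2.1 • (Complex.I * X.1.1.2))
        + (3 * X.2) • (Complex.I * v.1.2)),
       ((X.1.2.2 * conj v.2.2).im + ((X.1.1.1 * conj v.1.1).im - (X.1.1.2 * conj v.1.2).im) / 2,
        v.2.1 • (Complex.I * X.1.2.2) - X.1.2.1 • (Complex.I * v.2.2)
          + (1 / 2 : ℝ) • (X.1.1.2 * conj v.1.1 - v.1.2 * conj X.1.1.1))) := rfl

/-- The connection is compatible with the metric. -/
theorem nomizu_skew (c : ℝ) (X : ModelM × ℝ) (v w : ModelM) :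
    formQ c (nomizu c X v) w + formQ c v (nomizu c X w) = 0 := by
  simp only [nomizu_apply, formQ_apply]
  simp
  ring

/-- The connection is torsion-free. -/
theorem nomizu_sub (c : ℝ) (X Y : ModelM × ℝ) :
    nomizu c X Y.1 - nomizu c Y X.1 = (lieBracket X Y).1 := by
  simp only [nomizu_apply, lieBracket, lieCoord_apply, projM_apply]
  ext <;> simp [lieMat] <;> ring

/-! ### The algebraic curvature inequality -/

/-- The curvature tensor `R(X, Y) = [Λ(X), Λ(Y)] - Λ([X, Y])` of the connection `nomizu`. -/
def curvAlg (c : ℝ) (X Y : ModelM × ℝ) (w : ModelM) : ModelM :=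
  nomizu c X (nomizu c Y w) - nomizu c Y (nomizu c X w) - nomizu c (lieBracket X Y) w

theorem formQ_curvAlg (c : ℝ) (X Y : ModelM × ℝ) (u v : ModelM) :
    formQ c (curvAlg c X Y v) u = formQ c (nomizu c X v) (nomizu c Y u)
      - formQ c (nomizu c Y v) (nomizu c X u) - formQ c (nomizu c (lieBracket X Y) v) u := by
  have h1 := nomizu_skew c X (nomizu c Y v) u
  have h2 := nomizu_skew c Y (nomizu c X v) u
  simp only [curvAlg, map_sub, _root_.sub_apply] at *
  linarith

/-- The bracket of two elements of `𝔥₂ ⊕ 𝔥₁`, written out. -/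
theorem lieBracket_horizontal (u v : ModelM) : lieBracket (u, 0) (v, 0) =
    (((Complex.I * u.2.1 * v.1.1 - Complex.I * v.2.1 * u.1.1 - conj u.2.2 * v.1.2
        + conj v.2.2 * u.1.2,
       u.2.2 * v.1.1 - v.2.2 * u.1.1 - Complex.I * u.2.1 * v.1.2 + Complex.I * v.2.1 * u.1.2),
      (2 * (u.2.2 * conj v.2.2).im + (u.1.1 * conj v.1.1).im - (u.1.2 * conj v.1.2).im,
       2 * Complex.I * (v.2.1 * u.2.2 - u.2.1 * v.2.2) + u.1.2 * conj v.1.1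
        - v.1.2 * conj u.1.1)),
     -((conj u.1.1 * v.1.1 + conj u.1.2 * v.1.2).im)) := by
  simp only [lieBracket, lieCoord_apply, projM_apply]
  ext <;> simp [lieMat] <;> ring

/-- The curvature bound for all planes in `𝔥₂ ⊕ 𝔥₁`. In terms of half the bracket `n` of the
`𝔥₁`-parts, the `𝔥₁`-part `P` and the `𝔥₀`-part `-τ` of the bracket of the `𝔥₂`-parts, and the
squared norm `ξ` of the mixed part of the bivector `u ∧ v`, the difference of the two sides is
`(4kc - c²/2) ξ + 6 τ²` plus a quadratic form in `(n, P)`. By `hk1` the coefficient of `ξ` is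
nonnegative, and `ξ ≥ -n · P`; then `hk` says that the discriminant of the remaining quadratic form
in `(n, P)` is nonpositive. -/
theorem curvAlg_ge {c k : ℝ} (hc : 0 < c) (hc2 : c < 2 / 5) (hk1 : c / 8 ≤ k) (hk2 : 2 * k < 1)
    (hk : c * (6 - 5 / 2 * c - 4 * k) ^ 2 ≤ 8 * (1 - 2 * k * c) * (2 - 3 / 2 * c - 4 * k))
    (u v : ModelM) :
    k * (formQ c u u * formQ c v v - formQ c u v ^ 2) ≤
      formQ c (curvAlg c (u, 0) (v, 0) v) u := by
  rw [formQ_curvAlg]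
  obtain ⟨⟨⟨p₁, p₂⟩, ⟨q₁, q₂⟩⟩, s, ⟨w₁, w₂⟩⟩ := u
  obtain ⟨⟨⟨p₁', p₂'⟩, ⟨q₁', q₂'⟩⟩, s', ⟨w₁', w₂'⟩⟩ := v
  -- `n` is half the bracket of the vertical parts
  obtain ⟨n₁, hn₁⟩ : ∃ x, x = w₂ * w₁' - w₁ * w₂' := ⟨_, rfl⟩
  obtain ⟨n₂, hn₂⟩ : ∃ x, x = s * w₂' - s' * w₂ := ⟨_, rfl⟩
  obtain ⟨n₃, hn₃⟩ : ∃ x, x = s' * w₁ - s * w₁' := ⟨_, rfl⟩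
  -- `P` is the vertical part of the bracket of the horizontal parts
  obtain ⟨P₁, hP₁⟩ : ∃ x, x = p₂ * p₁' - p₁ * p₂' - (q₂ * q₁' - q₁ * q₂') := ⟨_, rfl⟩
  obtain ⟨P₂, hP₂⟩ : ∃ x, x = q₁ * p₁' + q₂ * p₂' - (q₁' * p₁ + q₂' * p₂) := ⟨_, rfl⟩
  obtain ⟨P₃, hP₃⟩ : ∃ x, x = q₂ * p₁' - q₁ * p₂' - (q₂' * p₁ - q₁' * p₂) := ⟨_, rfl⟩
  -- `-τ` is the `𝔥₀`-part of the bracket of the horizontal parts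
  obtain ⟨τ, hτ⟩ : ∃ x, x = p₁ * p₂' - p₂ * p₁' + q₁ * q₂' - q₂ * q₁' := ⟨_, rfl⟩
  -- `ξ` is the squared norm of the component of `u ∧ v` in `𝔥₁ ⊗ 𝔥₂`
  obtain ⟨ξ, hξ⟩ : ∃ x, x =
    (s ^ 2 + w₁ ^ 2 + w₂ ^ 2) * (p₁' ^ 2 + p₂' ^ 2 + q₁' ^ 2 + q₂' ^ 2)
    + (s' ^ 2 + w₁' ^ 2 + w₂' ^ 2) * (p₁ ^ 2 + p₂ ^ 2 + q₁ ^ 2 + q₂ ^ 2)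
    - 2 * (s * s' + w₁ * w₁' + w₂ * w₂') * (p₁ * p₁' + p₂ * p₂' + q₁ * q₁' + q₂ * q₂') :=
    ⟨_, rfl⟩
  have hR : formQ c (nomizu c (((⟨p₁, p₂⟩, ⟨q₁, q₂⟩), s, ⟨w₁, w₂⟩), 0)
        ((⟨p₁', p₂'⟩, ⟨q₁', q₂'⟩), s', ⟨w₁', w₂'⟩))
        (nomizu c (((⟨p₁', p₂'⟩, ⟨q₁', q₂'⟩), s', ⟨w₁', w₂'⟩), 0)
        ((⟨p₁, p₂⟩, ⟨q₁, q₂⟩), s, ⟨w₁, w₂⟩))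
      - formQ c (nomizu c (((⟨p₁', p₂'⟩, ⟨q₁', q₂'⟩), s', ⟨w₁', w₂'⟩), 0)
        ((⟨p₁', p₂'⟩, ⟨q₁', q₂'⟩), s', ⟨w₁', w₂'⟩))
        (nomizu c (((⟨p₁, p₂⟩, ⟨q₁, q₂⟩), s, ⟨w₁, w₂⟩), 0)
        ((⟨p₁, p₂⟩, ⟨q₁, q₂⟩), s, ⟨w₁, w₂⟩))
      - formQ c (nomizu c (lieBracket (((⟨p₁, p₂⟩, ⟨q₁, q₂⟩), s, ⟨w₁, w₂⟩), 0)
        (((⟨p₁', p₂'⟩, ⟨q₁', q₂'⟩), s', ⟨w₁', w₂'⟩), 0))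
        ((⟨p₁', p₂'⟩, ⟨q₁', q₂'⟩), s', ⟨w₁', w₂'⟩))
        ((⟨p₁, p₂⟩, ⟨q₁, q₂⟩), s, ⟨w₁, w₂⟩) =
      2 * c * (n₁ ^ 2 + n₂ ^ 2 + n₃ ^ 2) + (2 - 3 / 2 * c) * (P₁ ^ 2 + P₂ ^ 2 + P₃ ^ 2)
      + 6 * τ ^ 2 + (6 * c - 3 * c ^ 2) * (n₁ * P₁ + n₂ * P₂ + n₃ * P₃) - c ^ 2 / 2 * ξ := by
    subst hn₁ hn₂ hn₃ hP₁ hP₂ hP₃ hτ hξ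
    simp only [nomizu_apply, formQ_apply, lieBracket_horizontal]
    simp
    ring
  rw [hR]
  have hG : formQ c ((⟨p₁, p₂⟩, ⟨q₁, q₂⟩), s, ⟨w₁, w₂⟩) ((⟨p₁, p₂⟩, ⟨q₁, q₂⟩), s, ⟨w₁, w₂⟩) *
      formQ c ((⟨p₁', p₂'⟩, ⟨q₁', q₂'⟩), s', ⟨w₁', w₂'⟩)
        ((⟨p₁', p₂'⟩, ⟨q₁', q₂'⟩), s', ⟨w₁', w₂'⟩) -
      formQ c ((⟨p₁, p₂⟩, ⟨q₁, q₂⟩), s, ⟨w₁, w₂⟩)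
        ((⟨p₁', p₂'⟩, ⟨q₁', q₂'⟩), s', ⟨w₁', w₂'⟩) ^ 2 =
      4 * c ^ 2 * (n₁ ^ 2 + n₂ ^ 2 + n₃ ^ 2) + 4 * (P₁ ^ 2 + P₂ ^ 2 + P₃ ^ 2) - 4 * c * ξ := by
    subst hn₁ hn₂ hn₃ hP₁ hP₂ hP₃ hξ
    simp only [formQ_apply]
    ring
  rw [hG]
  -- As `u ∧ v` is decomposable, `n · P` is a quadratic form in its component in `𝔥₁ ⊗ 𝔥₂`, and
  -- adding the squared norm `ξ` of this component gives a sum of squares.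
  have hξν : 0 ≤ ξ + (n₁ * P₁ + n₂ * P₂ + n₃ * P₃) := by
    have : 2 * (ξ + (n₁ * P₁ + n₂ * P₂ + n₃ * P₃)) =
        ((s * p₁' - s' * p₁) + (w₁ * q₂' - w₁' * q₂)) ^ 2
        + ((s * p₂' - s' * p₂) - (w₁ * q₁' - w₁' * q₁)) ^ 2
        + ((s * q₁' - s' * q₁) + (w₁ * p₂' - w₁' * p₂)) ^ 2
        + ((s * q₂' - s' * q₂) - (w₁ * p₁' - w₁' * p₁)) ^ 2
        + ((s * p₁' - s' * p₁) - (w₂ * q₁' - w₂' * q₁)) ^ 2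
        + ((s * p₂' - s' * p₂) - (w₂ * q₂' - w₂' * q₂)) ^ 2
        + ((s * q₁' - s' * q₁) + (w₂ * p₁' - w₂' * p₁)) ^ 2
        + ((s * q₂' - s' * q₂) + (w₂ * p₂' - w₂' * p₂)) ^ 2
        + ((w₁ * q₁' - w₁' * q₁) - (w₂ * q₂' - w₂' * q₂)) ^ 2
        + ((w₁ * q₂' - w₁' * q₂) + (w₂ * q₁' - w₂' * q₁)) ^ 2
        + ((w₁ * p₁' - w₁' * p₁) + (w₂ * p₂' - w₂' * p₂)) ^ 2
        + ((w₁ * p₂' - w₁' * p₂) - (w₂ * p₁' - w₂' * p₁)) ^ 2 := by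
      subst hn₁ hn₂ hn₃ hP₁ hP₂ hP₃ hξ
      ring
    have h2 : 0 ≤ 2 * (ξ + (n₁ * P₁ + n₂ * P₂ + n₃ * P₃)) := by
      rw [this]; positivity
    linarith
  clear hR hG hn₁ hn₂ hn₃ hP₁ hP₂ hP₃ hτ hξ
  have hξ' := mul_nonneg (a := 4 * k * c - c ^ 2 / 2) (by nlinarith) hξν
  have hτ := sq_nonneg τ
  have hkc : 4 * k * c < 4 / 5 := by nlinarith
  -- The quadratic form in `(n, P)` which remains after replacing `ξ` by `-n · P`.
  set A := 2 * c - 4 * k * c ^ 2 with hA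
  set D := 2 - 3 / 2 * c - 4 * k with hD
  set g := 6 * c - 5 / 2 * c ^ 2 - 4 * k * c with hg
  have hA0 : 0 < A := by nlinarith
  have hgAD : 0 ≤ A * D - g ^ 2 / 4 := by
    have h := mul_le_mul_of_nonneg_left hk hc.le
    have e : A * D - g ^ 2 / 4 = (c * (8 * (1 - 2 * k * c) * (2 - 3 / 2 * c - 4 * k))
        - c * (c * (6 - 5 / 2 * c - 4 * k) ^ 2)) / 4 := by
      rw [hA, hD, hg]; ring
    rw [e, ← hD]; linarith
  have hq : 0 ≤ A * (n₁ ^ 2 + n₂ ^ 2 + n₃ ^ 2) + D * (P₁ ^ 2 + P₂ ^ 2 + P₃ ^ 2)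
      + g * (n₁ * P₁ + n₂ * P₂ + n₃ * P₃) := by
    apply nonneg_of_mul_nonneg_right (a := A) _ hA0
    have e : A * (A * (n₁ ^ 2 + n₂ ^ 2 + n₃ ^ 2) + D * (P₁ ^ 2 + P₂ ^ 2 + P₃ ^ 2)
        + g * (n₁ * P₁ + n₂ * P₂ + n₃ * P₃)) =
        (A * n₁ + g / 2 * P₁) ^ 2 + (A * n₂ + g / 2 * P₂) ^ 2 + (A * n₃ + g / 2 * P₃) ^ 2
        + (A * D - g ^ 2 / 4) * (P₁ ^ 2 + P₂ ^ 2 + P₃ ^ 2) := by ring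
    rw [e]; positivity
  rw [hA, hD, hg] at hq
  linarith

/-! ### The bound `η(t)` -/

/-- The conditions on `k` in `curvAlg_ge` hold for `c = 1 + t` and `c / 8 < k < η(t)`. Here `η(t)` is
the smaller root of the quadratic polynomial `(a - 16 c k)² - D` in `k`, where `a = -3c² + 4c + 4` and
`D` is the radicand in `η(t)`.
The discriminant condition in `curvAlg_ge` is weaker than the positivity of this polynomial by a
positive multiple of `4k - c/2`. -/
theorem etaBound_spec {t : ℝ} (ht : -1 < t) (ht' : t < -(3 / 5)) :
    (1 + t) / 8 < etaBound t ∧ ∀ k, (1 + t) / 8 < k → k < etaBound t → 2 * k < 1 ∧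
      (1 + t) * (6 - 5 / 2 * (1 + t) - 4 * k) ^ 2 ≤
        8 * (1 - 2 * k * (1 + t)) * (2 - 3 / 2 * (1 + t) - 4 * k) := by
  obtain ⟨c, rfl⟩ : ∃ c, t = c - 1 := ⟨t + 1, by ring⟩
  have hc : 0 < c := by linarith
  have hc2 : c < 2 / 5 := by linarith
  obtain ⟨a, ha⟩ : ∃ a, a = -3 * c ^ 2 + 4 * c + 4 := ⟨_, rfl⟩
  obtain ⟨D, hD⟩ : ∃ D, D = 45 * (c - 1) ^ 4 + 12 * (c - 1) ^ 3 - 50 * (c - 1) ^ 2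
    + 12 * (c - 1) + 45 := ⟨_, rfl⟩
  have hDa : D = a ^ 2 - 4 * c * (-9 * c ^ 3 + 36 * c ^ 2 - 48 * c + 16) := by
    rw [hD, ha]; ring
  have heta : etaBound (c - 1) = (a - Real.sqrt D) / (16 * c) := by
    rw [etaBound, ← hD, ha]; ring
  have hlt : ∀ k, k < etaBound (c - 1) ↔ Real.sqrt D < a - 16 * c * k := by
    intro k
    rw [heta, lt_div_iff₀ (by linarith)]
    constructor <;> intro h <;> linarith
  have hc3 : 0 < c * (2 - 5 * c) := mul_pos hc (by linarith)
  rw [add_sub_cancel]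
  constructor
  · rw [hlt, Real.sqrt_lt']
    · have e : (a - 16 * c * (c / 8)) ^ 2 - D = 4 * c * ((2 - 5 * c) * (2 - c) * (4 - c)) := by
        rw [hDa, ha]; ring
      have : 0 < 4 * c * ((2 - 5 * c) * (2 - c) * (4 - c)) := by
        have h1 : 0 < 2 - 5 * c := by linarith
        have h2 : 0 < 2 - c := by linarith
        have h3 : 0 < 4 - c := by linarith
        positivity
      linarith
    · rw [ha]; nlinarith
  · intro k hk hk'
    rw [hlt] at hk'
    have hpos : 0 < a - 16 * c * k := lt_of_le_of_lt (Real.sqrt_nonneg D) hk'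
    have hsq : D < (a - 16 * c * k) ^ 2 := (Real.sqrt_lt' hpos).1 hk'
    have hk2 : 2 * k < 1 := by
      by_contra! hcon
      have h1 : (a - 16 * c * k) ^ 2 ≤ (a - 8 * c) ^ 2 := by
        apply pow_le_pow_left₀ hpos.le
        nlinarith
      have e : (a - 8 * c) ^ 2 - D = -(12 * c ^ 2 * ((4 - c) * (4 - 3 * c))) := by
        rw [hDa, ha]; ring
      have : 0 < 12 * c ^ 2 * ((4 - c) * (4 - 3 * c)) := by
        have h2 : 0 < 4 - 3 * c := by linarith
        have h3 : 0 < 4 - c := by linarith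
        positivity
      linarith
    refine ⟨hk2, ?_⟩
    have h1 : 0 < 4 * c ^ 2 * (4 * k - c / 2) * (12 - 11 / 2 * c - 4 * k) :=
      mul_pos (mul_pos (by positivity) (by linarith)) (by linarith)
    have e : 4 * c * (8 * (1 - 2 * k * c) * (2 - 3 / 2 * c - 4 * k)
        - c * (6 - 5 / 2 * c - 4 * k) ^ 2) =
        ((a - 16 * c * k) ^ 2 - D) + 4 * c ^ 2 * (4 * k - c / 2) * (12 - 11 / 2 * c - 4 * k) := by
      rw [hDa, ha]; ring
    have h2 : 0 < 4 * c * (8 * (1 - 2 * k * c) * (2 - 3 / 2 * c - 4 * k)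
        - c * (6 - 5 / 2 * c - 4 * k) ^ 2) := by rw [e]; linarith
    have h3 := (pos_iff_pos_of_mul_pos h2).1 (by linarith)
    linarith

section MaurerCartan

open scoped Matrix.Norms.Operator

/-! ### Curves in `SU(2,1)` -/

/-- A matrix entry as a continuous real-linear map. -/
def entryL (i j : Fin 3) : Mat →L[ℝ] ℂ :=
  LinearMap.toContinuousLinearMap (Matrix.entryLinearMap ℝ ℂ i j)

/-- The conjugate transpose as a continuous real-linear map. -/
def conjTransposeL : Mat →L[ℝ] Mat :=
  LinearMap.toContinuousLinearMap
    { toFun := fun X => Xᴴ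
      map_add' := fun X Y => Matrix.conjTranspose_add X Y
      map_smul' := fun r X => by simp [Matrix.conjTranspose_smul] }

theorem hasDerivAt_entry {F : ℝ → Mat} {F' : Mat} {s : ℝ} (h : HasDerivAt F F' s) (i j : Fin 3) :
    HasDerivAt (fun r => F r i j) (F' i j) s :=
  (entryL i j).hasFDerivAt.comp_hasDerivAt s h

/-- The curve is a linear combination of the matrix units, with its entries as coefficients. -/
theorem hasDerivAt_of_entries {F : ℝ → Mat} {F' : Mat} {s : ℝ}
    (h : ∀ i j, HasDerivAt (fun r => F r i j) (F' i j) s) : HasDerivAt F F' s := by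
  have hF : DifferentiableAt ℝ F s := by
    have e : F = fun y => ∑ i, ∑ j, (LinearMap.toContinuousLinearMap
        ((Matrix.singleLinearMap ℝ i j : ℂ →ₗ[ℝ] Mat))) (F y i j) := by
      funext y
      conv_lhs => rw [Matrix.matrix_eq_sum_single (F y)]
      rfl
    rw [e]
    exact DifferentiableAt.fun_sum fun i _ => DifferentiableAt.fun_sum fun j _ =>
      (ContinuousLinearMap.differentiableAt _).comp s (h i j).differentiableAt
  have e : deriv F s = F' := by
    ext i j
    exact (hasDerivAt_entry hF.hasDerivAt i j).unique (h i j)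
  rw [← e]
  exact hF.hasDerivAt

theorem hasDerivAt_conjTranspose {F : ℝ → Mat} {F' : Mat} {s : ℝ} (h : HasDerivAt F F' s) :
    HasDerivAt (fun r => (F r)ᴴ) F'ᴴ s :=
  conjTransposeL.hasFDerivAt.comp_hasDerivAt s h

/-- The derivative of the determinant at the identity is the trace. -/
theorem hasDerivAt_det {F : ℝ → Mat} {F' : Mat} {s : ℝ} (h : HasDerivAt F F' s) (h1 : F s = 1) :
    HasDerivAt (fun r => (F r).det) F'.trace s := by
  have e := hasDerivAt_entry h
  have key := ((((((((e 0 0).mul (e 1 1)).mul (e 2 2)).sub (((e 0 0).mul (e 1 2)).mul (e 2 1))).sub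
    (((e 0 1).mul (e 1 0)).mul (e 2 2))).add (((e 0 1).mul (e 1 2)).mul (e 2 0))).add
    (((e 0 2).mul (e 1 0)).mul (e 2 1))).sub (((e 0 2).mul (e 1 1)).mul (e 2 0)))
  have hd : (fun r => (F r).det) = _ := funext fun r => Matrix.det_fin_three (F r)
  rw [hd]
  refine key.congr_deriv ?_
  simp [h1, Matrix.trace_fin_three]

theorem toMat_inv_mul (g : SU21) : toMat g⁻¹ * toMat g = 1 := by
  rw [← toMat_mul, inv_mul_cancel, toMat_one]

theorem toMat_mul_inv (g : SU21) : toMat g * toMat g⁻¹ = 1 := by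
  rw [← toMat_mul, mul_inv_cancel, toMat_one]

theorem I21_mul_I21 : I21 * I21 = 1 := by
  rw [I21, Matrix.diagonal_mul_diagonal, ← Matrix.diagonal_one]
  congr 1
  ext i
  fin_cases i <;> simp

theorem toMat_inv (g : SU21) : toMat g⁻¹ = I21 * (toMat g)ᴴ * I21 := by
  have h : I21 * (toMat g)ᴴ * I21 * toMat g = 1 := by
    rw [Matrix.mul_assoc, Matrix.mul_assoc, ← Matrix.mul_assoc _ I21, toMat_isom, I21_mul_I21]
  calc toMat g⁻¹ = I21 * (toMat g)ᴴ * I21 * toMat g * toMat g⁻¹ := by rw [h, Matrix.one_mul]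
    _ = _ := by rw [Matrix.mul_assoc, toMat_mul_inv, Matrix.mul_one]

theorem hasDerivAt_toMat_const_mul {g : ℝ → SU21} {G' : Mat} {s : ℝ}
    (h : HasDerivAt (fun r => toMat (g r)) G' s) (a : SU21) :
    HasDerivAt (fun r => toMat (a * g r)) (toMat a * G') s := by
  simp only [toMat_mul]
  exact h.const_mul (toMat a)

theorem hasDerivAt_toMat_inv {g : ℝ → SU21} {G' : Mat} {s : ℝ}
    (h : HasDerivAt (fun r => toMat (g r)) G' s) :
    HasDerivAt (fun r => toMat (g r)⁻¹) (-(toMat (g s)⁻¹ * G' * toMat (g s)⁻¹)) s := by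
  have h1 : DifferentiableAt ℝ (fun r => toMat (g r)⁻¹) s := by
    simp only [toMat_inv]
    exact (((hasDerivAt_conjTranspose h).const_mul I21).mul_const I21).differentiableAt
  have h2 := h1.hasDerivAt.mul h
  have h3 : (fun r => toMat (g r)⁻¹) * (fun r => toMat (g r)) = fun _ => 1 :=
    funext fun r => toMat_inv_mul (g r)
  rw [h3] at h2
  have h4 := h2.unique (hasDerivAt_const s (1 : Mat))
  have h5 : deriv (fun r => toMat (g r)⁻¹) s = -(toMat (g s)⁻¹ * G' * toMat (g s)⁻¹) := by
    calc _ = deriv (fun r => toMat (g r)⁻¹) s * (toMat (g s) * toMat (g s)⁻¹) := by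
          rw [toMat_mul_inv, mul_one]
      _ = _ := by
        rw [← mul_assoc, ← neg_mul]
        exact congrArg (· * toMat (g s)⁻¹) (eq_neg_of_add_eq_zero_left h4)
  rw [← h5]
  exact h1.hasDerivAt

/-- The logarithmic derivative of a curve in `SU(2,1)` lies in the Lie algebra. -/
theorem isLie_of_hasDerivAt {g : ℝ → SU21} {G' : Mat} {s : ℝ}
    (h : HasDerivAt (fun r => toMat (g r)) G' s) : IsLie (toMat (g s)⁻¹ * G') := by
  have hc := hasDerivAt_toMat_const_mul h (g s)⁻¹
  have h1 : toMat ((g s)⁻¹ * g s) = 1 := by rw [inv_mul_cancel, toMat_one]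
  constructor
  · have h2 := ((hasDerivAt_conjTranspose hc).mul_const I21).mul hc
    have h3 : ((fun r => (toMat ((g s)⁻¹ * g r))ᴴ * I21) * fun r => toMat ((g s)⁻¹ * g r)) =
        fun _ => I21 := funext fun r => toMat_isom _
    rw [h3] at h2
    have h4 := h2.unique (hasDerivAt_const s I21)
    simpa only [h1, Matrix.conjTranspose_one, mul_one, one_mul] using h4
  · have h2 := hasDerivAt_det hc h1
    simp only [det_toMat] at h2
    exact h2.unique (hasDerivAt_const s 1)

theorem toMat_circle_inv (z : Circle) : toMat (circleEmb z)⁻¹ = circleMat (conj (z : ℂ)) := by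
  rw [← map_inv, toMat_circleEmb, Circle.coe_inv_eq_conj]

/-- The logarithmic derivative of a curve in `H`. -/
theorem projM_of_mem_subH {g : ℝ → SU21} {G' : Mat} {s : ℝ}
    (h : HasDerivAt (fun r => toMat (g r)) G' s) (hH : ∀ᶠ r in 𝓝 s, g r ∈ subH) :
    projM (toMat (g s)⁻¹ * G') = 0 := by
  have hc := hasDerivAt_toMat_const_mul h (g s)⁻¹
  have hmem : ∀ᶠ r in 𝓝 s, ∃ z : Circle, toMat ((g s)⁻¹ * g r) = circleMat z := by
    filter_upwards [hH] with r hr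
    obtain ⟨z, hz⟩ := mul_mem (inv_mem hH.self_of_nhds) hr
    exact ⟨z, by rw [← hz, toMat_circleEmb]⟩
  have e := hasDerivAt_entry hc
  have e0 : ∀ i j, (∀ z : Circle, circleMat (z : ℂ) i j = 0) → (toMat (g s)⁻¹ * G') i j = 0 := by
    intro i j hij
    apply (e i j).unique
    refine (hasDerivAt_const s (0 : ℂ)).congr_of_eventuallyEq ?_
    filter_upwards [hmem] with r hr
    obtain ⟨z, hz⟩ := hr
    rw [hz, hij]
  have e1 : (toMat (g s)⁻¹ * G') 0 0 = (toMat (g s)⁻¹ * G') 1 1 := by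
    apply (e 0 0).unique
    refine (e 1 1).congr_of_eventuallyEq ?_
    filter_upwards [hmem] with r hr
    obtain ⟨z, hz⟩ := hr
    rw [hz]
    simp [circleMat]
  rw [projM_apply, e1, e0 0 2 (by simp [circleMat]), e0 1 2 (by simp [circleMat]),
    e0 1 0 (by simp [circleMat])]
  simp

theorem circleMat_eq_diagonal (z : ℂ) :
    circleMat z = Matrix.diagonal ![z, z, (z ^ 2)⁻¹] := by
  ext i j
  fin_cases i <;> fin_cases j <;> simp [circleMat]

theorem projM_conj_circle (z : Circle) (X : Mat) :
    projM (toMat (circleEmb z)⁻¹ * X * toMat (circleEmb z)) = rho z (projM X) := by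
  have h := conj_mul_circle z
  have h' : ((z : ℂ) ^ 2)⁻¹ = conj (z : ℂ) ^ 2 := by
    apply inv_eq_of_mul_eq_one_left
    rw [← mul_pow, h, one_pow]
  have h2 : ∀ x : ℂ, conj (z : ℂ) * x * z = x := fun x => by linear_combination x * h
  rw [toMat_circle_inv, toMat_circleEmb, circleMat_eq_diagonal, circleMat_eq_diagonal]
  simp only [projM_apply, rho_apply, Matrix.mul_diagonal, Matrix.diagonal_mul]
  simp only [Matrix.cons_val_zero, Matrix.cons_val_one, Matrix.cons_val, h2, h']
  ext1
  · ext1 <;> ring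
  · rfl

/-- Curves in `SU(2,1)` inducing the same curve in `SU(2,1)/S¹`, up to a translation, have the same
`𝔥₂ ⊕ 𝔥₁`-part of the logarithmic derivative, up to the action of the isotropy group. -/
theorem projM_gauge {g₁ g₂ : ℝ → SU21} {G₁ G₂ : Mat} {s : ℝ}
    (h₁ : HasDerivAt (fun r => toMat (g₁ r)) G₁ s) (h₂ : HasDerivAt (fun r => toMat (g₂ r)) G₂ s)
    (a : SU21) (z : Circle) (hz : g₂ s = a * g₁ s * circleEmb z)
    (hH : ∀ᶠ r in 𝓝 s, (a * g₁ r)⁻¹ * g₂ r ∈ subH) :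
    projM (toMat (g₂ s)⁻¹ * G₂) = rho z (projM (toMat (g₁ s)⁻¹ * G₁)) := by
  have hk : HasDerivAt (fun r => toMat ((a * g₁ r)⁻¹ * g₂ r))
      (-(toMat (a * g₁ s)⁻¹ * (toMat a * G₁) * toMat (a * g₁ s)⁻¹) * toMat (g₂ s) +
        toMat (a * g₁ s)⁻¹ * G₂) s :=
    (hasDerivAt_toMat_inv (hasDerivAt_toMat_const_mul h₁ a)).mul h₂
  have h0 := projM_of_mem_subH hk hH
  have hk0 : (a * g₁ s)⁻¹ * g₂ s = circleEmb z := by rw [hz, inv_mul_cancel_left]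
  have e1 : toMat (a * g₁ s)⁻¹ * (toMat a * G₁) = toMat (g₁ s)⁻¹ * G₁ := by
    rw [← mul_assoc, ← toMat_mul, mul_inv_rev, inv_mul_cancel_right]
  have e2 : toMat (a * g₁ s)⁻¹ * toMat (g₂ s) = toMat (circleEmb z) := by rw [← toMat_mul, hk0]
  have e3 : toMat (circleEmb z)⁻¹ * toMat (a * g₁ s)⁻¹ = toMat (g₂ s)⁻¹ := by
    rw [← toMat_mul, hz, mul_inv_rev (a * g₁ s)]
  rw [hk0, e1, neg_mul, mul_assoc _ _ (toMat (g₂ s)), e2, mul_add, mul_neg, ← mul_assoc _ _ G₂, e3,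
    ← mul_assoc, map_add, map_neg, projM_conj_circle] at h0
  exact (eq_of_neg_add_eq_zero h0).symm

end MaurerCartan

section MaurerCartan

open scoped Matrix.Norms.Operator

/-! ### The Maurer–Cartan form along the slice -/

theorem contDiff_slice_entry (i j : Fin 3) :
    ContDiff ℝ ∞ (fun x : ModelM => toMat (slice x) i j) :=
  contDiff_iff_contDiffAt.2 fun x => contDiffAt_slice x i j

theorem toMat_inv_entry (g : SU21) (i j : Fin 3) :
    toMat g⁻¹ i j = I21 i i * conj (toMat g j i) * I21 j j := by
  rw [toMat_inv, I21, Matrix.mul_diagonal, Matrix.diagonal_mul]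
  simp

theorem contDiff_slice_inv_entry (i j : Fin 3) :
    ContDiff ℝ ∞ (fun x : ModelM => toMat (slice x)⁻¹ i j) := by
  simp only [toMat_inv_entry]
  exact (contDiff_const.mul (Complex.conjCLE.contDiff.comp (contDiff_slice_entry j i))).mul
    contDiff_const

/-- The derivative of `slice` at `x` in the direction `u`. -/
def dSlice (x u : ModelM) : Mat :=
  Matrix.of fun i j => fderiv ℝ (fun y : ModelM => toMat (slice y) i j) x u

theorem dSlice_apply (x u : ModelM) (i j : Fin 3) :
    dSlice x u i j = fderiv ℝ (fun y : ModelM => toMat (slice y) i j) x u := rfl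

theorem hasDerivAt_slice {x : ℝ → ModelM} {x' : ModelM} {s : ℝ} (h : HasDerivAt x x' s) :
    HasDerivAt (fun r => toMat (slice (x r))) (dSlice (x s) x') s :=
  hasDerivAt_of_entries fun i j =>
    ((contDiff_slice_entry i j).differentiable (by simp) (x s)).hasFDerivAt.comp_hasDerivAt s h

/-- The lines through `x`, by means of which directional derivatives are computed. -/
theorem hasDerivAt_line (x u : ModelM) : HasDerivAt (fun r : ℝ => x + r • u) u 0 := by
  simpa using ((hasDerivAt_id (0 : ℝ)).smul_const u).const_add x

theorem isLie_mc (x u : ModelM) : IsLie (toMat (slice x)⁻¹ * dSlice x u) := by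
  simpa using isLie_of_hasDerivAt (hasDerivAt_slice (hasDerivAt_line x u))

/-- The pullback by `slice` of the Maurer–Cartan form `g⁻¹ dg` of `SU(2,1)`, in coordinates. -/
def mc (x : ModelM) : ModelM →L[ℝ] ModelM × ℝ :=
  LinearMap.toContinuousLinearMap
    { toFun := fun u => lieCoord (toMat (slice x)⁻¹ * dSlice x u)
      map_add' := by
        intro u v
        rw [← map_add, ← Matrix.mul_add]
        congr 2
        ext i j
        simp [dSlice_apply]
      map_smul' := by
        intro r u
        rw [RingHom.id_apply, ← map_smul, ← Matrix.mul_smul]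
        congr 2
        ext i j
        simp [dSlice_apply] }

theorem mc_apply (x u : ModelM) : mc x u = lieCoord (toMat (slice x)⁻¹ * dSlice x u) := rfl

theorem lieMat_mc (x u : ModelM) :
    lieMat (mc x u).1 (mc x u).2 = toMat (slice x)⁻¹ * dSlice x u :=
  (isLie_mc x u).eq_lieMat.symm

/-- The `𝔥₂ ⊕ 𝔥₁`-part of the Maurer–Cartan form along the slice. -/
def mcM (x : ModelM) : ModelM →L[ℝ] ModelM := (ContinuousLinearMap.fst ℝ ModelM ℝ).comp (mc x)

theorem mcM_apply (x u : ModelM) : mcM x u = (mc x u).1 := rfl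

theorem mcM_eq_projM (x u : ModelM) : mcM x u = projM (toMat (slice x)⁻¹ * dSlice x u) := rfl

theorem contDiff_mc_entry (u : ModelM) (i j : Fin 3) :
    ContDiff ℝ ∞ (fun x => (toMat (slice x)⁻¹ * dSlice x u) i j) := by
  simp only [Matrix.mul_apply, dSlice_apply]
  exact ContDiff.sum fun k _ => (contDiff_slice_inv_entry i k).mul
    (((contDiff_slice_entry k j).fderiv_right (m := ∞) (by simp)).clm_apply contDiff_const)

theorem contDiff_mc : ContDiff ℝ ∞ mc := by
  rw [contDiff_clm_apply_iff]
  intro u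
  have h := contDiff_mc_entry u
  have him : ∀ i j, ContDiff ℝ ∞ (fun x => ((toMat (slice x)⁻¹ * dSlice x u) i j).im) :=
    fun i j => Complex.imCLM.contDiff.comp (h i j)
  simp only [mc_apply, lieCoord_apply, projM_apply]
  exact (((h 0 2).prodMk (h 1 2)).prodMk ((((him 0 0).sub (him 1 1)).div_const 2).prodMk
    (h 1 0))).prodMk ((him 2 2).neg.div_const 2)

theorem contDiff_mcM : ContDiff ℝ ∞ mcM :=
  contDiff_const.clm_comp contDiff_mc

theorem differentiableAt_mc (x : ModelM) : DifferentiableAt ℝ mc x :=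
  contDiff_mc.differentiable (by simp) x

/-- The coordinates of `a · slice x`. -/
def transCoord (a : SU21) (x : ModelM) : ModelM := coords (toMat (a * slice x))

theorem contDiffAt_transCoord {a : SU21} {x : ModelM} (h : kTrace (toMat (a * slice x)) ≠ 0) :
    ContDiffAt ℝ ∞ (transCoord a) x := by
  refine contDiffAt_coords ?_ (toMat_22_ne _) h
  simp only [toMat_mul]
  exact contDiffAt_mul (fun _ _ => contDiffAt_const) (contDiffAt_slice x)

theorem continuous_kTrace_slice (a : SU21) :
    Continuous fun x : ModelM => kTrace (toMat (a * slice x)) :=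
  continuous_kTrace.comp (continuous_const.mul continuous_slice)

theorem eventually_kTrace_ne {a : SU21} {x : ModelM} (h : kTrace (toMat (a * slice x)) ≠ 0) :
    ∀ᶠ y in 𝓝 x, kTrace (toMat (a * slice y)) ≠ 0 :=
  (continuous_kTrace_slice a).continuousAt.eventually_ne h

/-- The element of `H` relating `a · slice x` to the slice. -/
theorem exists_slice_transCoord {a : SU21} {x : ModelM} (h : kTrace (toMat (a * slice x)) ≠ 0) :
    ∃ z : Circle, slice (transCoord a x) = a * slice x * circleEmb z := by
  obtain ⟨z, hz⟩ := exists_slice _ h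
  refine ⟨z⁻¹, ?_⟩
  rw [map_inv, eq_mul_inv_iff_mul_eq]
  exact hz.symm

/-- The Maurer–Cartan form along the slice is invariant under a change of the chart of
`SU(2,1)/S¹`, up to the action of the isotropy group. -/
theorem mcM_gauge {a : SU21} {x : ModelM} (h : kTrace (toMat (a * slice x)) ≠ 0) {z : Circle}
    (hz : slice (transCoord a x) = a * slice x * circleEmb z) (u : ModelM) :
    mcM (transCoord a x) (fderiv ℝ (transCoord a) x u) = rho z (mcM x u) := by
  have h1 := hasDerivAt_line x u
  have h0 : x + (0 : ℝ) • u = x := by simp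
  have h2 : HasDerivAt (fun r : ℝ => transCoord a (x + r • u)) (fderiv ℝ (transCoord a) x u) 0 := by
    exact ((contDiffAt_transCoord h).differentiableAt
      (by simp)).hasFDerivAt.comp_hasDerivAt_of_eq (0 : ℝ) h1 h0.symm
  have key := projM_gauge (hasDerivAt_slice h1) (hasDerivAt_slice h2) a z
    (by rw [h0]; exact hz) ?_
  · simpa only [h0, ← mcM_eq_projM] using key
  · have h3 : ∀ᶠ r : ℝ in 𝓝 0, kTrace (toMat (a * slice (x + r • u))) ≠ 0 := by
      have := eventually_kTrace_ne h
      rw [← h0] at this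
      exact h1.continuousAt.eventually this
    filter_upwards [h3] with r hr
    obtain ⟨z', hz'⟩ := exists_slice_transCoord hr
    rw [hz', inv_mul_cancel_left]
    exact ⟨z', rfl⟩

theorem slice_zero : slice 0 = 1 := by
  apply toMat_injective
  rw [slice, toMat_mul, toMat_boost, toMat_rot, toMat_one]
  ext i j
  fin_cases i <;> fin_cases j <;>
    simp [boostMat, kMat, rotMat, rotScale, Matrix.mul_apply, Fin.sum_univ_three,
      Matrix.det_fin_two]

theorem hasDerivAt_sqrt_line (n : ℝ) : HasDerivAt (fun r : ℝ => Real.sqrt (1 + r ^ 2 * n)) 0 0 := by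
  have h1 : HasDerivAt (fun r : ℝ => 1 + r ^ 2 * n) 0 0 := by
    simpa using (((hasDerivAt_id (0 : ℝ)).pow 2).mul_const n).const_add 1
  simpa using h1.sqrt (by simp)

theorem hasDerivAt_boost_line (p q : ℂ) :
    HasDerivAt (fun r : ℝ => boostMat (r * p) (r * q)) (lieMat ((p, q), (0, 0)) 0) 0 := by
  obtain ⟨f, hf⟩ : ∃ f : ℝ → ℂ, f = fun r : ℝ => ((Real.sqrt (1 + Complex.normSq (r * p) +
    Complex.normSq (r * q)) : ℝ) : ℂ) := ⟨_, rfl⟩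
  have hf' : HasDerivAt f 0 0 := by
    have := (hasDerivAt_sqrt_line (Complex.normSq p + Complex.normSq q)).ofReal_comp
    simp only [Complex.ofReal_zero] at this
    convert this using 4 with r
    rw [hf]
    simp only [Complex.normSq_mul, Complex.normSq_ofReal]
    congr 2
    ring
  have hf0 : f 0 = 1 := by rw [hf]; simp
  have hr : HasDerivAt (fun r : ℝ => (r : ℂ)) 1 0 := Complex.ofRealCLM.hasDerivAt
  have hg : HasDerivAt (fun r => (1 + f r)⁻¹) 0 0 := by
    have := (hf'.const_add 1).fun_inv (by rw [hf0]; norm_num)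
    simpa using this
  have hl : ∀ a : ℂ, HasDerivAt (fun r : ℝ => (r : ℂ) * a) a 0 := fun a => by
    simpa using hr.mul_const a
  have hq : ∀ a b : ℂ, HasDerivAt (fun r : ℝ => (r * a) * (r * b) * (1 + f r)⁻¹) 0 0 :=
    fun a b => by simpa using ((hl a).fun_mul (hl b)).fun_mul hg
  have e : ∀ r : ℝ, boostMat (r * p) (r * q) =
      !![1 + (r * p) * (r * conj p) * (1 + f r)⁻¹, (r * p) * (r * conj q) * (1 + f r)⁻¹, r * p;
        (r * q) * (r * conj p) * (1 + f r)⁻¹, 1 + (r * q) * (r * conj q) * (1 + f r)⁻¹, r * q;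
        r * conj p, r * conj q, f r] := by
    intro r
    simp only [hf]
    simp only [boostMat, map_mul, Complex.conj_ofReal, div_eq_mul_inv]
  simp only [e]
  apply hasDerivAt_of_entries
  intro i j
  fin_cases i <;> fin_cases j
  · simpa [lieMat] using (hq p (conj p)).const_add 1
  · simpa [lieMat] using hq p (conj q)
  · simpa [lieMat] using hl p
  · simpa [lieMat] using hq q (conj p)
  · simpa [lieMat] using (hq q (conj q)).const_add 1
  · simpa [lieMat] using hl q
  · simpa [lieMat] using hl (conj p)
  · simpa [lieMat] using hl (conj q)
  · simpa [lieMat] using hf'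

theorem hasDerivAt_rot_line (s : ℝ) (w : ℂ) :
    HasDerivAt (fun r : ℝ => kMat (rotMat (r * s) (r * w))) (lieMat ((0, 0), (s, w)) 0) 0 := by
  obtain ⟨f, hf⟩ : ∃ f : ℝ → ℂ, f = fun r => (rotScale (r * s) (r * w) : ℂ) := ⟨_, rfl⟩
  have hf0 : f 0 = 1 := by rw [hf]; simp [rotScale]
  have hf' : HasDerivAt f 0 0 := by
    have h1 := (hasDerivAt_sqrt_line (s ^ 2 + Complex.normSq w)).fun_inv (by simp)
    have h2 := h1.ofReal_comp
    simp only [neg_zero, zero_div, Complex.ofReal_zero] at h2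
    convert h2 using 4 with r
    rw [hf]
    simp only [rotScale, Complex.normSq_mul, Complex.normSq_ofReal]
    congr 3
    ring
  have hr : HasDerivAt (fun r : ℝ => (r : ℂ)) 1 0 := Complex.ofRealCLM.hasDerivAt
  have hl : ∀ a : ℂ, HasDerivAt (fun r : ℝ => f r * (r * a)) a 0 := fun a => by
    simpa [hf0] using hf'.fun_mul (hr.mul_const a)
  have hd : ∀ a : ℂ, HasDerivAt (fun r : ℝ => f r * (1 + r * a)) a 0 := fun a => by
    simpa [hf0] using hf'.fun_mul ((hr.mul_const a).const_add 1)
  have e : ∀ r : ℝ, kMat (rotMat (r * s) (r * w)) =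
      !![f r * (1 + r * (Complex.I * s)), -(f r * (r * conj w)), 0;
         f r * (r * w), f r * (1 + r * -(Complex.I * s)), 0; 0, 0, 1] := by
    intro r
    simp only [kMat, det_rotMat, inv_one, hf]
    ext i j
    fin_cases i <;> fin_cases j <;>
      simp only [rotMat, Complex.ofReal_mul, map_mul, Complex.conj_ofReal] <;> simp <;> ring_nf <;>
      simp
  simp only [e]
  apply hasDerivAt_of_entries
  intro i j
  fin_cases i <;> fin_cases j
  · simpa [lieMat] using hd (Complex.I * s)
  · simpa [lieMat] using (hl (conj w)).fun_neg
  · simpa [lieMat] using hasDerivAt_const (0 : ℝ) (0 : ℂ)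
  · simpa [lieMat] using hl w
  · simpa [lieMat] using hd (-(Complex.I * s))
  · simpa [lieMat] using hasDerivAt_const (0 : ℝ) (0 : ℂ)
  · simpa [lieMat] using hasDerivAt_const (0 : ℝ) (0 : ℂ)
  · simpa [lieMat] using hasDerivAt_const (0 : ℝ) (0 : ℂ)
  · simpa [lieMat] using hasDerivAt_const (0 : ℝ) (1 : ℂ)

/-- At the origin, the slice is tangent to `𝔥₂ ⊕ 𝔥₁`, and the chart is adapted to the coordinates of
`lieMat`. -/
theorem mc_zero (u : ModelM) : mc 0 u = (u, 0) := by
  have h1 := hasDerivAt_slice (hasDerivAt_line 0 u)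
  have h2 := (hasDerivAt_boost_line u.1.1 u.1.2).mul (hasDerivAt_rot_line u.2.1 u.2.2)
  have e : (fun r : ℝ => toMat (slice (0 + r • u))) =
      (fun r : ℝ => boostMat (r * u.1.1) (r * u.1.2)) *
        fun r : ℝ => kMat (rotMat (r * u.2.1) (r * u.2.2)) := by
    funext r
    simp [slice, toMat_mul, toMat_boost, toMat_rot]
  rw [e] at h1
  have h3 := h1.unique h2
  have h4 : boostMat 0 0 = 1 := by
    ext i j
    fin_cases i <;> fin_cases j <;> simp [boostMat]
  have h5 : kMat (rotMat 0 0) = 1 := by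
    have := slice_zero
    have h6 : toMat (slice 0) = boostMat 0 0 * kMat (rotMat 0 0) := rfl
    rw [this, h4, one_mul, toMat_one] at h6
    exact h6.symm
  simp only [zero_smul, add_zero, Complex.ofReal_zero, zero_mul, h4, h5, one_mul, mul_one] at h3
  rw [mc_apply, slice_zero, h3, inv_one, toMat_one, one_mul, ← lieCoord_lieMat]
  congr 1
  obtain ⟨⟨p, q⟩, s, w⟩ := u
  ext i j
  fin_cases i <;> fin_cases j <;> simp [lieMat]

theorem mcM_zero (u : ModelM) : mcM 0 u = u := by
  rw [mcM_apply, mc_zero]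

theorem kTrace_one : kTrace (toMat 1) ≠ 0 := by
  rw [← slice_zero]
  exact kTrace_slice_ne 0

/-- The slice is transversal to the cosets of `H`. -/
theorem mcM_injective (x : ModelM) : Function.Injective (mcM x) := by
  -- `transCoord (slice x)⁻¹` is a local diffeomorphism at `x`, with inverse `transCoord (slice x)`
  have h1 : kTrace (toMat ((slice x)⁻¹ * slice x)) ≠ 0 := by
    rw [inv_mul_cancel]; exact kTrace_one
  have hx : transCoord (slice x)⁻¹ x = 0 := by
    rw [transCoord, inv_mul_cancel, ← slice_zero, coords_slice]
  have h2 : kTrace (toMat (slice x * slice 0)) ≠ 0 := by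
    rw [slice_zero, mul_one]; exact kTrace_slice_ne x
  have hinv : (fun y => transCoord (slice x) (transCoord (slice x)⁻¹ y)) =ᶠ[𝓝 x] id := by
    filter_upwards [eventually_kTrace_ne h1] with y hy
    obtain ⟨z, hz⟩ := exists_slice_transCoord hy
    rw [transCoord, hz, mul_assoc, mul_inv_cancel_left, toMat_mul, toMat_circleEmb, coords_mul_circle,
      coords_slice, id]
  have hd1 := ((contDiffAt_transCoord h1).differentiableAt (by simp)).hasFDerivAt
  have hd2 := ((contDiffAt_transCoord h2).differentiableAt (by simp)).hasFDerivAt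
  rw [← hx] at hd2
  have hd := (hd2.comp x hd1).congr_of_eventuallyEq hinv.symm
  have hid := hd.unique (hasFDerivAt_id x)
  obtain ⟨z, hz⟩ := exists_slice_transCoord h1
  intro u v huv
  have hu := mcM_gauge h1 hz u
  have hv := mcM_gauge h1 hz v
  rw [hx, mcM_zero] at hu hv
  have e : ∀ y, fderiv ℝ (transCoord (slice x)) 0 (fderiv ℝ (transCoord (slice x)⁻¹) x y) = y := by
    intro y
    have := congrArg (fun f => f y) hid
    simpa [hx] using this
  rw [← e u, ← e v, hu, hv, huv]

theorem mcM_surjective (x : ModelM) : Function.Surjective (mcM x) :=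
  LinearMap.injective_iff_surjective (f := (mcM x : ModelM →ₗ[ℝ] ModelM)).1 (mcM_injective x)

theorem fderiv_slice_inv (x u : ModelM) (i j : Fin 3) :
    fderiv ℝ (fun y : ModelM => toMat (slice y)⁻¹ i j) x u =
      -(toMat (slice x)⁻¹ * dSlice x u * toMat (slice x)⁻¹) i j := by
  have h1 := (((contDiff_slice_inv_entry i j).differentiable
    (by simp) x).hasFDerivAt.comp_hasDerivAt_of_eq (0 : ℝ) (hasDerivAt_line x u) (by simp))
  have h2 := hasDerivAt_entry
    (hasDerivAt_toMat_inv (hasDerivAt_slice (hasDerivAt_line x u))) i j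
  have h3 := h1.unique h2
  simpa using h3

/-- The Maurer–Cartan equation. -/
theorem fderiv_mc (x u v : ModelM) :
    fderiv ℝ mc x u v - fderiv ℝ mc x v u = lieBracket (mc x v) (mc x u) := by
  have hS := contDiff_slice_entry
  have hd : ∀ i j, DifferentiableAt ℝ (fderiv ℝ (fun y : ModelM => toMat (slice y) i j)) x :=
    fun i j => ((hS i j).fderiv_right (m := ∞) (by simp)).differentiable (by simp) x
  have hi : ∀ i j, DifferentiableAt ℝ (fun y : ModelM => toMat (slice y)⁻¹ i j) x :=
    fun i j => (contDiff_slice_inv_entry i j).differentiable (by simp) x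
  -- the second derivative of `slice`
  obtain ⟨S₂, hS₂⟩ : ∃ S₂ : ModelM → ModelM → Mat, S₂ = fun u v => Matrix.of fun i j =>
    fderiv ℝ (fderiv ℝ (fun y : ModelM => toMat (slice y) i j)) x u v := ⟨_, rfl⟩
  have hsymm : ∀ u v, S₂ u v = S₂ v u := by
    intro u v
    rw [hS₂]
    ext i j
    exact (hS i j).contDiffAt.isSymmSndFDerivAt (by simp; norm_cast) u v
  have hentry : ∀ u v i j, fderiv ℝ (fun y => (toMat (slice y)⁻¹ * dSlice y v) i j) x u =
      (toMat (slice x)⁻¹ * S₂ u v - toMat (slice x)⁻¹ * dSlice x u *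
        (toMat (slice x)⁻¹ * dSlice x v)) i j := by
    intro u v i j
    have e : (fun y => (toMat (slice y)⁻¹ * dSlice y v) i j) = fun y => ∑ k,
        toMat (slice y)⁻¹ i k * fderiv ℝ (fun y : ModelM => toMat (slice y) k j) y v := by
      funext y
      rw [Matrix.mul_apply]
      rfl
    rw [e, fderiv_fun_sum fun k _ => (hi i k).fun_mul ((hd k j).clm_apply (differentiableAt_const v))]
    rw [← Matrix.mul_assoc, Matrix.sub_apply, Matrix.mul_apply, Matrix.mul_apply,
      ← Finset.sum_sub_distrib, _root_.sum_apply]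
    refine Finset.sum_congr rfl fun k _ => ?_
    rw [fderiv_fun_mul (hi i k) ((hd k j).clm_apply (differentiableAt_const v)),
      fderiv_clm_apply (hd k j) (differentiableAt_const v)]
    simp [fderiv_slice_inv, hS₂, dSlice_apply]
    ring
  have key : ∀ u v, fderiv ℝ mc x u v = lieCoord (toMat (slice x)⁻¹ * S₂ u v -
      toMat (slice x)⁻¹ * dSlice x u * (toMat (slice x)⁻¹ * dSlice x v)) := by
    intro u v
    have h1 : fderiv ℝ mc x u v = fderiv ℝ (fun y => mc y v) x u := by
      rw [fderiv_clm_apply (differentiableAt_mc x) (differentiableAt_const v)]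
      simp
    have hline := hasDerivAt_line x u
    have hm : HasDerivAt (fun r : ℝ => toMat (slice (x + r • u))⁻¹ * dSlice (x + r • u) v)
        (toMat (slice x)⁻¹ * S₂ u v -
          toMat (slice x)⁻¹ * dSlice x u * (toMat (slice x)⁻¹ * dSlice x v)) 0 := by
      apply hasDerivAt_of_entries
      intro i j
      rw [← hentry]
      exact ((contDiff_mc_entry v i j).differentiable
        (by simp) x).hasFDerivAt.comp_hasDerivAt_of_eq (0 : ℝ) hline (by simp)
    have h2 : HasDerivAt (fun r : ℝ => mc (x + r • u) v) _ 0 :=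
      (LinearMap.toContinuousLinearMap lieCoord).hasFDerivAt.comp_hasDerivAt (0 : ℝ) hm
    have h3 := ((differentiableAt_mc x).clm_apply
      (differentiableAt_const v)).hasFDerivAt.comp_hasDerivAt_of_eq (0 : ℝ) hline (by simp)
    rw [h1]
    exact h3.unique h2
  -- the second derivatives of `slice` cancel by symmetry
  rw [key, key, hsymm u v, ← map_sub, lieBracket, lieMat_mc, lieMat_mc]
  congr 1
  abel

theorem fderiv_mcM (x u v : ModelM) : fderiv ℝ mcM x u v = (fderiv ℝ mc x u v).1 := by
  have h : HasFDerivAt mcM _ x :=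
    (hasFDerivAt_const (ContinuousLinearMap.fst ℝ ModelM ℝ) x).clm_comp
      (differentiableAt_mc x).hasFDerivAt
  rw [h.fderiv]
  simp

end MaurerCartan

section LeviCivita

/-! ### The Levi-Civita connection and the curvature in the coordinates of the slice -/

/-- The invariant metric in the coordinates of the slice. -/
def sliceMetric (c : ℝ) (x : ModelM) : ModelM →L[ℝ] ModelM →L[ℝ] ℝ :=
  (formQ c).bilinearComp (mcM x) (mcM x)

theorem sliceMetric_apply (c : ℝ) (x u v : ModelM) :
    sliceMetric c x u v = formQ c (mcM x u) (mcM x v) := rfl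

theorem contDiff_sliceMetric (c : ℝ) : ContDiff ℝ ∞ (sliceMetric c) := by
  rw [contDiff_clm_apply_iff]
  intro u
  rw [contDiff_clm_apply_iff]
  intro v
  simp only [sliceMetric_apply]
  have h : ∀ u, ContDiff ℝ ∞ fun x => mcM x u := fun u => contDiff_mcM.clm_apply contDiff_const
  exact ((formQ c).contDiff.comp (h u)).clm_apply (h v)

theorem sliceMetric_nondegenerate {c : ℝ} (hc : 0 < c) (x u : ModelM)
    (h : ∀ v, sliceMetric c x u v = 0) : u = 0 := by
  apply mcM_injective x
  rw [map_zero]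
  apply formQ_nondegenerate hc
  intro v
  obtain ⟨v, rfl⟩ := mcM_surjective x v
  exact h v

theorem differentiableAt_mcM (x : ModelM) : DifferentiableAt ℝ mcM x :=
  contDiff_mcM.differentiable (by simp) x

theorem fderiv_sliceMetric (c : ℝ) (x z u v : ModelM) :
    fderiv ℝ (sliceMetric c) x z u v =
      formQ c (fderiv ℝ mcM x z u) (mcM x v) + formQ c (mcM x u) (fderiv ℝ mcM x z v) := by
  have hG : DifferentiableAt ℝ (sliceMetric c) x :=
    (contDiff_sliceMetric c).differentiable (by simp) x
  have h1 : fderiv ℝ (sliceMetric c) x z u v = fderiv ℝ (fun y => sliceMetric c y u v) x z := by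
    rw [fderiv_clm_apply (hG.clm_apply (differentiableAt_const u)) (differentiableAt_const v),
      fderiv_clm_apply hG (differentiableAt_const u)]
    simp
  have hm : ∀ u, DifferentiableAt ℝ (fun y => mcM y u) x := fun u =>
    (differentiableAt_mcM x).clm_apply (differentiableAt_const u)
  have hm' : ∀ u, fderiv ℝ (fun y => mcM y u) x z = fderiv ℝ mcM x z u := fun u => by
    rw [fderiv_clm_apply (differentiableAt_mcM x) (differentiableAt_const u)]
    simp
  rw [h1]
  simp only [sliceMetric_apply]
  have hq : DifferentiableAt ℝ (fun y => formQ c (mcM y u)) x :=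
    (formQ c).differentiableAt.comp x (hm u)
  have hq' : fderiv ℝ (fun y => formQ c (mcM y u)) x z = formQ c (fderiv ℝ mcM x z u) := by
    rw [← hm' u]
    have := ((formQ c).hasFDerivAt.comp x (hm u).hasFDerivAt).fderiv
    exact congrArg (fun f => f z) this
  rw [fderiv_clm_apply hq (hm v)]
  simp [hq', hm', add_comm]

theorem fderiv_mcM_sub (x u v : ModelM) : fderiv ℝ mcM x u v - fderiv ℝ mcM x v u =
    (lieBracket (mc x v) (mc x u)).1 := by
  rw [fderiv_mcM, fderiv_mcM, ← fderiv_mc]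
  rfl

/-- The Christoffel symbols are determined by Koszul's formula. -/
theorem christoffel_eq {G : ModelM → ModelM →L[ℝ] ModelM →L[ℝ] ℝ} {x u w γ : ModelM}
    (hG : ∀ u, (∀ v, G x u v = 0) → u = 0)
    (h : ∀ z, 2 * G x γ z = fderiv ℝ G x u w z + fderiv ℝ G x w u z - fderiv ℝ G x z u w) :
    christoffel G x u w = γ := by
  have hinj : Function.Injective (G x) := by
    rw [injective_iff_map_eq_zero]
    intro v hv
    exact hG v fun z => by rw [hv]; rfl
  have hfin : Module.finrank ℝ ModelM = Module.finrank ℝ (ModelM →L[ℝ] ℝ) := by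
    rw [LinearEquiv.finrank_eq (LinearMap.toContinuousLinearMap :
      (ModelM →ₗ[ℝ] ℝ) ≃ₗ[ℝ] (ModelM →L[ℝ] ℝ)).symm]
    exact (Subspace.dual_finrank_eq (K := ℝ) (V := ModelM)).symm
  let e : ModelM ≃L[ℝ] (ModelM →L[ℝ] ℝ) :=
    (LinearEquiv.ofInjectiveOfFinrankEq (G x : ModelM →ₗ[ℝ] (ModelM →L[ℝ] ℝ)) hinj
      hfin).toContinuousLinearEquiv
  have he : G x = (e : ModelM →L[ℝ] (ModelM →L[ℝ] ℝ)) :=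
    ContinuousLinearMap.ext fun v => rfl
  rw [christoffel]
  have hv : ((1 / 2 : ℝ) • (fderiv ℝ G x u w + fderiv ℝ G x w u
    - ((fderiv ℝ G x).flip u).flip w)) = e γ := by
    refine ContinuousLinearMap.ext fun z => ?_
    have h2 := h z
    rw [he] at h2
    simp only [_root_.smul_apply, _root_.sub_apply, _root_.add_apply,
      ContinuousLinearMap.flip_apply, smul_eq_mul]
    rw [← h2]
    change _ = e γ z
    simp
  rw [hv, he, ContinuousLinearMap.inverse_equiv]
  exact e.symm_apply_apply γ

/-- The Levi-Civita connection in terms of the Maurer–Cartan form. -/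
theorem mcM_christoffel {c : ℝ} (hc : 0 < c) (x u w : ModelM) :
    mcM x (christoffel (sliceMetric c) x u w) =
      fderiv ℝ mcM x u w + nomizu c (mc x u) (mcM x w) := by
  obtain ⟨γ, hγ⟩ := mcM_surjective x (fderiv ℝ mcM x u w + nomizu c (mc x u) (mcM x w))
  rw [← hγ]
  congr 1
  apply christoffel_eq (sliceMetric_nondegenerate hc x)
  intro z
  have key : ∀ a b, nomizu c (mc x a) (mcM x b) - nomizu c (mc x b) (mcM x a) =
      fderiv ℝ mcM x b a - fderiv ℝ mcM x a b := fun a b => by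
    rw [fderiv_mcM_sub]
    exact nomizu_sub c (mc x a) (mc x b)
  have skew := nomizu_skew c
  have kuw := congrArg (fun f => formQ c f (mcM x z)) (key u w)
  have kuz := congrArg (fun f => formQ c (mcM x w) f) (key u z)
  have kwz := congrArg (fun f => formQ c (mcM x u) f) (key w z)
  have s1 := skew (mc x u) (mcM x w) (mcM x z)
  have s2 := skew (mc x w) (mcM x u) (mcM x z)
  have s3 := skew (mc x z) (mcM x u) (mcM x w)
  simp only [map_sub, _root_.sub_apply] at kuw kuz kwz
  rw [sliceMetric_apply, hγ]
  simp only [fderiv_sliceMetric, map_add, _root_.add_apply]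
  have c1 := formQ_symm c (nomizu c (mc x z) (mcM x u)) (mcM x w)
  have c2 := formQ_symm c (fderiv ℝ mcM x z u) (mcM x w)
  linarith

/-- The Maurer–Cartan form along the slice as an isomorphism of tangent spaces. -/
def mcEquiv (x : ModelM) : ModelM ≃L[ℝ] ModelM :=
  (LinearEquiv.ofBijective (mcM x : ModelM →ₗ[ℝ] ModelM)
    ⟨mcM_injective x, mcM_surjective x⟩).toContinuousLinearEquiv

theorem mcM_eq_coe (x : ModelM) : mcM x = (mcEquiv x : ModelM →L[ℝ] ModelM) :=
  ContinuousLinearMap.ext fun _ => rfl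

theorem mcM_inverse_apply (x u : ModelM) : (mcM x).inverse (mcM x u) = u := by
  rw [mcM_eq_coe, ContinuousLinearMap.inverse_equiv]
  exact (mcEquiv x).symm_apply_apply u

theorem contDiff_mcM_inverse : ContDiff ℝ ∞ fun x => (mcM x).inverse := by
  rw [contDiff_iff_contDiffAt]
  intro x
  have h : ContDiffAt ℝ ∞ ContinuousLinearMap.inverse (mcM x) := by
    rw [mcM_eq_coe]
    exact contDiffAt_map_inverse (mcEquiv x)
  exact h.comp x contDiff_mcM.contDiffAt

theorem contDiff_fderiv_mcM : ContDiff ℝ ∞ (fderiv ℝ mcM) :=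
  contDiff_mcM.fderiv_right (by simp)

theorem contDiff_nomizu_mc (c : ℝ) (u w : ModelM) :
    ContDiff ℝ ∞ fun x => nomizu c (mc x u) (mcM x w) :=
  ((nomizu c).contDiff.comp (contDiff_mc.clm_apply contDiff_const)).clm_apply
    (contDiff_mcM.clm_apply contDiff_const)

theorem contDiff_christoffel {c : ℝ} (hc : 0 < c) (u w : ModelM) :
    ContDiff ℝ ∞ fun x => christoffel (sliceMetric c) x u w := by
  have e : (fun x => christoffel (sliceMetric c) x u w) = fun x =>
      (mcM x).inverse (fderiv ℝ mcM x u w + nomizu c (mc x u) (mcM x w)) := by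
    funext x
    rw [← mcM_christoffel hc, mcM_inverse_apply]
  rw [e]
  exact contDiff_mcM_inverse.clm_apply
    (((contDiff_fderiv_mcM.clm_apply contDiff_const).clm_apply contDiff_const).add
      (contDiff_nomizu_mc c u w))

theorem fderiv_mc_apply (x u v : ModelM) :
    fderiv ℝ (fun y => mc y v) x u = fderiv ℝ mc x u v := by
  rw [fderiv_clm_apply (differentiableAt_mc x) (differentiableAt_const v)]
  simp

theorem fderiv_mcM_apply (x u v : ModelM) :
    fderiv ℝ (fun y => mcM y v) x u = fderiv ℝ mcM x u v := by
  rw [fderiv_clm_apply (differentiableAt_mcM x) (differentiableAt_const v)]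
  simp

theorem fderiv_nomizu_mc (c : ℝ) (x u v w : ModelM) :
    fderiv ℝ (fun y => nomizu c (mc y v) (mcM y w)) x u =
      nomizu c (fderiv ℝ mc x u v) (mcM x w) + nomizu c (mc x v) (fderiv ℝ mcM x u w) := by
  have h1 : DifferentiableAt ℝ (fun y => mc y v) x :=
    (differentiableAt_mc x).clm_apply (differentiableAt_const v)
  have h2 : DifferentiableAt ℝ (fun y => mcM y w) x :=
    (differentiableAt_mcM x).clm_apply (differentiableAt_const w)
  have h3 : DifferentiableAt ℝ (fun y => nomizu c (mc y v)) x :=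
    (nomizu c).differentiableAt.comp x h1
  have h4 : fderiv ℝ (fun y => nomizu c (mc y v)) x u = nomizu c (fderiv ℝ mc x u v) := by
    rw [← fderiv_mc_apply x u v]
    exact congrArg (fun f => f u) ((nomizu c).hasFDerivAt.comp x h1.hasFDerivAt).fderiv
  rw [fderiv_clm_apply h3 h2]
  simp [h4, fderiv_mcM_apply, add_comm]

/-- The curvature in terms of the Maurer–Cartan form. -/
theorem mcM_curvatureCoord {c : ℝ} (hc : 0 < c) (x u v w : ModelM) :
    mcM x (curvatureCoord (sliceMetric c) x u v w) =
      curvAlg c (mc x u) (mc x v) (mcM x w) := by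
  have hsymm : ∀ u v, fderiv ℝ (fderiv ℝ mcM) x u v = fderiv ℝ (fderiv ℝ mcM) x v u := fun u v =>
    contDiff_mcM.contDiffAt.isSymmSndFDerivAt (by simp; norm_cast) u v
  have hd2 : DifferentiableAt ℝ (fderiv ℝ mcM) x :=
    contDiff_fderiv_mcM.differentiable (by simp) x
  -- the derivative of `mcM_christoffel`
  have key : ∀ u v, mcM x (fderiv ℝ (fun y => christoffel (sliceMetric c) y v w) x u) +
      mcM x (christoffel (sliceMetric c) x u (christoffel (sliceMetric c) x v w)) =
      fderiv ℝ (fderiv ℝ mcM) x u v w + nomizu c (fderiv ℝ mc x u v) (mcM x w)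
        + nomizu c (mc x v) (fderiv ℝ mcM x u w) + nomizu c (mc x u) (fderiv ℝ mcM x v w)
        + nomizu c (mc x u) (nomizu c (mc x v) (mcM x w)) := by
    intro u v
    have hC : DifferentiableAt ℝ (fun y => christoffel (sliceMetric c) y v w) x :=
      (contDiff_christoffel hc v w).differentiable (by simp) x
    have h1 : (fun y => mcM y (christoffel (sliceMetric c) y v w)) =
        fun y => fderiv ℝ mcM y v w + nomizu c (mc y v) (mcM y w) :=
      funext fun y => mcM_christoffel hc y v w
    have h2 := congrArg (fun f => fderiv ℝ f x u) h1
    have h3 : DifferentiableAt ℝ (fun y => fderiv ℝ mcM y v) x :=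
      hd2.clm_apply (differentiableAt_const v)
    rw [fderiv_clm_apply (differentiableAt_mcM x) hC,
      fderiv_fun_add (h3.clm_apply (differentiableAt_const w))
      ((contDiff_nomizu_mc c v w).differentiable (by simp) x),
      fderiv_clm_apply h3 (differentiableAt_const w),
      fderiv_clm_apply hd2 (differentiableAt_const v)] at h2
    simp only [_root_.add_apply, ContinuousLinearMap.comp_apply, ContinuousLinearMap.flip_apply,
      fderiv_fun_const, Pi.zero_apply, _root_.zero_apply, map_zero, zero_add,
      fderiv_nomizu_mc] at h2
    rw [mcM_christoffel hc x u, mcM_christoffel hc x v, map_add, ← add_assoc, ← add_assoc, h2]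
    abel
  rw [curvatureCoord, map_sub, map_add, map_sub]
  have k1 := key u v
  have k2 := key v u
  have k3 : nomizu c (lieBracket (mc x u) (mc x v)) (mcM x w) =
      nomizu c (fderiv ℝ mc x v u) (mcM x w) - nomizu c (fderiv ℝ mc x u v) (mcM x w) := by
    rw [← fderiv_mc, map_sub, _root_.sub_apply]
  rw [curvAlg, k3]
  rw [hsymm] at k1
  calc _ = (mcM x (fderiv ℝ (fun y => christoffel (sliceMetric c) y v w) x u) +
      mcM x (christoffel (sliceMetric c) x u (christoffel (sliceMetric c) x v w))) -
      (mcM x (fderiv ℝ (fun y => christoffel (sliceMetric c) y u w) x v) +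
      mcM x (christoffel (sliceMetric c) x v (christoffel (sliceMetric c) x u w))) := by abel
    _ = _ := by rw [k1, k2]; abel

/-- The curvature bound in the coordinates of the slice. -/
theorem curvatureCoord_ge {t k : ℝ} (ht : -1 < t) (ht' : t < -(3 / 5)) (hk : (1 + t) / 8 < k)
    (hk' : k < etaBound t) (u v : ModelM) :
    k * (formQ (1 + t) u u * formQ (1 + t) v v - formQ (1 + t) u v ^ 2) ≤
      formQ (1 + t) (curvatureCoord (sliceMetric (1 + t)) 0 u v v) u := by
  obtain ⟨h1, h2⟩ := (etaBound_spec ht ht').2 k hk hk'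
  have h3 := curvAlg_ge (c := 1 + t) (k := k) (by linarith) (by linarith) hk.le h1 h2 u v
  have h4 := mcM_curvatureCoord (c := 1 + t) (by linarith) 0 u v v
  rw [mcM_zero, mcM_zero, mc_zero, mc_zero] at h4
  rwa [h4]

end LeviCivita

/-! ### Charts of `SU(2,1)/S¹` -/

theorem chartAt_eq (p : SpaceM) : chartAt ModelM p = chartM p.out := rfl

theorem mk_out (p : SpaceM) : ((p.out : SU21) : SpaceM) = p := Quotient.out_eq p

theorem coords_one : coords (toMat 1) = 0 := by rw [← slice_zero, coords_slice]

theorem chartAt_self (p : SpaceM) : chartAt ModelM p p = 0 := by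
  conv_lhs => rw [chartAt_eq, ← mk_out p, chartM_mk]
  rw [mk_out, inv_mul_cancel, coords_one]

theorem chartAt_symm_zero (p : SpaceM) : (chartAt ModelM p).symm 0 = p := by
  rw [chartAt_eq, chartM_symm, slice_zero, mul_one, mk_out]

section

variable {E F M N : Type*} [NormedAddCommGroup E] [NormedSpace ℝ E] [NormedAddCommGroup F]
  [NormedSpace ℝ F] [TopologicalSpace M] [TopologicalSpace N] [ChartedSpace E M] [ChartedSpace F N]

/-- Tangent spaces are the model space by means of the preferred charts, so the differential is the
derivative of the expression in these charts. -/
theorem mfderiv_eq_fderiv_chart {f : M → N} {p : M} (hf : MDifferentiableAt 𝓘(ℝ, E) 𝓘(ℝ, F) f p) :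
    (mfderiv 𝓘(ℝ, E) 𝓘(ℝ, F) f p : E →L[ℝ] F) =
      fderiv ℝ (chartAt F (f p) ∘ f ∘ (chartAt E p).symm) (chartAt E p p) := by
  simp only [mfderiv, hf, writtenInExtChartAt, mfld_simps]
  rw [fderivWithin_univ]
  rfl

theorem mdifferentiableAt_of_chart {f : M → N} {p : M} (hc : ContinuousAt f p)
    (hf : DifferentiableAt ℝ (chartAt F (f p) ∘ f ∘ (chartAt E p).symm) (chartAt E p p)) :
    MDifferentiableAt 𝓘(ℝ, E) 𝓘(ℝ, F) f p := by
  rw [mdifferentiableAt_iff]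
  refine ⟨hc, ?_⟩
  simp only [writtenInExtChartAt, mfld_simps]
  rw [differentiableWithinAt_univ]
  exact hf

end

/-- The transition from the chart of a translate to the preferred chart at a point, at this point. -/
theorem exists_fderiv_transCoord {a : SU21} {x : ModelM} (h : ((a * slice x : SU21) : SpaceM) = (1 : SU21)) :
    kTrace (toMat (a * slice x)) ≠ 0 ∧
    ∃ z : Circle, ∀ u, fderiv ℝ (transCoord a) x u = rho z (mcM x u) := by
  obtain ⟨z, hz⟩ := QuotientGroup.eq.1 h
  have h1 : a * slice x * circleEmb z = 1 := by rw [hz]; group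
  have hk : kTrace (toMat (a * slice x)) ≠ 0 := by
    intro h0
    apply kTrace_one
    rw [← h1, toMat_mul, toMat_circleEmb, kTrace_mul_circle, h0, zero_mul]
  have h0 : transCoord a x = 0 := by
    rw [transCoord, ← coords_mul_circle _ z, ← toMat_circleEmb, ← toMat_mul, h1, coords_one]
  refine ⟨hk, z, fun u => ?_⟩
  have := mcM_gauge hk (z := z) (by rw [h0, slice_zero, h1]) u
  rwa [h0, mcM_zero] at this

theorem mk_out_inv_mul (a : SU21) :
    (((a : SpaceM).out⁻¹ * a : SU21) : SpaceM) = (1 : SU21) := by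
  rw [eq_comm]
  apply QuotientGroup.eq.2
  rw [inv_one, one_mul]
  exact QuotientGroup.eq.1 (mk_out (a : SpaceM))

/-- The differential of `y ↦ a · slice y · H`, in the preferred chart at the image point, is the
Maurer–Cartan form up to the isotropy group. -/
theorem exists_fderiv_chart (a : SU21) (x : ModelM) :
    DifferentiableAt ℝ (fun y => chartAt ModelM ((a * slice x : SU21) : SpaceM)
      ((a * slice y : SU21) : SpaceM)) x ∧ ∃ z : Circle, ∀ u,
    fderiv ℝ (fun y => chartAt ModelM ((a * slice x : SU21) : SpaceM)
      ((a * slice y : SU21) : SpaceM)) x u = rho z (mcM x u) := by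
  have h := mk_out_inv_mul (a * slice x)
  rw [← mul_assoc] at h
  obtain ⟨h1, z, hz⟩ := exists_fderiv_transCoord h
  have e : (fun y => chartAt ModelM ((a * slice x : SU21) : SpaceM)
      ((a * slice y : SU21) : SpaceM)) =
      transCoord (((a * slice x : SU21) : SpaceM).out⁻¹ * a) := by
    funext y
    rw [chartAt_eq, chartM_mk, transCoord, mul_assoc]
  rw [e]
  exact ⟨(contDiffAt_transCoord h1).differentiableAt (by simp), z, hz⟩

theorem mfderiv_chartM_symm (a : SU21) (x : ModelM) : ∃ z : Circle, ∀ u : ModelM,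
    (mfderiv 𝓘(ℝ, ModelM) 𝓘(ℝ, ModelM) (chartM a).symm x u : ModelM) = rho z (mcM x u) := by
  obtain ⟨hd, z, hz⟩ := exists_fderiv_chart a x
  have e : (chartM a).symm = fun y => ((a * slice y : SU21) : SpaceM) := by
    funext y; exact chartM_symm a y
  refine ⟨z, fun u => ?_⟩
  rw [← hz]
  have hc : Continuous fun y => ((a * slice y : SU21) : SpaceM) :=
    QuotientGroup.continuous_mk.comp (continuous_const.mul continuous_slice)
  rw [e, mfderiv_eq_fderiv_chart]
  · rfl
  · apply mdifferentiableAt_of_chart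
    · exact hc.continuousAt
    · exact hd

theorem smul_chart_symm (c : SU21) (p : SpaceM) :
    chartAt ModelM (c • p) ∘ (fun q : SpaceM => c • q) ∘ (chartAt ModelM p).symm =
      fun y => chartAt ModelM ((c * p.out * slice 0 : SU21) : SpaceM)
        ((c * p.out * slice y : SU21) : SpaceM) := by
  funext y
  have e : ∀ y, ((c * p.out * slice y : SU21) : SpaceM) = c • (chartAt ModelM p).symm y := by
    intro y
    rw [chartAt_eq, chartM_symm, mul_assoc]
    rfl
  rw [e, e, chartAt_symm_zero]
  rfl

theorem mdifferentiableAt_smul (c : SU21) (p : SpaceM) :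
    MDifferentiableAt 𝓘(ℝ, ModelM) 𝓘(ℝ, ModelM) (fun q : SpaceM => c • q) p := by
  apply mdifferentiableAt_of_chart
  · exact (continuous_const_smul c).continuousAt
  · rw [smul_chart_symm, chartAt_self]
    exact (exists_fderiv_chart (c * p.out) 0).1

/-- Under the identification of the tangent spaces with the model space, translations act by elements
of the isotropy group. -/
theorem mfderiv_smul (c : SU21) (p : SpaceM) : ∃ z : Circle, ∀ u : ModelM,
    (mfderiv 𝓘(ℝ, ModelM) 𝓘(ℝ, ModelM) (fun q : SpaceM => c • q) p u : ModelM) = rho z u := by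
  obtain ⟨hd, z, hz⟩ := exists_fderiv_chart (c * p.out) 0
  refine ⟨z, fun u => ?_⟩
  rw [mfderiv_eq_fderiv_chart (mdifferentiableAt_smul c p), smul_chart_symm, chartAt_self]
  exact (hz u).trans (by rw [mcM_zero])

/-- The tangent space at each point is the model space `𝔥₂ ⊕ 𝔥₁` by means of the preferred chart at
this point, a translate of the chart at the base point. In these terms the invariant metric is the
constant form `formQ c`. -/
def IsFormQ (c : ℝ) (g : SemiRiemannianMetric ModelM SpaceM) : Prop :=
  ∀ (p : SpaceM) (u w : TangentSpace 𝓘(ℝ, ModelM) p), g.form p u w = formQ c u w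

/-- In each of the charts, the metric is the pullback of `formQ c` by the Maurer–Cartan form. -/
theorem inChart_chartM {c : ℝ} {g : SemiRiemannianMetric ModelM SpaceM} (hg : IsFormQ c g)
    (a : SU21) : g.inChart (chartM a) = sliceMetric c := by
  funext x
  obtain ⟨z, hz⟩ := mfderiv_chartM_symm a x
  refine ContinuousLinearMap.ext fun u => ContinuousLinearMap.ext fun w => ?_
  refine (hg ((chartM a).symm x) (mfderiv 𝓘(ℝ, ModelM) 𝓘(ℝ, ModelM) (chartM a).symm x u)
    (mfderiv 𝓘(ℝ, ModelM) 𝓘(ℝ, ModelM) (chartM a).symm x w)).trans ?_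
  exact (congrArg₂ (fun a b => formQ c a b) (hz u) (hz w)).trans (formQ_rho _ _ _ _)

theorem IsFormQ.isInvariantMetric {c : ℝ} {g : SemiRiemannianMetric ModelM SpaceM}
    (hg : IsFormQ c g) : IsInvariantMetric SU21 g := by
  intro a p u w
  obtain ⟨z, hz⟩ := mfderiv_smul a p
  rw [hg p]
  exact (hg _ _ _).trans
    ((congrArg₂ (fun a b => formQ c a b) (hz u) (hz w)).trans (formQ_rho _ _ _ _))

theorem IsFormQ.curvatureGE {t k : ℝ} {g : SemiRiemannianMetric ModelM SpaceM}
    (hg : IsFormQ (1 + t) g) (ht : -1 < t) (ht' : t < -(3 / 5)) (hk : (1 + t) / 8 < k)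
    (hk' : k < etaBound t) : g.CurvatureGE k := by
  intro p u v
  have e : g.curvature p u v v = curvatureCoord (sliceMetric (1 + t)) 0 u v v := by
    rw [SemiRiemannianMetric.curvature, chartAt_self, chartAt_eq, inChart_chartM hg]
  rw [hg, hg, hg, hg, e]
  exact curvatureCoord_ge ht ht' hk hk' u v

/-! ### Existence and uniqueness of the metric on `SU(2,1)/S¹` -/

section

variable {E M : Type*} [NormedAddCommGroup E] [NormedSpace ℝ E] [TopologicalSpace M]
  [ChartedSpace E M] [IsManifold 𝓘(ℝ, E) ∞ M]

/-- A field of bilinear forms is smooth if its expressions in the charts are. -/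
theorem contMDiff_form
    (b : ∀ p : M, TangentSpace 𝓘(ℝ, E) p →L[ℝ] TangentSpace 𝓘(ℝ, E) p →L[ℝ] ℝ)
    (h : ∀ p₀ : M, ∃ G : E → E →L[ℝ] E →L[ℝ] ℝ, ContDiff ℝ ∞ G ∧ ∀ x (u w : E),
      b ((chartAt E p₀).symm x) (mfderiv 𝓘(ℝ, E) 𝓘(ℝ, E) (chartAt E p₀).symm x u)
        (mfderiv 𝓘(ℝ, E) 𝓘(ℝ, E) (chartAt E p₀).symm x w) = G x u w) :
    ContMDiff 𝓘(ℝ, E) (𝓘(ℝ, E).prod 𝓘(ℝ, E →L[ℝ] E →L[ℝ] ℝ)) ∞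
    (fun p => Bundle.TotalSpace.mk' (E →L[ℝ] E →L[ℝ] ℝ)
      (E := fun p : M => TangentSpace 𝓘(ℝ, E) p →L[ℝ] TangentSpace 𝓘(ℝ, E) p →L[ℝ] ℝ) p (b p)) := by
  intro p₀
  obtain ⟨G, hG, hb⟩ := h p₀
  have : IsManifold 𝓘(ℝ, E) 1 M := IsManifold.of_le (n := ∞) (by simp)
  rw [contMDiffAt_hom_bundle]
  refine ⟨contMDiffAt_id, ?_⟩
  have h1 : ContMDiffAt 𝓘(ℝ, E) 𝓘(ℝ, E →L[ℝ] E →L[ℝ] ℝ) ∞ (fun p => G (chartAt E p₀ p)) p₀ := by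
    refine hG.contMDiff.contMDiffAt.comp p₀ ?_
    exact contMDiffAt_of_mem_maximalAtlas (IsManifold.chart_mem_maximalAtlas p₀)
      (mem_chart_source E p₀)
  refine h1.congr_of_eventuallyEq ?_
  filter_upwards [(chartAt E p₀).open_source.mem_nhds (mem_chart_source E p₀)] with p hp
  refine ContinuousLinearMap.ext fun u => ContinuousLinearMap.ext fun w => ?_
  have hs := TangentBundle.symmL_trivializationAt (I := 𝓘(ℝ, E)) hp
  have hm : p ∈ (trivializationAt E (TangentSpace 𝓘(ℝ, E)) p₀).baseSet := by simpa using hp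
  have hs' : ∀ u : E, (trivializationAt E (TangentSpace 𝓘(ℝ, E)) p₀).symm p u =
      mfderiv 𝓘(ℝ, E) 𝓘(ℝ, E) (chartAt E p₀).symm (chartAt E p₀ p) u := by
    intro u
    rw [← Bundle.Trivialization.symmL_apply (R := ℝ) _ hm, hs]
    simp only [mfld_simps, mfderivWithin_univ]
    rfl
  refine (inCoordinates_apply_eq₂ hm hm (Set.mem_univ _)).trans ?_
  rw [hs', hs', ← hb, (chartAt E p₀).left_inv hp]
  simp
end

/-- Smoothness holds since the expression in each chart is `sliceMetric c`. -/
theorem exists_isFormQ {c : ℝ} (hc : 0 < c) :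
    ∃ g : SemiRiemannianMetric ModelM SpaceM, IsFormQ c g :=
  ⟨{ form := fun _ => formQ c
     symm := fun _ => formQ_symm c
     nondegenerate := fun _ => formQ_nondegenerate hc
     contMDiff := by
      refine contMDiff_form _ fun p₀ => ⟨sliceMetric c, contDiff_sliceMetric c, fun x u w => ?_⟩
      obtain ⟨z, hz⟩ := mfderiv_chartM_symm p₀.out x
      exact (congrArg₂ (fun a b => formQ c a b) (hz u) (hz w)).trans (formQ_rho _ _ _ _) },
    fun _ _ _ => rfl⟩

theorem IsFormQ.unique {c : ℝ} {g g' : SemiRiemannianMetric ModelM SpaceM} (h : IsFormQ c g)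
    (h' : IsFormQ c g') : g = g' := by
  obtain ⟨f, _, _, _⟩ := g
  obtain ⟨f', _, _, _⟩ := g'
  congr 1
  funext p
  exact ContinuousLinearMap.ext fun u => ContinuousLinearMap.ext fun w =>
    (h p u w).trans (h' p u w).symm

/-! ### One-parameter subgroups and the subspaces `𝔥₀`, `𝔥₁` and `𝔥₂` -/

section Exponential

open scoped Matrix.Norms.Operator

theorem hasDerivAt_exp_smul (X : Mat) (s : ℝ) :
    HasDerivAt (fun r : ℝ => NormedSpace.exp (r • X)) (NormedSpace.exp (s • X) * X) s :=
  hasDerivAt_exp_smul_const X s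

theorem exp_add_smul (X : Mat) (s r : ℝ) :
    NormedSpace.exp ((s + r) • X) = NormedSpace.exp (s • X) * NormedSpace.exp (r • X) := by
  rw [add_smul]
  exact Matrix.exp_add_of_commute _ _ (((Commute.refl X).smul_left s).smul_right r)

/-- The determinant along a one-parameter group has the derivative `0`, by `hasDerivAt_det` and
translation. -/
theorem det_exp_of_trace_eq_zero {X : Mat} (hX : X.trace = 0) (s : ℝ) :
    (NormedSpace.exp (s • X)).det = 1 := by
  have h : ∀ s : ℝ, HasDerivAt (fun r : ℝ => (NormedSpace.exp (r • X)).det) 0 s := by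
    intro s
    have h1 : HasDerivAt (fun r : ℝ => NormedSpace.exp (r • X)) X 0 := by
      simpa using hasDerivAt_exp_smul X 0
    have h2 := hasDerivAt_det h1 (by simp)
    rw [hX] at h2
    have h3 := (HasDerivAt.comp_sub_const s s (by rwa [sub_self])).const_mul
      (NormedSpace.exp (s • X)).det
    rw [mul_zero] at h3
    refine h3.congr_of_eventuallyEq (Filter.Eventually.of_forall fun r => ?_)
    change _ = Matrix.det _ * Matrix.det _
    rw [← Matrix.det_mul, ← exp_add_smul, add_sub_cancel]
  have h' := is_const_of_deriv_eq_zero (fun s => (h s).differentiableAt) (fun s => (h s).deriv) s 0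
  simpa using h'

theorem conjTranspose_exp_mul {X : Mat} (hX : Xᴴ * I21 + I21 * X = 0) (s : ℝ) :
    (NormedSpace.exp (s • X))ᴴ * I21 * NormedSpace.exp (s • X) = I21 := by
  have hinv : I21⁻¹ = I21 := Matrix.inv_eq_left_inv I21_mul_I21
  have h1 : Xᴴ = I21 * -X * I21 := by
    rw [mul_neg, ← eq_neg_of_add_eq_zero_left hX, mul_assoc, I21_mul_I21, mul_one]
  have e : (s • X)ᴴ = I21 * (-(s • X)) * I21⁻¹ := by
    rw [Matrix.conjTranspose_smul, h1, hinv, ← smul_neg, mul_smul_comm, smul_mul_assoc, star_trivial]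
  have hu : IsUnit I21 := IsUnit.of_mul_eq_one _ I21_mul_I21
  have h2 : (NormedSpace.exp (s • X))ᴴ = I21 * NormedSpace.exp (-(s • X)) * I21 := by
    rw [← Matrix.exp_conjTranspose, e, Matrix.exp_conj _ _ hu, hinv]
  have h3 : NormedSpace.exp (-(s • X)) * NormedSpace.exp (s • X) = 1 := by
    rw [Matrix.exp_neg]
    exact Matrix.nonsing_inv_mul _ ((Matrix.isUnit_iff_isUnit_det _).1 (Matrix.isUnit_exp _))
  rw [h2, mul_assoc _ I21 I21, I21_mul_I21, mul_one, mul_assoc, h3, mul_one]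

/-- The one-parameter subgroup generated by an element of the Lie algebra. -/
def expG (X : Mat) (hX : IsLie X) (s : ℝ) : SU21 :=
  ofMat (NormedSpace.exp (s • X)) (det_exp_of_trace_eq_zero hX.2 s) (conjTranspose_exp_mul hX.1 s)

theorem isOneParam_expG (X : Mat) (hX : IsLie X) : IsOneParam (expG X hX) X := fun _ => rfl

theorem IsOneParam.hasDerivAt {c : ℝ → SU21} {X : Mat} (h : IsOneParam c X) (s : ℝ) :
    HasDerivAt (fun r => toMat (c r)) (toMat (c s) * X) s := by
  rw [h s, funext h]
  exact hasDerivAt_exp_smul X s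

theorem IsOneParam.isLie {c : ℝ → SU21} {X : Mat} (h : IsOneParam c X) : IsLie X := by
  have := isLie_of_hasDerivAt (h.hasDerivAt 0)
  rwa [h.zero, ← mul_assoc, ← toMat_mul, inv_mul_cancel, toMat_one, one_mul] at this

theorem exists_isOneParam {L : Subgroup SU21} {X : Mat} (h : X ∈ lieAlg L) :
    ∃ c, IsOneParam c X ∧ ∀ s, c s ∈ L := by
  choose c hc using h
  exact ⟨c, fun s => (hc s).2, fun s => (hc s).1⟩

theorem isLie_of_mem_lieAlg {L : Subgroup SU21} {X : Mat} (h : X ∈ lieAlg L) : IsLie X := by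
  obtain ⟨c, hc, -⟩ := exists_isOneParam h
  exact hc.isLie

theorem toMat_eq_zero_of_mem_subK {k : SU21} (hk : k ∈ subK) :
    toMat k 0 2 = 0 ∧ toMat k 1 2 = 0 := by
  obtain ⟨A, rfl⟩ := hk
  rw [toMat_kEmb]
  simp [kMat]

/-- The logarithmic derivative of a curve in `K`. -/
theorem projM_fst_of_mem_subK {g : ℝ → SU21} {G' : Mat} {s : ℝ}
    (h : HasDerivAt (fun r => toMat (g r)) G' s) (hK : ∀ᶠ r in 𝓝 s, g r ∈ subK) :
    (projM (toMat (g s)⁻¹ * G')).1 = 0 := by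
  have hc := hasDerivAt_toMat_const_mul h (g s)⁻¹
  have hmem : ∀ᶠ r in 𝓝 s, (g s)⁻¹ * g r ∈ subK := by
    filter_upwards [hK] with r hr
    exact mul_mem (inv_mem hK.self_of_nhds) hr
  have e := hasDerivAt_entry hc
  have e0 : (toMat (g s)⁻¹ * G') 0 2 = 0 := by
    apply (e 0 2).unique
    refine (hasDerivAt_const s (0 : ℂ)).congr_of_eventuallyEq ?_
    filter_upwards [hmem] with r hr using (toMat_eq_zero_of_mem_subK hr).1
  have e1 : (toMat (g s)⁻¹ * G') 1 2 = 0 := by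
    apply (e 1 2).unique
    refine (hasDerivAt_const s (0 : ℂ)).congr_of_eventuallyEq ?_
    filter_upwards [hmem] with r hr using (toMat_eq_zero_of_mem_subK hr).2
  rw [projM_apply, e0, e1]
  rfl

theorem toMat_inv_mul_mul {c : ℝ → SU21} {X : Mat} (s : ℝ) :
    toMat (c s)⁻¹ * (toMat (c s) * X) = X := by
  rw [← mul_assoc, toMat_inv_mul, one_mul]

theorem projM_of_mem_lieH0 {X : Mat} (h : X ∈ lieH0) : projM X = 0 := by
  obtain ⟨c, hc, hL⟩ := exists_isOneParam h
  have := projM_of_mem_subH (hc.hasDerivAt 0) (Filter.Eventually.of_forall hL)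
  rwa [toMat_inv_mul_mul] at this

theorem projM_fst_of_mem_lieAlg_subK {X : Mat} (h : X ∈ lieAlg subK) : (projM X).1 = 0 := by
  obtain ⟨c, hc, hL⟩ := exists_isOneParam h
  have := projM_fst_of_mem_subK (hc.hasDerivAt 0) (Filter.Eventually.of_forall hL)
  rwa [toMat_inv_mul_mul] at this

theorem lieMat_mem_lieAlg_top (u : ModelM) (θ : ℝ) : lieMat u θ ∈ lieAlg ⊤ :=
  fun s => ⟨expG _ (isLie_lieMat u θ) s, trivial, rfl⟩

/-- The exponentials commute with `diag(0, 0, 1)`, hence are block diagonal. -/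
theorem lieMat_mem_lieAlg_subK (b : ℝ × ℂ) (θ : ℝ) : lieMat (0, b) θ ∈ lieAlg subK := by
  intro s
  refine ⟨expG _ (isLie_lieMat (0, b) θ) s, ?_, rfl⟩
  have h1 : Commute (lieMat (0, b) θ) (Matrix.diagonal ![0, 0, 1]) := by
    ext i j
    rw [Matrix.mul_diagonal, Matrix.diagonal_mul]
    fin_cases i <;> fin_cases j <;> simp [lieMat]
  have h2 : toMat (expG _ (isLie_lieMat (0, b) θ) s) * Matrix.diagonal ![0, 0, 1] =
      Matrix.diagonal ![0, 0, 1] * toMat (expG _ (isLie_lieMat (0, b) θ) s) :=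
    (h1.smul_left s).exp_left
  have h3 := fun i => congrFun (congrFun h2 i) 2
  simp only [Matrix.mul_diagonal, Matrix.diagonal_mul] at h3
  have h30 := h3 0
  have h31 := h3 1
  simp at h30 h31
  exact mem_subK_of_entries _ h30 h31

theorem lieMat_mem_lieH0 (θ : ℝ) : lieMat 0 θ ∈ lieH0 := by
  intro s
  refine ⟨circleEmb (Circle.exp (s * θ)), ⟨_, rfl⟩, ?_⟩
  have h1 : s • lieMat 0 θ = Matrix.diagonal ![Complex.I * (s * θ), Complex.I * (s * θ),
      -(2 * (Complex.I * (s * θ)))] := by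
    ext i j
    fin_cases i <;> fin_cases j <;> simp [lieMat] <;> ring
  rw [h1, Matrix.exp_diagonal, toMat_circleEmb, circleMat_eq_diagonal]
  congr 1
  funext i
  rw [Pi.coe_exp]
  fin_cases i <;> simp [Complex.exp_eq_exp_ℂ.symm, Circle.coe_exp]
  · ring_nf
  · ring_nf
  · rw [← Complex.exp_nat_mul, ← Complex.exp_neg]
    congr 1
    push_cast
    ring

/-- The form `B` in coordinates: `formQ 1` on `𝔥₂ ⊕ 𝔥₁`, and `6 θ τ` on `𝔥₀`. -/
theorem formB_lieMat (u v : ModelM) (θ τ : ℝ) :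
    formB (lieMat u θ) (lieMat v τ) = formQ 1 u v + 6 * θ * τ := by
  rw [formB, formQ_apply, Matrix.trace_fin_three]
  simp [lieMat, Matrix.mul_apply, Fin.sum_univ_three]
  ring

theorem lieMat_mem_lieH1 (b : ℝ × ℂ) : lieMat (0, b) 0 ∈ lieH1 := by
  refine ⟨lieMat_mem_lieAlg_subK b 0, fun Z hZ => ?_⟩
  rw [(isLie_of_mem_lieAlg hZ).eq_lieMat, projM_of_mem_lieH0 hZ, formB_lieMat]
  simp

theorem lieMat_mem_lieH2 (a : ℂ × ℂ) : lieMat (a, 0) 0 ∈ lieH2 := by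
  refine ⟨lieMat_mem_lieAlg_top _ 0, fun Z hZ => ?_⟩
  rw [(isLie_of_mem_lieAlg hZ).eq_lieMat, formB_lieMat, formQ_apply,
    projM_fst_of_mem_lieAlg_subK hZ]
  simp

theorem eq_of_mem_lieH1 {X : Mat} (h : X ∈ lieH1) : X = lieMat (0, (projM X).2) 0 := by
  have h1 := (isLie_of_mem_lieAlg h.1).eq_lieMat
  have h2 := h.2 _ (lieMat_mem_lieH0 1)
  rw [h1, formB_lieMat, map_zero] at h2
  have h3 : -(X 2 2).im / 2 = 0 := by linarith
  rw [h3] at h1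
  conv_lhs => rw [h1]
  rw [← projM_fst_of_mem_lieAlg_subK h.1]

theorem eq_of_mem_lieH2 {X : Mat} (h : X ∈ lieH2) : X = lieMat ((projM X).1, 0) 0 := by
  have h1 := (isLie_of_mem_lieAlg h.1).eq_lieMat
  have h2 := h.2 _ (lieMat_mem_lieAlg_subK 0 1)
  have h4 := h.2 _ (lieMat_mem_lieAlg_subK (projM X).2 0)
  rw [h1, formB_lieMat, formQ_apply] at h2 h4
  simp only [projM_lieMat] at h2 h4
  have h3 : -(X 2 2).im / 2 = 0 := by simp at h2; linarith
  have h5 : (projM X).2.1 ^ 2 + (projM X).2.2.re ^ 2 + (projM X).2.2.im ^ 2 = 0 := by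
    simp at h4; nlinarith
  have h6 : (projM X).2 = 0 := by
    have e0 := sq_nonneg (projM X).2.1
    have e1 := sq_nonneg (projM X).2.2.re
    have e2 := sq_nonneg (projM X).2.2.im
    exact Prod.ext (sq_eq_zero_iff.1 (by linarith)) (Complex.ext (sq_eq_zero_iff.1 (by linarith))
      (sq_eq_zero_iff.1 (by linarith)))
  rw [h3] at h1
  conv_lhs => rw [h1]
  rw [← h6]

theorem zero_mem_lieAlg (L : Subgroup SU21) : (0 : Mat) ∈ lieAlg L :=
  fun s => ⟨1, L.one_mem, by rw [smul_zero, NormedSpace.exp_zero, toMat_one]⟩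

end Exponential

/-! ### The invariant metric on `SU(2,1)/S¹` -/

section Curves

open scoped Matrix.Norms.Operator

theorem isInducing_toMat : Topology.IsInducing toMat :=
  Topology.IsInducing.subtypeVal.comp Topology.IsInducing.subtypeVal

theorem continuousAt_of_hasDerivAt {g : ℝ → SU21} {G' : Mat} {s : ℝ}
    (h : HasDerivAt (fun r => toMat (g r)) G' s) : ContinuousAt g s := by
  rw [isInducing_toMat.continuousAt_iff]
  exact h.continuousAt

theorem hasDerivAt_pi_entries {g : ℝ → SU21} {G' : Mat} {s : ℝ}
    (h : HasDerivAt (fun r => toMat (g r)) G' s) :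
    HasDerivAt (fun r => (fun i j => toMat (g r) i j : Fin 3 → Fin 3 → ℂ)) (fun i j => G' i j) s :=
  hasDerivAt_pi.2 fun i => hasDerivAt_pi.2 fun j => hasDerivAt_entry h i j

/-- The velocity of the curve in `SU(2,1)/S¹` induced by a curve in `SU(2,1)`, in a chart. -/
theorem exists_hasDerivAt_coords {g : ℝ → SU21} {G' : Mat} {s : ℝ}
    (h : HasDerivAt (fun r => toMat (g r)) G' s) {b : SU21}
    (hk : kTrace (toMat (b * g s)) ≠ 0) {z : Circle}
    (hz : slice (coords (toMat (b * g s))) = b * g s * circleEmb z) :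
    ∃ ξ, HasDerivAt (fun r => coords (toMat (b * g r))) ξ s ∧
      mcM (coords (toMat (b * g s))) ξ = rho z (projM (toMat (g s)⁻¹ * G')) := by
  have hb := hasDerivAt_toMat_const_mul h b
  have hd : DifferentiableAt ℝ (fun y : Fin 3 → Fin 3 → ℂ => coords (Matrix.of y))
      (fun i j => toMat (b * g s) i j) :=
    (contDiffAt_coords (contDiffAt_entry (toMat (b * g s))) (toMat_22_ne (b * g s)) hk).differentiableAt
      (by simp)
  obtain ⟨ξ, h2⟩ : ∃ ξ, HasDerivAt (fun r => coords (toMat (b * g r))) ξ s :=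
    ⟨_, HasFDerivAt.comp_hasDerivAt (f := fun r => (fun i j => toMat (b * g r) i j)) s
      hd.hasFDerivAt (hasDerivAt_pi_entries hb)⟩
  refine ⟨ξ, h2, ?_⟩
  rw [mcM_eq_projM]
  refine projM_gauge h (hasDerivAt_slice h2) b z hz ?_
  have h3 : ∀ᶠ r in 𝓝 s, kTrace (toMat (b * g r)) ≠ 0 :=
    (continuous_kTrace.continuousAt.comp (continuousAt_of_hasDerivAt hb)).eventually_ne hk
  filter_upwards [h3] with r hr
  obtain ⟨z', hz'⟩ := exists_slice _ hr
  refine ⟨z'⁻¹, ?_⟩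
  rw [map_inv, eq_comm, inv_mul_eq_iff_eq_mul, eq_mul_inv_iff_mul_eq]
  exact hz'.symm

/-- The velocity of a curve, as a vector in the model space, is its derivative in the preferred
chart. -/
theorem mdifferentiableAt_curve {E M : Type*} [NormedAddCommGroup E] [NormedSpace ℝ E]
    [TopologicalSpace M] [ChartedSpace E M] {γ : ℝ → M} {s : ℝ} {ξ : E} (hc : ContinuousAt γ s)
    (h : HasDerivAt (fun r => chartAt E (γ s) (γ r)) ξ s) :
    MDifferentiableAt 𝓘(ℝ, ℝ) 𝓘(ℝ, E) γ s ∧ (mfderiv 𝓘(ℝ, ℝ) 𝓘(ℝ, E) γ s (1 : ℝ) : E) = ξ := by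
  have hd : MDifferentiableAt 𝓘(ℝ, ℝ) 𝓘(ℝ, E) γ s :=
    mdifferentiableAt_of_chart hc h.differentiableAt
  refine ⟨hd, ?_⟩
  rw [mfderiv_eq_fderiv_chart hd]
  change fderiv ℝ (fun r => chartAt E (γ s) (γ r)) s 1 = ξ
  rw [h.hasFDerivAt.fderiv]
  simp

/-- The vector at the base point generated by `X` is the `𝔥₂ ⊕ 𝔥₁`-part of `X`. The action of the
isotropy group appears because the preferred chart at the base point is a translate by an unspecified
element `z` of `H`. -/
theorem exists_generatorAt_subH : ∃ z : Circle, ∀ (c : ℝ → SU21) (X : Mat) (h : IsOneParam c X),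
    (generatorAt (E := ModelM) subH h : ModelM) = rho z (projM X) := by
  have ho := mem_chartM_out ((1 : SU21) : SpaceM)
  rw [mk_mem_chartM_source] at ho
  obtain ⟨z, hz⟩ := exists_slice _ ho
  refine ⟨z⁻¹, fun c X h => ?_⟩
  have h0 := h.zero
  have hz' : slice (coords (toMat (((1 : SU21) : SpaceM).out⁻¹ * c 0))) =
      ((1 : SU21) : SpaceM).out⁻¹ * c 0 * circleEmb z⁻¹ := by
    rw [map_inv, eq_mul_inv_iff_mul_eq, h0]
    exact hz.symm
  obtain ⟨ξ, h1, h2⟩ := exists_hasDerivAt_coords (h.hasDerivAt 0) (by rwa [h0]) hz'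
  rw [toMat_inv_mul_mul] at h2
  have h3 := (mdifferentiableAt_curve (γ := fun s => (c s : SpaceM)) (s := 0) (ξ := ξ)
    (QuotientGroup.continuous_mk.continuousAt.comp (continuousAt_of_hasDerivAt (h.hasDerivAt 0)))
    (by
      simp only [h0]
      exact h1)).2
  have h4 : coords (toMat (((1 : SU21) : SpaceM).out⁻¹ * c 0)) = 0 := by
    rw [h0]
    exact chartAt_self ((1 : SU21) : SpaceM)
  rw [h4, mcM_zero] at h2
  rw [← h2]
  exact h3

end Curves

theorem lieMat_add (u v : ModelM) (θ τ : ℝ) : lieMat u θ + lieMat v τ = lieMat (u + v) (θ + τ) := by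
  ext i j
  fin_cases i <;> fin_cases j <;> simp [lieMat] <;> ring

/-- The form `formQ (1 + t)` at every point is invariant, and has the prescribed value at the base
point. -/
theorem IsFormQ.isMetricM {t : ℝ} {g : SemiRiemannianMetric ModelM SpaceM}
    (hg : IsFormQ (1 + t) g) : IsMetricM t g where
  invariant := hg.isInvariantMetric
  base := by
    intro X₀ X₁ X₂ Y₀ Y₁ Y₂ hX₀ hX₁ hX₂ hY₀ hY₁ hY₂ c d hc hd
    obtain ⟨z, hz⟩ := exists_generatorAt_subH
    refine (hg _ _ _).trans ?_
    refine (congrArg₂ (fun a b => formQ (1 + t) a b) (hz c _ hc) (hz d _ hd)).trans ?_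
    rw [formQ_rho, map_add projM, map_add projM, map_add projM, map_add projM, projM_of_mem_lieH0 hX₀,
      projM_of_mem_lieH0 hY₀, eq_of_mem_lieH1 hX₁, eq_of_mem_lieH1 hY₁, eq_of_mem_lieH2 hX₂,
      eq_of_mem_lieH2 hY₂]
    simp only [formB_lieMat, projM_lieMat, formQ_apply]
    simp
    ring

theorem exists_smul_out (p : SpaceM) : p.out • ((1 : SU21) : SpaceM) = p := by
  conv_rhs => rw [← mk_out p]
  change ((p.out * 1 : SU21) : SpaceM) = _
  rw [mul_one]

/-- Conversely, an invariant metric is determined by its value at the base point, as the action is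
transitive. -/
theorem IsMetricM.isFormQ {t : ℝ} {g : SemiRiemannianMetric ModelM SpaceM}
    (hg : IsMetricM t g) : IsFormQ (1 + t) g := by
  have h1 : ∀ u w : TangentSpace 𝓘(ℝ, ModelM) ((1 : SU21) : SpaceM),
      g.form ((1 : SU21) : SpaceM) u w = formQ (1 + t) u w := by
    obtain ⟨z, hz⟩ := exists_generatorAt_subH
    intro u w
    obtain ⟨u, rfl⟩ := rho_surjective z u
    obtain ⟨w, rfl⟩ := rho_surjective z w
    have e : ∀ u : ModelM, lieMat u 0 = 0 + lieMat (0, u.2) 0 + lieMat (u.1, 0) 0 := by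
      intro u
      rw [zero_add, lieMat_add]
      simp
    have hc : ∀ u : ModelM, IsOneParam (expG _ (isLie_lieMat u 0))
        (0 + lieMat (0, u.2) 0 + lieMat (u.1, 0) 0) := fun u s => by
      rw [← e]; exact isOneParam_expG _ (isLie_lieMat u 0) s
    have hz' : ∀ u : ModelM, (generatorAt (E := ModelM) subH (hc u) : ModelM) = rho z u := by
      intro u
      rw [hz, ← e, projM_lieMat]
    have key := hg.base 0 (lieMat (0, u.2) 0) (lieMat (u.1, 0) 0) 0 (lieMat (0, w.2) 0)
      (lieMat (w.1, 0) 0) (zero_mem_lieAlg _) (lieMat_mem_lieH1 _) (lieMat_mem_lieH2 _)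
      (zero_mem_lieAlg _) (lieMat_mem_lieH1 _) (lieMat_mem_lieH2 _) _ _ (hc u) (hc w)
    rw [formQ_rho]
    refine (congrArg₂ (fun a b : TangentSpace 𝓘(ℝ, ModelM) ((1 : SU21) : SpaceM) =>
      g.form ((1 : SU21) : SpaceM) a b) (hz' u) (hz' w)).symm.trans (key.trans ?_)
    rw [formB_lieMat, formB_lieMat]
    simp only [formQ_apply]
    simp
    ring
  have h2 : ∀ (a : SU21) (u w : TangentSpace 𝓘(ℝ, ModelM) (a • ((1 : SU21) : SpaceM))),
      g.form (a • ((1 : SU21) : SpaceM)) u w = formQ (1 + t) u w := by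
    intro a u w
    obtain ⟨z, hz⟩ := mfderiv_smul a ((1 : SU21) : SpaceM)
    obtain ⟨u, rfl⟩ := rho_surjective z u
    obtain ⟨w, rfl⟩ := rho_surjective z w
    rw [formQ_rho]
    refine (congrArg₂ (fun x y : TangentSpace 𝓘(ℝ, ModelM) (a • ((1 : SU21) : SpaceM)) =>
      g.form (a • ((1 : SU21) : SpaceM)) x y) (hz u) (hz w)).symm.trans ?_
    exact (hg.invariant a _ u w).trans (h1 u w)
  intro p
  rw [← exists_smul_out p]
  exact h2 p.out

/-! ### The isotropy representation and the Maurer–Cartan form of `SU(2,1)/U(2)` -/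

/-- The form `B` on `𝔥₂`. -/
def formP : ModelB →L[ℝ] ModelB →L[ℝ] ℝ :=
  (formQ 1).bilinearComp (ContinuousLinearMap.inl ℝ _ _) (ContinuousLinearMap.inl ℝ _ _)

theorem formP_apply (u w : ModelB) :
    formP u w = -2 * (conj u.1 * w.1 + conj u.2 * w.2).re := by
  change formQ 1 (u, 0) (w, 0) = _
  rw [formQ_apply]
  simp

theorem formP_symm (u w : ModelB) : formP u w = formP w u := formQ_symm 1 (u, 0) (w, 0)

theorem formP_self_neg {u : ModelB} (hu : u ≠ 0) : formP u u < 0 := by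
  obtain ⟨p, q⟩ := u
  rw [formP_apply]
  simp only [← Complex.normSq_eq_conj_mul_self, Complex.add_re, Complex.ofReal_re]
  have hp := Complex.normSq_nonneg p
  have hq := Complex.normSq_nonneg q
  by_contra! h
  have h1 : Complex.normSq p = 0 := by linarith
  have h2 : Complex.normSq q = 0 := by linarith
  exact hu (by rw [Complex.normSq_eq_zero.1 h1, Complex.normSq_eq_zero.1 h2]; rfl)

theorem formP_nondegenerate (u : ModelB) (h : ∀ w, formP u w = 0) : u = 0 := by
  by_contra hu
  exact (formP_self_neg hu).ne (h u)

/-- The isotropy representation of `K` on `𝔥₂`: the action of `k = diag(A, (det A)⁻¹)` by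
`X ↦ k⁻¹ X k`. -/
def sigma (A : Matrix.unitaryGroup (Fin 2) ℂ) : ModelB →L[ℝ] ModelB :=
  LinearMap.toContinuousLinearMap
    { toFun := fun u => (A.1.det⁻¹ * (conj (A.1 0 0) * u.1 + conj (A.1 1 0) * u.2),
        A.1.det⁻¹ * (conj (A.1 0 1) * u.1 + conj (A.1 1 1) * u.2))
      map_add' := by
        intro u v
        ext1 <;> simp <;> ring
      map_smul' := by
        intro r u
        ext1 <;> simp <;> ring }

theorem sigma_apply (A : Matrix.unitaryGroup (Fin 2) ℂ) (u : ModelB) :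
    sigma A u = (A.1.det⁻¹ * (conj (A.1 0 0) * u.1 + conj (A.1 1 0) * u.2),
        A.1.det⁻¹ * (conj (A.1 0 1) * u.1 + conj (A.1 1 1) * u.2)) := rfl

theorem sigma_one (u : ModelB) : sigma 1 u = u := by
  simp [sigma_apply]

theorem conj_det_mul_det (A : Matrix.unitaryGroup (Fin 2) ℂ) : conj A.1.det * A.1.det = 1 := by
  have := congrArg Matrix.det (Matrix.mem_unitaryGroup_iff'.1 A.2)
  rwa [Matrix.det_mul, Matrix.star_eq_conjTranspose, Matrix.det_conjTranspose,
    Matrix.det_one] at this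

/-- The isotropy group `K` acts by isometries. -/
theorem formP_sigma (A : Matrix.unitaryGroup (Fin 2) ℂ) (u w : ModelB) :
    formP (sigma A u) (sigma A w) = formP u w := by
  have hd := conj_det_mul_det A
  have hd' : conj (A.1.det)⁻¹ * (A.1.det)⁻¹ = 1 := by
    rw [map_inv₀, ← mul_inv, hd, inv_one]
  have hu := Matrix.mem_unitaryGroup_iff.1 A.2
  have k00 := congrFun (congrFun hu 0) 0
  have k10 := congrFun (congrFun hu 1) 0
  have k01 := congrFun (congrFun hu 0) 1
  have k11 := congrFun (congrFun hu 1) 1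
  simp only [Matrix.star_eq_conjTranspose, Matrix.mul_apply, Matrix.conjTranspose_apply,
    Fin.sum_univ_two, RCLike.star_def, Matrix.one_apply_eq, ne_eq, one_ne_zero, not_false_eq_true,
    zero_ne_one, Matrix.one_apply_ne] at k00 k10 k01 k11
  rw [formP_apply, formP_apply]
  congr 2
  simp only [sigma_apply, map_add, map_mul, Complex.conj_conj]
  generalize (A.1.det)⁻¹ = δ at *
  linear_combination (conj δ * δ) * (conj u.1 * w.1 * k00 + conj u.1 * w.2 * k01 +
    conj u.2 * w.1 * k10 + conj u.2 * w.2 * k11) + (conj u.1 * w.1 + conj u.2 * w.2) * hd'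

theorem sigma_injective (A : Matrix.unitaryGroup (Fin 2) ℂ) : Function.Injective (sigma A) := by
  rw [injective_iff_map_eq_zero]
  intro u hu
  apply formP_nondegenerate
  intro w
  rw [← formP_sigma A, hu]
  simp

theorem sigma_surjective (A : Matrix.unitaryGroup (Fin 2) ℂ) : Function.Surjective (sigma A) :=
  LinearMap.injective_iff_surjective (f := (sigma A : ModelB →ₗ[ℝ] ModelB)).1 (sigma_injective A)

theorem toMat_kEmb_inv (A : Matrix.unitaryGroup (Fin 2) ℂ) :
    toMat (kEmb A)⁻¹ = kMat (star A.1) := by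
  rw [← map_inv, toMat_kEmb]
  rfl

theorem projM_conj_kEmb (A : Matrix.unitaryGroup (Fin 2) ℂ) (X : Mat) :
    (projM (toMat (kEmb A)⁻¹ * X * toMat (kEmb A))).1 = sigma A (projM X).1 := by
  rw [toMat_kEmb_inv, toMat_kEmb]
  simp only [projM_apply, sigma_apply]
  ext1 <;> simp [kMat, Matrix.mul_apply, Fin.sum_univ_three,
    Matrix.star_apply, Matrix.vecMul, dotProduct] <;> ring

section Curves

open scoped Matrix.Norms.Operator

/-- Curves in `SU(2,1)` inducing the same curve in `SU(2,1)/U(2)`, up to a translation, have the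
same `𝔥₂`-part of the logarithmic derivative, up to the action of the isotropy group. -/
theorem projM_fst_gauge {g₁ g₂ : ℝ → SU21} {G₁ G₂ : Mat} {s : ℝ}
    (h₁ : HasDerivAt (fun r => toMat (g₁ r)) G₁ s) (h₂ : HasDerivAt (fun r => toMat (g₂ r)) G₂ s)
    (a : SU21) (A : Matrix.unitaryGroup (Fin 2) ℂ) (hA : g₂ s = a * g₁ s * kEmb A)
    (hK : ∀ᶠ r in 𝓝 s, (a * g₁ r)⁻¹ * g₂ r ∈ subK) :
    (projM (toMat (g₂ s)⁻¹ * G₂)).1 = sigma A (projM (toMat (g₁ s)⁻¹ * G₁)).1 := by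
  have hk : HasDerivAt (fun r => toMat ((a * g₁ r)⁻¹ * g₂ r))
      (-(toMat (a * g₁ s)⁻¹ * (toMat a * G₁) * toMat (a * g₁ s)⁻¹) * toMat (g₂ s) +
        toMat (a * g₁ s)⁻¹ * G₂) s :=
    (hasDerivAt_toMat_inv (hasDerivAt_toMat_const_mul h₁ a)).mul h₂
  have h0 := projM_fst_of_mem_subK hk hK
  have hk0 : (a * g₁ s)⁻¹ * g₂ s = kEmb A := by rw [hA, inv_mul_cancel_left]
  have e1 : toMat (a * g₁ s)⁻¹ * (toMat a * G₁) = toMat (g₁ s)⁻¹ * G₁ := by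
    rw [← mul_assoc, ← toMat_mul, mul_inv_rev, inv_mul_cancel_right]
  have e2 : toMat (a * g₁ s)⁻¹ * toMat (g₂ s) = toMat (kEmb A) := by rw [← toMat_mul, hk0]
  have e3 : toMat (kEmb A)⁻¹ * toMat (a * g₁ s)⁻¹ = toMat (g₂ s)⁻¹ := by
    rw [← toMat_mul, hA, mul_inv_rev (a * g₁ s)]
  rw [hk0, e1, neg_mul, mul_assoc _ _ (toMat (g₂ s)), e2, mul_add, mul_neg, ← mul_assoc _ _ G₂, e3,
    ← mul_assoc, map_add, map_neg, Prod.fst_add, Prod.fst_neg, projM_conj_kEmb] at h0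
  exact (eq_of_neg_add_eq_zero h0).symm

/-- The `𝔥₂`-part of the Maurer–Cartan form along `boost`. -/
def mcB (x : ModelB) : ModelB →L[ℝ] ModelB :=
  (ContinuousLinearMap.fst ℝ _ _).comp ((mcM (x, 0)).comp (ContinuousLinearMap.inl ℝ _ _))

theorem mcB_apply (x u : ModelB) : mcB x u = (mcM (x, 0) (u, 0)).1 := rfl

theorem mcB_zero (u : ModelB) : mcB 0 u = u := by
  rw [mcB_apply]
  exact congrArg Prod.fst (mcM_zero (u, 0))

theorem contDiff_mcB : ContDiff ℝ ∞ mcB := by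
  have h : ContDiff ℝ ∞ fun x : ModelB => mcM (x, 0) :=
    contDiff_mcM.comp (contDiff_id.prodMk contDiff_const)
  exact contDiff_const.clm_comp (h.clm_comp contDiff_const)

theorem slice_inl (x : ModelB) : slice (x, 0) = boost x.1 x.2 := by
  have h : rot 0 0 = 1 := by
    have := slice_zero
    rw [slice] at this
    have hb : boost 0 0 = 1 := by
      have h1 := boost_neg_mul 0 0
      have h2 : boost 0 0 * boost 0 0 = boost 0 0 := by
        apply toMat_injective
        ext i j
        fin_cases i <;> fin_cases j <;>
          simp [toMat_mul, toMat_boost, boostMat, Matrix.mul_apply, Fin.sum_univ_three]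
      rw [neg_zero] at h1
      rw [← h1, h2]
    simpa [hb] using this
  rw [slice]
  change boost x.1 x.2 * rot 0 0 = _
  rw [h, mul_one]

/-- The velocity of the curve in `SU(2,1)/U(2)` induced by a curve in `SU(2,1)`, in the chart. -/
theorem exists_hasDerivAt_vCoord {g : ℝ → SU21} {G' : Mat} {s : ℝ}
    (h : HasDerivAt (fun r => toMat (g r)) G' s) {b : SU21} {A : Matrix.unitaryGroup (Fin 2) ℂ}
    (hA : boost (vCoord (toMat (b * g s))).1 (vCoord (toMat (b * g s))).2 = b * g s * kEmb A) :
    ∃ ξ, HasDerivAt (fun r => vCoord (toMat (b * g r))) ξ s ∧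
      mcB (vCoord (toMat (b * g s))) ξ = sigma A (projM (toMat (g s)⁻¹ * G')).1 := by
  have hb := hasDerivAt_toMat_const_mul h b
  have hd : DifferentiableAt ℝ (fun y : Fin 3 → Fin 3 → ℂ => vCoord (Matrix.of y))
      (fun i j => toMat (b * g s) i j) :=
    (contDiffAt_vCoord (contDiffAt_entry (toMat (b * g s))) (toMat_22_ne (b * g s))).differentiableAt
      (by simp)
  obtain ⟨ξ, h2⟩ : ∃ ξ, HasDerivAt (fun r => vCoord (toMat (b * g r))) ξ s :=
    ⟨_, HasFDerivAt.comp_hasDerivAt (f := fun r => (fun i j => toMat (b * g r) i j)) s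
      hd.hasFDerivAt (hasDerivAt_pi_entries hb)⟩
  refine ⟨ξ, h2, ?_⟩
  have h3 : HasDerivAt (fun r => ((vCoord (toMat (b * g r)), 0) : ModelM)) (ξ, 0) s :=
    h2.prodMk (hasDerivAt_const s 0)
  rw [mcB_apply, mcM_eq_projM]
  refine projM_fst_gauge h (hasDerivAt_slice h3) b A (by rw [slice_inl, hA]) ?_
  refine Filter.Eventually.of_forall fun r => ?_
  obtain ⟨A', hA'⟩ := polar (b * g r)
  rw [slice_inl]
  conv => enter [2, 1, 1]; rw [← hA']
  refine ⟨A'⁻¹, ?_⟩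
  rw [map_inv]
  group

/-- The polar decomposition, with the unitary factor on the other side. -/
theorem exists_polar (g : SU21) : ∃ A : Matrix.unitaryGroup (Fin 2) ℂ,
    boost (vCoord (toMat g)).1 (vCoord (toMat g)).2 = g * kEmb A := by
  obtain ⟨A, hA⟩ := polar g
  refine ⟨A⁻¹, ?_⟩
  rw [map_inv, eq_mul_inv_iff_mul_eq, hA]

/-- The Maurer–Cartan forms of the two homogeneous spaces correspond to each other under the
projection `x ↦ x.1` of the charts. -/
theorem mcB_fst {x : ModelM} {A : Matrix.unitaryGroup (Fin 2) ℂ}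
    (hA : boost x.1.1 x.1.2 = slice x * kEmb A) (u : ModelM) :
    mcB x.1 u.1 = sigma A (mcM x u).1 := by
  have h1 := hasDerivAt_slice (hasDerivAt_line x u)
  have h0 : x + (0 : ℝ) • u = x := by simp
  have hv := fun r : ℝ => vCoord_slice (x + r • u)
  obtain ⟨ξ, h2, h3⟩ := exists_hasDerivAt_vCoord h1 (b := 1) (A := A) (by
    rw [one_mul, hv, h0, hA])
  simp only [one_mul, hv, h0, vCoord_slice] at h2 h3
  have h4 : HasDerivAt (fun r : ℝ => (x + r • u).1) u.1 0 :=
    (ContinuousLinearMap.fst ℝ ModelB (ℝ × ℂ)).hasFDerivAt.comp_hasDerivAt 0 (hasDerivAt_line x u)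
  rw [h4.unique h2, h3, mcM_eq_projM]

theorem mcB_surjective (x : ModelB) : Function.Surjective (mcB x) := by
  intro v
  obtain ⟨u, hu⟩ := mcM_surjective (x, 0) (v, 0)
  refine ⟨u.1, ?_⟩
  have := mcB_fst (x := (x, 0)) (A := 1) (by rw [slice_inl, map_one, mul_one]) u
  rw [hu, sigma_one] at this
  exact this

theorem mcB_injective (x : ModelB) : Function.Injective (mcB x) :=
  LinearMap.injective_iff_surjective (f := (mcB x : ModelB →ₗ[ℝ] ModelB)).2 (mcB_surjective x)

end Curves

/-! ### The invariant metric on `SU(2,1)/U(2)` -/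

theorem homeoB_mk (g : SU21) : homeoB (g : SpaceB) = vCoord (toMat g) := rfl

theorem projMB_mk (g : SU21) : projMB (g : SpaceM) = (g : SpaceB) := rfl

/-- The coordinate of `a · boost x`. -/
def transB (a : SU21) (x : ModelB) : ModelB := vCoord (toMat (a * boost x.1 x.2))

theorem contDiff_transB (a : SU21) : ContDiff ℝ ∞ (transB a) := by
  rw [contDiff_iff_contDiffAt]
  intro x
  refine contDiffAt_vCoord ?_ (toMat_22_ne _)
  simp only [toMat_mul, toMat_boost]
  refine contDiffAt_mul (fun _ _ => contDiffAt_const) fun i j => ?_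
  apply contDiffAt_boost <;> fun_prop

/-- The Maurer–Cartan form is invariant under translations, up to the isotropy group. -/
theorem mcB_transB {a : SU21} {x : ModelB} {A : Matrix.unitaryGroup (Fin 2) ℂ}
    (hA : boost (transB a x).1 (transB a x).2 = a * boost x.1 x.2 * kEmb A) (u : ModelB) :
    mcB (transB a x) (fderiv ℝ (transB a) x u) = sigma A (mcB x u) := by
  have h1 : HasDerivAt (fun r : ℝ => ((x + r • u, 0) : ModelM)) (u, 0) 0 := by
    have h : HasDerivAt (fun r : ℝ => x + r • u) u 0 := by
      simpa using ((hasDerivAt_id (0 : ℝ)).smul_const u).const_add x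
    exact h.prodMk (hasDerivAt_const 0 0)
  have h0 : x + (0 : ℝ) • u = x := by simp
  obtain ⟨ξ, h2, h3⟩ := exists_hasDerivAt_vCoord (hasDerivAt_slice h1) (b := a) (A := A) (by
    rw [h0, slice_inl]; exact hA)
  simp only [slice_inl, h0] at h2 h3
  have h4 : HasDerivAt (fun r : ℝ => transB a (x + r • u)) (fderiv ℝ (transB a) x u) 0 := by
    exact ((contDiff_transB a).differentiable
      (by simp) x).hasFDerivAt.comp_hasDerivAt_of_eq (0 : ℝ)
      (by simpa using ((hasDerivAt_id (0 : ℝ)).smul_const u).const_add x) h0.symm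
  rw [h4.unique h2]
  refine h3.trans ?_
  rw [mcB_apply, mcM_eq_projM, slice_inl]

theorem smul_homeoB_symm (a : SU21) (x : ModelB) : homeoB (a • homeoB.symm x) = transB a x := rfl

theorem mdifferentiableAt_smulB (a : SU21) (p : SpaceB) :
    MDifferentiableAt 𝓘(ℝ, ModelB) 𝓘(ℝ, ModelB) (fun q : SpaceB => a • q) p :=
  mdifferentiableAt_of_chart (continuous_const_smul a).continuousAt
    ((contDiff_transB a).differentiable (by simp) _)

theorem mfderiv_smulB (a : SU21) (p : SpaceB) : ∃ A, ∀ u : ModelB,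
    mcB (homeoB (a • p)) (mfderiv 𝓘(ℝ, ModelB) 𝓘(ℝ, ModelB) (fun q : SpaceB => a • q) p u) =
      sigma A (mcB (homeoB p) u) := by
  have e : homeoB (a • p) = transB a (homeoB p) := by
    rw [← smul_homeoB_symm, homeoB.symm_apply_apply]
  obtain ⟨A, hA⟩ := exists_polar (a * boost (homeoB p).1 (homeoB p).2)
  refine ⟨A, fun u => ?_⟩
  rw [e, mfderiv_eq_fderiv_chart (mdifferentiableAt_smulB a p)]
  exact mcB_transB hA u

/-- The global coordinate `homeoB` is the preferred chart at every point, so its differential is the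
identity. -/
theorem mfderiv_homeoB_symm (x u : ModelB) :
    (mfderiv 𝓘(ℝ, ModelB) 𝓘(ℝ, ModelB) homeoB.toOpenPartialHomeomorph.symm x u : ModelB) = u := by
  have e : (chartAt ModelB (homeoB.toOpenPartialHomeomorph.symm x) ∘
      homeoB.toOpenPartialHomeomorph.symm ∘ (chartAt ModelB x).symm) = id := by
    funext y
    exact homeoB.apply_symm_apply y
  rw [mfderiv_eq_fderiv_chart, e]
  · rw [fderiv_id]
    rfl
  · apply mdifferentiableAt_of_chart
    · exact homeoB.symm.continuous.continuousAt
    · rw [e]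
      exact differentiableAt_id

/-- The description of the invariant metric on `SU(2,1)/U(2)` by the Maurer–Cartan form. Unlike in
`IsFormQ`, this form appears explicitly, as the preferred charts are all equal to the global chart
`homeoB` and are not adapted to the points. -/
def IsFormP (h : SemiRiemannianMetric ModelB SpaceB) : Prop :=
  ∀ (p : SpaceB) (u w : TangentSpace 𝓘(ℝ, ModelB) p),
    h.form p u w = formP (mcB (homeoB p) u) (mcB (homeoB p) w)

theorem IsFormP.unique {h h' : SemiRiemannianMetric ModelB SpaceB} (hh : IsFormP h)
    (hh' : IsFormP h') : h = h' := by
  obtain ⟨f, _, _, _⟩ := h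
  obtain ⟨f', _, _, _⟩ := h'
  congr 1
  funext p
  exact ContinuousLinearMap.ext fun u => ContinuousLinearMap.ext fun w =>
    (hh p u w).trans (hh' p u w).symm

theorem exists_isFormP : ∃ h : SemiRiemannianMetric ModelB SpaceB, IsFormP h :=
  ⟨{ form := fun p => formP.bilinearComp (mcB (homeoB p)) (mcB (homeoB p))
     symm := fun p u w => formP_symm (mcB (homeoB p) u) (mcB (homeoB p) w)
     nondegenerate := by
      intro p u h
      have h1 : mcB (homeoB p) u = 0 := by
        apply formP_nondegenerate
        intro w
        obtain ⟨w, rfl⟩ := mcB_surjective (homeoB p) w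
        exact h w
      exact mcB_injective _ (h1.trans (map_zero (mcB (homeoB p))).symm)
     contMDiff := by
      refine contMDiff_form _ fun p₀ => ⟨fun x => formP.bilinearComp (mcB x) (mcB x), ?_, ?_⟩
      · rw [contDiff_clm_apply_iff]
        intro u
        rw [contDiff_clm_apply_iff]
        intro w
        have h : ∀ u, ContDiff ℝ ∞ fun x => mcB x u := fun u =>
          contDiff_mcB.clm_apply contDiff_const
        exact ((contDiff_const (c := formP)).clm_apply (h u)).clm_apply (h w)
      · intro x u w
        have e : homeoB (homeoB.symm x) = x := homeoB.apply_symm_apply x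
        change formP (mcB (homeoB (homeoB.symm x)) _) (mcB (homeoB (homeoB.symm x)) _) = _
        rw [e]
        exact congrArg₂ (fun a b => formP (mcB x a) (mcB x b)) (mfderiv_homeoB_symm x u)
          (mfderiv_homeoB_symm x w) },
    fun _ _ _ => rfl⟩

section Curves

open scoped Matrix.Norms.Operator

theorem homeoB_one : homeoB ((1 : SU21) : SpaceB) = 0 := by
  rw [homeoB_mk, ← slice_zero, vCoord_slice]
  rfl

/-- The vector at the base point generated by `X` is the `𝔥₂`-part of `X`. -/
theorem generatorAt_subK {c : ℝ → SU21} {X : Mat} (h : IsOneParam c X) :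
    (generatorAt (E := ModelB) subK h : ModelB) = (projM X).1 := by
  have hv : vCoord (toMat 1) = 0 := homeoB_one
  obtain ⟨ξ, h1, h2⟩ := exists_hasDerivAt_vCoord (h.hasDerivAt 0) (b := 1) (A := 1) (by
    rw [h.zero, map_one, one_mul, mul_one, hv]
    exact (slice_inl 0).symm.trans slice_zero)
  rw [toMat_inv_mul_mul, h.zero, one_mul, hv, mcB_zero, sigma_one] at h2
  have h3 := (mdifferentiableAt_curve (γ := fun s => (c s : SpaceB)) (s := 0) (ξ := ξ)
    (QuotientGroup.continuous_mk.continuousAt.comp (continuousAt_of_hasDerivAt (h.hasDerivAt 0)))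
    (by simp only [one_mul] at h1; exact h1)).2
  rw [← h2]
  exact h3

end Curves

theorem IsFormP.isMetricB {h : SemiRiemannianMetric ModelB SpaceB} (hh : IsFormP h) :
    IsMetricB h where
  invariant := by
    intro a p u w
    obtain ⟨A, hA⟩ := mfderiv_smulB a p
    rw [hh p]
    exact (hh _ _ _).trans
      ((congrArg₂ (fun a b => formP a b) (hA u) (hA w)).trans (formP_sigma _ _ _))
  base := by
    intro X₀ X₂ Y₀ Y₂ hX₀ hX₂ hY₀ hY₂ c d hc hd
    refine (hh _ _ _).trans ?_
    rw [homeoB_one]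
    refine (congrArg₂ (fun a b => formP a b) ((mcB_zero _).trans (generatorAt_subK hc))
      ((mcB_zero _).trans (generatorAt_subK hd))).trans ?_
    rw [map_add projM, map_add projM, Prod.fst_add, Prod.fst_add,
      projM_fst_of_mem_lieAlg_subK hX₀, projM_fst_of_mem_lieAlg_subK hY₀, zero_add, zero_add,
      eq_of_mem_lieH2 hX₂, eq_of_mem_lieH2 hY₂, formB_lieMat, projM_lieMat, projM_lieMat]
    simp [formP]

theorem exists_smul_outB (p : SpaceB) : ∃ a : SU21, a • ((1 : SU21) : SpaceB) = p := by
  obtain ⟨g, rfl⟩ := QuotientGroup.mk_surjective p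
  refine ⟨g, ?_⟩
  change ((g * 1 : SU21) : SpaceB) = _
  rw [mul_one]

/-- An invariant metric is determined by its value at the base point, as the action is transitive. -/
theorem IsMetricB.isFormP {h : SemiRiemannianMetric ModelB SpaceB} (hh : IsMetricB h) :
    IsFormP h := by
  have h1 : ∀ u w : TangentSpace 𝓘(ℝ, ModelB) ((1 : SU21) : SpaceB),
      h.form ((1 : SU21) : SpaceB) u w = formP u w := by
    intro u w
    have hc : ∀ u : ModelB, IsOneParam (expG _ (isLie_lieMat (u, 0) 0))
        (0 + lieMat (u, 0) 0) := fun u s => by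
      rw [zero_add]; exact isOneParam_expG _ (isLie_lieMat (u, 0) 0) s
    have hz : ∀ u : ModelB, (generatorAt (E := ModelB) subK (hc u) : ModelB) = u := by
      intro u
      rw [generatorAt_subK, zero_add, projM_lieMat]
    have key := hh.base 0 (lieMat (u, 0) 0) 0 (lieMat (w, 0) 0) (zero_mem_lieAlg _)
      (lieMat_mem_lieH2 _) (zero_mem_lieAlg _) (lieMat_mem_lieH2 _) _ _ (hc u) (hc w)
    refine (congrArg₂ (fun a b : TangentSpace 𝓘(ℝ, ModelB) ((1 : SU21) : SpaceB) =>
      h.form ((1 : SU21) : SpaceB) a b) (hz u) (hz w)).symm.trans (key.trans ?_)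
    rw [formB_lieMat, mul_zero, add_zero]
    rfl
  intro p u w
  obtain ⟨a, rfl⟩ := exists_smul_outB p
  obtain ⟨A, hA⟩ := mfderiv_smulB a ((1 : SU21) : SpaceB)
  have hs : ∀ u : TangentSpace 𝓘(ℝ, ModelB) (a • ((1 : SU21) : SpaceB)), ∃ u₀ : ModelB,
      (mfderiv 𝓘(ℝ, ModelB) 𝓘(ℝ, ModelB) (fun q : SpaceB => a • q) ((1 : SU21) : SpaceB) u₀
        : ModelB) = u := by
    intro u
    obtain ⟨v, hv⟩ := sigma_surjective A (mcB (homeoB (a • ((1 : SU21) : SpaceB))) u)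
    refine ⟨v, ?_⟩
    apply mcB_injective (homeoB (a • ((1 : SU21) : SpaceB)))
    refine (hA v).trans ?_
    rw [homeoB_one, mcB_zero, hv]
  obtain ⟨u₀, hu⟩ := hs u
  obtain ⟨w₀, hw⟩ := hs w
  subst hu hw
  refine (hh.invariant a _ u₀ w₀).trans ((h1 u₀ w₀).trans ?_)
  refine ((congrArg₂ (fun a b => formP a b) (hA u₀) (hA w₀)).trans ?_).symm
  rw [formP_sigma, homeoB_one, mcB_zero, mcB_zero]

theorem IsFormP.neg {h : SemiRiemannianMetric ModelB SpaceB} (hh : IsFormP h) (x : SpaceB)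
    (u : TangentSpace 𝓘(ℝ, ModelB) x) (hu : u ≠ 0) : h.form x u u < 0 := by
  rw [hh]
  apply formP_self_neg
  intro h0
  exact hu (mcB_injective _ (h0.trans (map_zero _).symm))

/-! ### The projection as a semi-Riemannian submersion -/

theorem projMB_chart (a : SU21) (p : SpaceM) : ∀ y : ModelM,
    homeoB (a • projMB ((chartM p.out).symm y)) = vCoord (toMat (a * p.out * slice y)) := by
  intro y
  rw [chartM_symm, projMB_mk]
  change homeoB ((a * (p.out * slice y) : SU21) : SpaceB) = _
  rw [homeoB_mk, mul_assoc]

theorem continuous_projMB : Continuous projMB :=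
  QuotientGroup.isOpenQuotientMap_mk.isQuotientMap.continuous_iff.2 QuotientGroup.continuous_mk

theorem contDiff_vCoord_mul_slice (a : SU21) :
    ContDiff ℝ ∞ fun y : ModelM => vCoord (toMat (a * slice y)) := by
  rw [contDiff_iff_contDiffAt]
  intro x
  refine contDiffAt_vCoord ?_ (toMat_22_ne _)
  simp only [toMat_mul]
  exact contDiffAt_mul (fun _ _ => contDiffAt_const) (contDiffAt_slice x)

theorem projMB_chart_eq (p : SpaceM) :
    chartAt ModelB (projMB p) ∘ projMB ∘ (chartAt ModelM p).symm =
      fun y => vCoord (toMat (p.out * slice y)) := by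
  funext y
  have := projMB_chart 1 p y
  rwa [one_smul, one_mul] at this

theorem mdifferentiableAt_projMB (p : SpaceM) :
    MDifferentiableAt 𝓘(ℝ, ModelM) 𝓘(ℝ, ModelB) projMB p := by
  apply mdifferentiableAt_of_chart continuous_projMB.continuousAt
  rw [projMB_chart_eq]
  exact (contDiff_vCoord_mul_slice _).differentiable (by simp) _

/-- The differential of the projection, in terms of the Maurer–Cartan form. -/
theorem mfderiv_projMB (p : SpaceM) : ∃ A, ∀ u : ModelM,
    mcB (homeoB (projMB p)) (mfderiv 𝓘(ℝ, ModelM) 𝓘(ℝ, ModelB) projMB p u) = sigma A u.1 := by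
  have e : homeoB (projMB p) = vCoord (toMat (p.out * slice 0)) := by
    rw [slice_zero, mul_one, ← homeoB_mk, ← projMB_mk, mk_out]
  obtain ⟨A, hA⟩ := exists_polar (p.out * slice 0)
  refine ⟨A, fun u => ?_⟩
  have h0 : (0 : ModelM) + (0 : ℝ) • u = 0 := by simp
  obtain ⟨ξ, h1, h2⟩ := exists_hasDerivAt_vCoord (hasDerivAt_slice (hasDerivAt_line 0 u))
    (b := p.out) (A := A) (by rw [h0, hA])
  rw [h0, ← mcM_eq_projM, mcM_zero, ← e] at h2
  rw [← h2, mfderiv_eq_fderiv_chart (mdifferentiableAt_projMB p), projMB_chart_eq, chartAt_self]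
  have h3 := ((contDiff_vCoord_mul_slice p.out).differentiable
    (by simp) 0).hasFDerivAt.comp_hasDerivAt_of_eq (0 : ℝ) (hasDerivAt_line 0 u) h0.symm
  exact congrArg _ (h3.unique h1)

/-- The vertical vectors are those in `𝔥₁`. -/
theorem mfderiv_projMB_eq_zero (p : SpaceM) (u : TangentSpace 𝓘(ℝ, ModelM) p) :
    mfderiv 𝓘(ℝ, ModelM) 𝓘(ℝ, ModelB) projMB p u = 0 ↔ (u : ModelM).1 = 0 := by
  obtain ⟨A, hA⟩ := mfderiv_projMB p
  constructor
  · intro h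
    apply sigma_injective A
    rw [map_zero]
    refine (hA u).symm.trans ?_
    exact (congrArg (mcB (homeoB (projMB p))) h).trans (map_zero _)
  · intro h
    apply mcB_injective (homeoB (projMB p))
    refine (hA u).trans ?_
    rw [h, map_zero]
    exact (map_zero _).symm

theorem formQ_vertical_pos {c : ℝ} (hc : 0 < c) {b : ℝ × ℂ} (hb : b ≠ 0) :
    0 < formQ c (0, b) (0, b) := by
  obtain ⟨s, w⟩ := b
  have h1 : formQ c (0, (s, w)) (0, (s, w)) = 2 * c * (s ^ 2 + Complex.normSq w) := by
    rw [formQ_apply, Complex.normSq_apply]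
    simp
    left
    ring
  rw [h1]
  have hw := Complex.normSq_nonneg w
  have h2 : 0 < s ^ 2 + Complex.normSq w := by
    by_contra! h
    have hs := sq_nonneg s
    exact hb (Prod.ext (sq_eq_zero_iff.1 (by linarith)) (Complex.normSq_eq_zero.1 (by linarith)))
  positivity

theorem formQ_vertical (c : ℝ) (u : ModelM) (b : ℝ × ℂ) :
    formQ c u (0, b) = formQ c (0, u.2) (0, b) := by
  simp [formQ_apply]

theorem formQ_horizontal (c : ℝ) {u w : ModelM} (hu : u.2 = 0) :
    formQ c u w = formP u.1 w.1 := by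
  rw [formQ_apply, formP_apply, hu]
  simp

/-- The horizontal vectors are those in `𝔥₂`. -/
theorem mem_horizontalSpace {c : ℝ} (hc : 0 < c) {g : SemiRiemannianMetric ModelM SpaceM}
    (hg : IsFormQ c g) (p : SpaceM) (u : TangentSpace 𝓘(ℝ, ModelM) p) :
    u ∈ horizontalSpace ModelB g projMB p ↔ (u : ModelM).2 = 0 := by
  constructor
  · intro h
    have h1 : formQ c u ((0, (u : ModelM).2) : ModelM) = 0 :=
      (hg p u _).symm.trans (h ((0, (u : ModelM).2) : ModelM)
        ((mfderiv_projMB_eq_zero p _).2 rfl))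
    by_contra h0
    exact (formQ_vertical_pos hc h0).ne' ((formQ_vertical c u (u : ModelM).2).symm.trans h1)
  · intro h w hw
    refine (hg p u w).trans ((formQ_horizontal c h).trans ?_)
    rw [(mfderiv_projMB_eq_zero p w).1 hw, map_zero]

theorem mem_contDiffGroupoid_of_contDiff {E : Type*} [NormedAddCommGroup E] [NormedSpace ℝ E]
    {e : OpenPartialHomeomorph E E} (h : ContDiff ℝ ∞ e) (h' : ContDiff ℝ ∞ e.symm) :
    e ∈ contDiffGroupoid ∞ 𝓘(ℝ, E) := by
  rw [contDiffGroupoid, mem_groupoid_of_pregroupoid]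
  exact ⟨h.contDiffOn, h'.contDiffOn⟩

/-- In the preferred chart at `p` and the translate of the global chart of `SU(2,1)/U(2)` by `p.out`,
the projection is the linear projection `x ↦ x.1`. -/
theorem isSubmersion_projMB : Manifold.IsSubmersion 𝓘(ℝ, ModelM) 𝓘(ℝ, ModelB) ∞ projMB := by
  refine ⟨ℝ × ℂ, inferInstance, inferInstance, fun p => ?_⟩
  let ψ : OpenPartialHomeomorph SpaceB ModelB :=
    ((Homeomorph.smul (p.out)⁻¹).trans homeoB).toOpenPartialHomeomorph
  have hψ : ∀ x, ψ.symm x = p.out • homeoB.symm x := by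
    intro x
    change (p.out⁻¹)⁻¹ • homeoB.symm x = _
    rw [inv_inv]
  refine Manifold.IsSubmersionAtOfComplement.mk_of_charts (ContinuousLinearEquiv.refl ℝ ModelM)
    (chartAt ModelM p) ψ (mem_chart_source _ p) (Set.mem_univ _)
    (IsManifold.chart_mem_maximalAtlas p) ?_ (fun _ _ => Set.mem_univ _) ?_
  · rw [IsManifold.maximalAtlas, mem_maximalAtlas_iff]
    rintro _ rfl
    have h1 : ((ψ.symm.trans homeoB.toOpenPartialHomeomorph : _) : ModelB → ModelB) =
        transB p.out := by
      funext x
      change homeoB (ψ.symm x) = _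
      rw [hψ]
      rfl
    have h2 : ((homeoB.toOpenPartialHomeomorph.symm.trans ψ : _) : ModelB → ModelB) =
        transB p.out⁻¹ := rfl
    constructor
    · apply mem_contDiffGroupoid_of_contDiff
      · rw [h1]
        exact contDiff_transB _
      · exact contDiff_transB p.out⁻¹
    · apply mem_contDiffGroupoid_of_contDiff
      · rw [h2]
        exact contDiff_transB _
      · have h3 : ContDiff ℝ ∞ ((ψ.symm.trans homeoB.toOpenPartialHomeomorph : _) :
            ModelB → ModelB) := by
          rw [h1]
          exact contDiff_transB _
        exact h3
  · intro y _
    have := projMB_chart (p.out)⁻¹ p y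
    rw [inv_mul_cancel, one_mul, vCoord_slice] at this
    exact this

theorem IsFormQ.isSemiRiemannianSubmersion {c : ℝ} (hc : 0 < c)
    {g : SemiRiemannianMetric ModelM SpaceM} (hg : IsFormQ c g)
    {h : SemiRiemannianMetric ModelB SpaceB} (hh : IsFormP h) :
    IsSemiRiemannianSubmersion g h projMB where
  surjective := by
    intro x
    obtain ⟨a, rfl⟩ := QuotientGroup.mk_surjective x
    exact ⟨a, rfl⟩
  isSubmersion := isSubmersion_projMB
  fiber := by
    intro p u hu hu'
    have h1 := (mfderiv_projMB_eq_zero p u).1 hu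
    have h2 := (mem_horizontalSpace hc hg p u).1 hu'
    exact Prod.ext h1 h2
  isometric := by
    intro p u w hu _
    have h1 := (mem_horizontalSpace hc hg p u).1 hu
    obtain ⟨A, hA⟩ := mfderiv_projMB p
    rw [hg]
    refine (hh _ _ _).trans ((congrArg₂ (fun a b => formP a b) (hA u) (hA w)).trans ?_)
    rw [formP_sigma]
    exact (formQ_horizontal c h1).symm

theorem IsFormQ.vertical_pos {c : ℝ} (hc : 0 < c) {g : SemiRiemannianMetric ModelM SpaceM}
    (hg : IsFormQ c g) (p : SpaceM) (u : TangentSpace 𝓘(ℝ, ModelM) p)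
    (hu : mfderiv 𝓘(ℝ, ModelM) 𝓘(ℝ, ModelB) projMB p u = 0) (h0 : u ≠ 0) :
    0 < g.form p u u := by
  have h1 := (mfderiv_projMB_eq_zero p u).1 hu
  have h2 : u = ((0, (u : ModelM).2) : ModelM) := Prod.ext h1 rfl
  have h3 : (u : ModelM).2 ≠ 0 := fun h => h0 (Prod.ext h1 h)
  rw [hg, h2]
  exact formQ_vertical_pos hc h3

/-! ### The horizontal distribution is not integrable -/

theorem chart_symm_eq (p : SpaceM) (x : ModelM) :
    (chartAt ModelM p).symm x = ((p.out * slice x : SU21) : SpaceM) := chartM_symm _ _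

/-- The differential of a map to `SU(2,1)/S¹`, in terms of its expression in a chart. -/
theorem exists_mfderiv_eq {V : Type*} [NormedAddCommGroup V] [NormedSpace ℝ V] {f : V → SpaceM}
    {x : V} (hf : MDifferentiableAt 𝓘(ℝ, V) 𝓘(ℝ, ModelM) f x) {p : SpaceM}
    (hp : f x ∈ (chartAt ModelM p).source)
    (hd : DifferentiableAt ℝ (fun y => chartAt ModelM p (f y)) x) :
    ∃ z : Circle, ∀ v : V, (mfderiv 𝓘(ℝ, V) 𝓘(ℝ, ModelM) f x v : ModelM) =
      rho z (mcM (chartAt ModelM p (f x)) (fderiv ℝ (fun y => chartAt ModelM p (f y)) x v)) := by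
  have hs := (chartAt ModelM p).left_inv hp
  obtain ⟨hd', z, hz⟩ := exists_fderiv_chart p.out (chartAt ModelM p (f x))
  rw [← chart_symm_eq, hs] at hd' hz
  refine ⟨z, fun v => ?_⟩
  rw [mfderiv_eq_fderiv_chart hf, ← hz]
  have he : (chartAt ModelM (f x) ∘ f ∘ (chartAt V x).symm) =ᶠ[𝓝 x]
      (fun y => chartAt ModelM (f x) ((p.out * slice y : SU21) : SpaceM)) ∘
        fun y => chartAt ModelM p (f y) := by
    filter_upwards [hf.continuousAt ((chartAt ModelM p).open_source.mem_nhds hp)] with y hy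
    change chartAt ModelM (f x) (f y) = chartAt ModelM (f x) _
    rw [← chart_symm_eq, (chartAt ModelM p).left_inv hy]
  exact congrArg (fun L : V →L[ℝ] ModelM => L v) (he.fderiv_eq.trans (fderiv_comp x hd' hd))

/-- The `𝔥₁`-part of `[𝔥₂, 𝔥₂]` is nonzero. -/
theorem bracket_horizontal_ne : (lieBracket (((1, 0), 0), 0) (((Complex.I, 0), 0), 0)).1.2 ≠ 0 := by
  intro h
  have h1 := congrArg Prod.fst h
  simp [lieBracket, lieCoord_apply, projM_apply, lieMat] at h1
  norm_num at h1

/-- By the Maurer–Cartan equation, the distribution defined by the vanishing of the `𝔥₁`-part of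
the Maurer–Cartan form has no integral manifolds, as `[𝔥₂, 𝔥₂]` has nonzero `𝔥₁`-part. -/
theorem not_integrable_horizontal {V : Type*} [NormedAddCommGroup V] [NormedSpace ℝ V]
    {y : V → ModelM} (hy : ContDiffAt ℝ ∞ y 0) (h0 : y 0 = 0)
    (hv : ∀ᶠ x in 𝓝 0, ∀ v, (mcM (y x) (fderiv ℝ y x v)).2 = 0)
    (hs : ∀ u : ModelM, u.2 = 0 → ∃ v, fderiv ℝ y 0 v = u) : False := by
  have hd : DifferentiableAt ℝ y 0 := hy.differentiableAt (by simp)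
  have hd2 : DifferentiableAt ℝ (fderiv ℝ y) 0 :=
    (hy.fderiv_right (m := ∞) (by simp)).differentiableAt (by simp)
  have hsymm : ∀ v w, fderiv ℝ (fderiv ℝ y) 0 v w = fderiv ℝ (fderiv ℝ y) 0 w v := fun v w =>
    hy.isSymmSndFDerivAt (by simp; norm_cast) v w
  -- differentiate the equation `hv` at `0`
  have key : ∀ v w, (fderiv ℝ mcM 0 (fderiv ℝ y 0 w) (fderiv ℝ y 0 v) +
      fderiv ℝ (fderiv ℝ y) 0 w v).2 = 0 := by
    intro v w
    have h1 : HasFDerivAt (fun x => mcM (y x)) ((fderiv ℝ mcM 0).comp (fderiv ℝ y 0)) 0 := by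
      have := (differentiableAt_mcM (y 0)).hasFDerivAt.comp 0 hd.hasFDerivAt
      rwa [h0] at this
    have h2 : HasFDerivAt (fun x => fderiv ℝ y x v)
        ((ContinuousLinearMap.apply ℝ ModelM v).comp (fderiv ℝ (fderiv ℝ y) 0)) 0 :=
      (ContinuousLinearMap.apply ℝ ModelM v).hasFDerivAt.comp 0 hd2.hasFDerivAt
    have h3 := (ContinuousLinearMap.snd ℝ ModelB (ℝ × ℂ)).hasFDerivAt.comp 0 (h1.clm_apply h2)
    have h4 : HasFDerivAt (fun _ : V => (0 : ℝ × ℂ)) (0 : V →L[ℝ] ℝ × ℂ) 0 :=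
      hasFDerivAt_const _ _
    have h5 := h3.unique (h4.congr_of_eventuallyEq (by
      filter_upwards [hv] with x hx using hx v))
    have h6 := congrFun (congrArg DFunLike.coe h5) w
    have h7 : (mcM (y 0) (fderiv ℝ (fderiv ℝ y) 0 w v) +
      fderiv ℝ mcM 0 (fderiv ℝ y 0 w) (fderiv ℝ y 0 v)).2 = 0 := h6
    rw [h0, mcM_zero] at h7
    rw [add_comm]
    exact h7
  obtain ⟨v, hv⟩ := hs ((Complex.I, 0), 0) rfl
  obtain ⟨w, hw⟩ := hs ((1, 0), 0) rfl
  have e1 := key v w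
  have e2 := key w v
  rw [hsymm] at e2
  rw [hv, hw] at e1 e2
  have e3 := fderiv_mcM_sub 0 ((Complex.I, 0), 0) ((1, 0), 0)
  rw [mc_zero, mc_zero] at e3
  apply bracket_horizontal_ne
  rw [← e3, Prod.snd_sub]
  rw [Prod.snd_add] at e1 e2
  exact sub_eq_zero.2 (add_right_cancel (e2.trans e1.symm))

/-- An integral manifold through the base point, read in the chart, contradicts
`not_integrable_horizontal`. -/
theorem IsFormQ.not_isIntegrableDistribution {c : ℝ} (hc : 0 < c)
    {g : SemiRiemannianMetric ModelM SpaceM} (hg : IsFormQ c g) :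
    ¬ IsIntegrableDistribution (horizontalSpace ModelB g projMB) := by
  intro h
  obtain ⟨d, U, f, hU, h0U, hf0, hf, hD⟩ := h ((1 : SU21) : SpaceM)
  set p := ((1 : SU21) : SpaceM) with hp
  have hfa : ∀ x ∈ U, ContMDiffAt 𝓘(ℝ, EuclideanSpace ℝ (Fin d)) 𝓘(ℝ, ModelM) ∞ f x :=
    fun x hx => hf.contMDiffAt (hU.mem_nhds hx)
  have hsrc : ∀ᶠ x in 𝓝 (0 : EuclideanSpace ℝ (Fin d)), f x ∈ (chartAt ModelM p).source := by
    apply (hfa 0 h0U).continuousAt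
    rw [hf0]
    exact (chartAt ModelM p).open_source.mem_nhds (mem_chart_source _ _)
  have hyd : ∀ x ∈ U, f x ∈ (chartAt ModelM p).source →
      ContDiffAt ℝ ∞ (fun x => chartAt ModelM p (f x)) x := by
    intro x hx hxs
    rw [← contMDiffAt_iff_contDiffAt]
    exact (contMDiffAt_of_mem_maximalAtlas (IsManifold.chart_mem_maximalAtlas p) hxs).comp x
      (hfa x hx)
  have hrel : ∀ x ∈ U, f x ∈ (chartAt ModelM p).source → ∃ z : Circle, ∀ v,
      (mfderiv 𝓘(ℝ, EuclideanSpace ℝ (Fin d)) 𝓘(ℝ, ModelM) f x v : ModelM) =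
      rho z (mcM (chartAt ModelM p (f x)) (fderiv ℝ (fun y => chartAt ModelM p (f y)) x v)) :=
    fun x hx hxs => exists_mfderiv_eq ((hfa x hx).mdifferentiableAt (by simp)) hxs
      ((hyd x hx hxs).differentiableAt (by simp))
  have hs0 : f 0 ∈ (chartAt ModelM p).source := hsrc.self_of_nhds
  have hy0 : chartAt ModelM p (f 0) = 0 := by rw [hf0, chartAt_self]
  apply not_integrable_horizontal (hyd 0 h0U hs0) hy0
  · filter_upwards [hsrc, hU.mem_nhds h0U] with x hxs hx v
    obtain ⟨z, hz⟩ := hrel x hx hxs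
    have h1 : mfderiv 𝓘(ℝ, EuclideanSpace ℝ (Fin d)) 𝓘(ℝ, ModelM) f x v ∈
        horizontalSpace ModelB g projMB (f x) := by
      rw [← (hD x hx).2]
      exact ⟨v, rfl⟩
    have h2 := (mem_horizontalSpace hc hg _ _).1 h1
    exact (congrArg Prod.snd (hz v)).symm.trans h2
  · intro u hu
    obtain ⟨z, hz⟩ := hrel 0 h0U hs0
    have h1 : (rho z u : TangentSpace 𝓘(ℝ, ModelM) (f 0)) ∈
        horizontalSpace ModelB g projMB (f 0) := (mem_horizontalSpace hc hg _ _).2 hu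
    rw [← (hD 0 h0U).2] at h1
    obtain ⟨v, hv⟩ := h1
    refine ⟨v, ?_⟩
    have h2 := (hz v).symm.trans hv
    rw [hy0, mcM_zero] at h2
    exact rho_injective z h2

/-! ### The momentum of a curve in `SU(2,1)/S¹` -/

/-- The inertia operator `X₁ + X₂ ↦ c X₁ + X₂`, which relates the metric to the invariant form `B`:
`formQ c X Y = B(X, inertia c Y)`. -/
def inertia (c : ℝ) : ModelM →L[ℝ] ModelM :=
  (ContinuousLinearMap.fst ℝ ModelB (ℝ × ℂ)).prod (c • ContinuousLinearMap.snd ℝ ModelB (ℝ × ℂ))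

theorem inertia_apply (c : ℝ) (u : ModelM) : inertia c u = (u.1, c • u.2) := rfl

theorem inertia_injective {c : ℝ} (hc : 0 < c) : Function.Injective (inertia c) := by
  intro u v h
  rw [inertia_apply, inertia_apply, Prod.mk.injEq] at h
  exact Prod.ext h.1 (smul_right_injective _ hc.ne' h.2)

theorem inertia_inv {c : ℝ} (hc : 0 < c) (u : ModelM) : inertia c⁻¹ (inertia c u) = u := by
  rw [inertia_apply, inertia_apply]
  refine Prod.ext rfl ?_
  change c⁻¹ • c • u.2 = u.2
  rw [smul_smul, inv_mul_cancel₀ hc.ne', one_smul]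

/-- The momentum of the vector `u` at `g H`, where `u ∈ 𝔥₂ ⊕ 𝔥₁` is the vector translated to the
origin by `g⁻¹`. It is the value of the moment map of the action of `SU(2,1)`, the Lie algebra being
identified with its dual by `B`. -/
def momentum (c : ℝ) (g : SU21) (u : ModelM) : Mat :=
  toMat g * lieMat (inertia c u) 0 * toMat g⁻¹

/-- The vector can be recovered from its momentum and the point `g`. -/
theorem projM_momentum (c : ℝ) (g : SU21) (u : ModelM) :
    projM (toMat g⁻¹ * momentum c g u * toMat g) = inertia c u := by
  rw [momentum, mul_assoc, mul_assoc _ (toMat g⁻¹), toMat_inv_mul, mul_one, ← mul_assoc,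
    toMat_inv_mul, one_mul, projM_lieMat]

theorem momentum_injective {c : ℝ} (hc : 0 < c) (g : SU21) : Function.Injective (momentum c g) := by
  intro u v h
  apply inertia_injective hc
  rw [← projM_momentum c g, h, projM_momentum]

/-- `rho z` is the conjugation by the inverse of `circleEmb z`. -/
theorem lieMat_rho (z : Circle) (u : ModelM) :
    lieMat (rho z u) 0 = toMat (circleEmb z)⁻¹ * lieMat u 0 * toMat (circleEmb z) := by
  have h := conj_mul_circle z
  have h' : ((z : ℂ) ^ 2)⁻¹ = conj (z : ℂ) ^ 2 := by
    apply inv_eq_of_mul_eq_one_left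
    rw [← mul_pow, h, one_pow]
  have h2 : ∀ x : ℂ, conj (z : ℂ) * x * z = x := fun x => by linear_combination x * h
  rw [toMat_circle_inv, toMat_circleEmb, circleMat_eq_diagonal, circleMat_eq_diagonal]
  have h3 : (conj (z : ℂ) ^ 2)⁻¹ = (z : ℂ) ^ 2 := by rw [← h', inv_inv]
  ext i j
  rw [Matrix.mul_diagonal, Matrix.diagonal_mul]
  fin_cases i <;> fin_cases j <;> simp [lieMat, rho_apply, h2, h3, h'] <;> ring

/-- The momentum depends only on the tangent vector of `SU(2,1)/S¹`, not on the choice of `g` in its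
coset. -/
theorem momentum_gauge (c : ℝ) (g : SU21) (z : Circle) (u : ModelM) :
    momentum c (g * circleEmb z) (rho z u) = momentum c g u := by
  have h1 : inertia c (rho z u) = rho z (inertia c u) := rfl
  rw [momentum, h1, lieMat_rho, momentum, mul_inv_rev, toMat_mul, toMat_mul]
  have h2 : toMat (circleEmb z) * toMat (circleEmb z)⁻¹ = 1 := toMat_mul_inv _
  calc _ = toMat g * (toMat (circleEmb z) * toMat (circleEmb z)⁻¹) * lieMat (inertia c u) 0 *
        (toMat (circleEmb z) * toMat (circleEmb z)⁻¹) * toMat g⁻¹ := by noncomm_ring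
    _ = _ := by rw [h2, mul_one, mul_one]

/-- Euler's equation: the covariant derivative of the velocity corresponds to the derivative of the
momentum. -/
theorem bracket_inertia (c : ℝ) (u : ModelM) (θ : ℝ) :
    lieMat u θ * lieMat (inertia c u) 0 - lieMat (inertia c u) 0 * lieMat u θ =
      lieMat (inertia c (nomizu c (u, θ) u)) 0 := by
  obtain ⟨⟨p, q⟩, s, w⟩ := u
  simp only [inertia_apply, nomizu_apply]
  ext i j
  fin_cases i <;> fin_cases j <;>
    simp [lieMat, Complex.conj_ofNat] <;> ring

theorem lieMat_add_zero (u v : ModelM) : lieMat (u + v) 0 = lieMat u 0 + lieMat v 0 := by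
  rw [lieMat_add, add_zero]

section Curves

open scoped Matrix.Norms.Operator

/-- The momentum along a curve in `SU(2,1)/S¹`. -/
def momentumAlong (c : ℝ) (γ : ℝ → SpaceM) (s : ℝ) : Mat :=
  momentum c (γ s).out (deriv (fun r => chartAt ModelM (γ s) (γ r)) s)

/-- The momentum along a curve can be computed by means of any lift of the curve to `SU(2,1)`. -/
theorem momentumAlong_eq (c : ℝ) {γ : ℝ → SpaceM} {g : ℝ → SU21} {G' : Mat} {s : ℝ}
    (h : HasDerivAt (fun r => toMat (g r)) G' s) (hg : ∀ᶠ r in 𝓝 s, γ r = (g r : SpaceM)) :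
    momentumAlong c γ s = momentum c (g s) (projM (toMat (g s)⁻¹ * G')) := by
  have hs : γ s = (g s : SpaceM) := hg.self_of_nhds
  obtain ⟨z, hz⟩ : ∃ z : Circle, circleEmb z = (g s)⁻¹ * (γ s).out := by
    have : (g s : SpaceM) = ((γ s).out : SU21) := by rw [mk_out, hs]
    obtain ⟨z, hz⟩ := QuotientGroup.eq.1 this
    exact ⟨z, hz⟩
  have hz1 : (γ s).out = g s * circleEmb z := by rw [hz, mul_inv_cancel_left]
  have h1 : (γ s).out⁻¹ * g s * circleEmb z = 1 := by rw [hz1]; group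
  have h0 : coords (toMat ((γ s).out⁻¹ * g s)) = 0 := by
    rw [← coords_mul_circle _ z, ← toMat_circleEmb, ← toMat_mul, h1, coords_one]
  have hk : kTrace (toMat ((γ s).out⁻¹ * g s)) ≠ 0 := by
    intro h0
    apply kTrace_one
    rw [← h1, toMat_mul, toMat_circleEmb, kTrace_mul_circle, h0, zero_mul]
  obtain ⟨ξ, h2, h3⟩ := exists_hasDerivAt_coords h (b := (γ s).out⁻¹) hk (z := z)
    (by rw [h0, slice_zero, h1])
  rw [h0, mcM_zero] at h3
  have h5 : HasDerivAt (fun r => chartAt ModelM (γ s) (γ r)) ξ s := by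
    refine h2.congr_of_eventuallyEq ?_
    filter_upwards [hg] with r hr
    rw [hr, chartAt_eq, chartM_mk]
  rw [momentumAlong, h5.deriv, ← momentum_gauge c (g s) z, ← hz1]
  exact congrArg _ h3

theorem hasDerivAt_lieMat {y : ℝ → ModelM} {y' : ModelM} {s : ℝ} (h : HasDerivAt y y' s) :
    HasDerivAt (fun r => lieMat (y r) 0) (lieMat y' 0) s := by
  have hp : HasDerivAt (fun r => (y r).1.1) y'.1.1 s :=
    ((ContinuousLinearMap.fst ℝ ℂ ℂ).comp
      (ContinuousLinearMap.fst ℝ ModelB (ℝ × ℂ))).hasFDerivAt.comp_hasDerivAt s h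
  have hq : HasDerivAt (fun r => (y r).1.2) y'.1.2 s :=
    ((ContinuousLinearMap.snd ℝ ℂ ℂ).comp
      (ContinuousLinearMap.fst ℝ ModelB (ℝ × ℂ))).hasFDerivAt.comp_hasDerivAt s h
  have hs : HasDerivAt (fun r => (y r).2.1) y'.2.1 s :=
    ((ContinuousLinearMap.fst ℝ ℝ ℂ).comp
      (ContinuousLinearMap.snd ℝ ModelB (ℝ × ℂ))).hasFDerivAt.comp_hasDerivAt s h
  have hw : HasDerivAt (fun r => (y r).2.2) y'.2.2 s :=
    ((ContinuousLinearMap.snd ℝ ℝ ℂ).comp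
      (ContinuousLinearMap.snd ℝ ModelB (ℝ × ℂ))).hasFDerivAt.comp_hasDerivAt s h
  have hconj : ∀ {f : ℝ → ℂ} {f' : ℂ}, HasDerivAt f f' s →
      HasDerivAt (fun r => conj (f r)) (conj f') s := fun hf =>
    (Complex.conjCLE : ℂ →L[ℝ] ℂ).hasFDerivAt.comp_hasDerivAt s hf
  have hs' := hs.ofReal_comp.const_mul Complex.I
  apply hasDerivAt_of_entries
  intro i j
  fin_cases i <;> fin_cases j <;> simp [lieMat]
  · exact hs'
  · exact (hconj hw).fun_neg
  · exact hp
  · exact hw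
  · exact hs'.fun_neg
  · exact hq
  · exact hconj hp
  · exact hconj hq
  · exact hasDerivAt_const _ _

theorem hasDerivAt_conj {g : ℝ → SU21} {X : ℝ → Mat} {L X' : Mat} {s : ℝ}
    (hg : HasDerivAt (fun r => toMat (g r)) (toMat (g s) * L) s) (hX : HasDerivAt X X' s) :
    HasDerivAt (fun r => toMat (g r) * X r * toMat (g r)⁻¹)
      (toMat (g s) * (X' + (L * X s - X s * L)) * toMat (g s)⁻¹) s := by
  have h3 := hasDerivAt_toMat_inv hg
  rw [← mul_assoc, toMat_inv_mul, one_mul] at h3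
  refine ((hg.fun_mul hX).fun_mul h3).congr_deriv ?_
  generalize toMat (g s) = a
  generalize toMat (g s)⁻¹ = b
  noncomm_ring

theorem hasDerivAt_mul_slice (b : SU21) {y : ℝ → ModelM} {y' : ModelM} {s : ℝ}
    (h : HasDerivAt y y' s) : HasDerivAt (fun r => toMat (b * slice (y r)))
      (toMat (b * slice (y s)) * lieMat (mcM (y s) y') (mc (y s) y').2) s := by
  refine (hasDerivAt_toMat_const_mul (hasDerivAt_slice h) b).congr_deriv ?_
  have e2 : lieMat (mcM (y s) y') (mc (y s) y').2 = toMat (slice (y s))⁻¹ * dSlice (y s) y' :=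
    lieMat_mc _ _
  rw [e2, toMat_mul, mul_assoc, ← mul_assoc (toMat (slice (y s))), toMat_mul_inv, one_mul]

/-- The derivative of the momentum of a curve is the momentum of its acceleration. -/
theorem hasDerivAt_momentum {c : ℝ} (b : SU21) {y : ℝ → ModelM} (y' : ℝ → ModelM) {y'' : ModelM}
    (hc : 0 < c) {s : ℝ} (h : HasDerivAt y (y' s) s) (h' : HasDerivAt y' y'' s) :
    HasDerivAt (fun r => momentum c (b * slice (y r)) (mcM (y r) (y' r)))
      (momentum c (b * slice (y s))
        (mcM (y s) (y'' + christoffel (sliceMetric c) (y s) (y' s) (y' s)))) s := by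
  have h1 : HasDerivAt (fun r => mcM (y r) (y' r))
      (fderiv ℝ mcM (y s) (y' s) (y' s) + mcM (y s) y'') s := by
    have e1 := ((differentiableAt_mcM (y s)).hasFDerivAt.comp_hasDerivAt s h)
    exact e1.clm_apply h'
  have h4 := hasDerivAt_lieMat ((inertia c).hasFDerivAt.comp_hasDerivAt s h1)
  have h5 := hasDerivAt_conj (hasDerivAt_mul_slice b h) h4
  refine h5.congr_deriv ?_
  have e2 : inertia c (mcM (y s) (y'' + christoffel (sliceMetric c) (y s) (y' s) (y' s))) =
      inertia c (fderiv ℝ mcM (y s) (y' s) (y' s) + mcM (y s) y'') +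
        inertia c (nomizu c (mcM (y s) (y' s), (mc (y s) (y' s)).2) (mcM (y s) (y' s))) := by
    rw [map_add (mcM (y s)), mcM_christoffel hc, ← map_add]
    congr 1
    have e3 : nomizu c (mcM (y s) (y' s), (mc (y s) (y' s)).2) (mcM (y s) (y' s)) =
      nomizu c (mc (y s) (y' s)) (mcM (y s) (y' s)) := rfl
    rw [e3]
    abel
  rw [momentum, e2, lieMat_add_zero, ← bracket_inertia]
  rfl

end Curves

/-! ### Geodesics are determined by their momentum -/

section

variable {E M : Type*} [NormedAddCommGroup E] [NormedSpace ℝ E] [TopologicalSpace M]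
  [ChartedSpace E M]

theorem contMDiffAt_curve_iff {γ : ℝ → M} {s : ℝ} : ContMDiffAt 𝓘(ℝ, ℝ) 𝓘(ℝ, E) ∞ γ s ↔
    ContinuousAt γ s ∧ ContDiffAt ℝ ∞ (fun r => chartAt E (γ s) (γ r)) s := by
  rw [contMDiffAt_iff]
  simp only [mfld_simps]
  rw [contDiffWithinAt_univ]
  rfl

end

/-- A curve in the chart around a point of it. -/
theorem eventually_eq_slice {γ : ℝ → SpaceM} {s : ℝ} (h : ContinuousAt γ s) :
    ∀ᶠ r in 𝓝 s, γ r = ((γ s).out * slice (chartAt ModelM (γ s) (γ r)) : SU21) := by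
  have h1 := h.preimage_mem_nhds (chart_source_mem_nhds ModelM (γ s))
  filter_upwards [h1] with r hr
  rw [← chartM_symm, ← chartAt_eq]
  exact ((chartAt ModelM (γ s)).left_inv hr).symm

/-- The momentum along a curve in the coordinates around a point of it. -/
theorem eventually_momentumAlong (c : ℝ) {γ : ℝ → SpaceM} {s : ℝ}
    (h : ContMDiffAt 𝓘(ℝ, ℝ) 𝓘(ℝ, ModelM) ∞ γ s) {y : ℝ → ModelM}
    (hy : y = fun r => chartAt ModelM (γ s) (γ r)) :
    ∀ᶠ r in 𝓝 s, DifferentiableAt ℝ y r ∧ momentumAlong c γ r =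
      momentum c ((γ s).out * slice (y r)) (mcM (y r) (deriv y r)) := by
  obtain ⟨h1, h2⟩ := contMDiffAt_curve_iff.1 h
  rw [← hy] at h2
  have h3 := (h2.of_le (m := 1) (by simp)).eventually (by simp)
  filter_upwards [h3, (eventually_eq_slice h1).eventually_nhds] with r hr hr'
  have hd := hr.differentiableAt (by simp)
  refine ⟨hd, ?_⟩
  rw [momentumAlong_eq c (hasDerivAt_mul_slice (γ s).out hd.hasDerivAt) (by rw [hy]; exact hr')]
  rw [← mul_assoc, toMat_inv_mul, one_mul, projM_lieMat]

section

open scoped Matrix.Norms.Operator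

/-- The derivative of the momentum along a curve is the momentum of its acceleration. -/
theorem IsFormQ.hasDerivAt_momentumAlong {c : ℝ} {g : SemiRiemannianMetric ModelM SpaceM}
    (hg : IsFormQ c g) (hc : 0 < c) {γ : ℝ → SpaceM} {s : ℝ}
    (h : ContMDiffAt 𝓘(ℝ, ℝ) 𝓘(ℝ, ModelM) ∞ γ s) :
    HasDerivAt (momentumAlong c γ) (momentum c (γ s).out (g.acceleration γ s)) s := by
  obtain ⟨y, hy⟩ : ∃ y : ℝ → ModelM, y = fun r => chartAt ModelM (γ s) (γ r) := ⟨_, rfl⟩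
  have h2 := (contMDiffAt_curve_iff.1 h).2
  rw [← hy] at h2
  have h0 : y s = 0 := by rw [hy]; exact chartAt_self (γ s)
  have hd : DifferentiableAt ℝ y s := h2.differentiableAt (by simp)
  have hd' : DifferentiableAt ℝ (deriv y) s :=
    ((h2.fderiv_right (m := 1) (by norm_cast)).differentiableAt (by simp)).clm_apply
      (differentiableAt_const (1 : ℝ))
  have h3 := hasDerivAt_momentum (γ s).out (deriv y) hc hd.hasDerivAt hd'.hasDerivAt
  rw [h0, slice_zero, mul_one, mcM_zero] at h3
  have h4 : g.acceleration γ s = deriv (deriv y) s + christoffel (sliceMetric c) 0 (deriv y s)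
      (deriv y s) := by
    rw [SemiRiemannianMetric.acceleration, chartAt_self]
    simp only [← hy]
    rw [chartAt_eq, inChart_chartM hg]
  rw [h4]
  refine h3.congr_of_eventuallyEq ?_
  filter_upwards [eventually_momentumAlong c h hy] with r hr using hr.2

end

/-- The vector field the integral curves of which are the geodesics with momentum `N`, in
coordinates. -/
def geodesicField (c : ℝ) (b : SU21) (N : Mat) (x : ModelM) : ModelM :=
  (mcM x).inverse (inertia c⁻¹ (projM (toMat (b * slice x)⁻¹ * N * toMat (b * slice x))))

/-- The velocity is recovered from the momentum. -/
theorem geodesicField_momentum {c : ℝ} (hc : 0 < c) (b : SU21) (x u : ModelM) :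
    geodesicField c b (momentum c (b * slice x) (mcM x u)) x = u := by
  rw [geodesicField, projM_momentum, inertia_inv hc, mcM_inverse_apply]

theorem contDiff_geodesicField (c : ℝ) (b : SU21) (N : Mat) :
    ContDiff ℝ ∞ (geodesicField c b N) := by
  have h1 : ∀ i j, ContDiff ℝ ∞ fun x : ModelM => toMat (b * slice x) i j := fun i j => by
    simp only [toMat_mul, Matrix.mul_apply]
    exact ContDiff.sum fun k _ => contDiff_const.mul (contDiff_slice_entry k j)
  have h2 : ∀ i j, ContDiff ℝ ∞ fun x : ModelM => toMat (b * slice x)⁻¹ i j := fun i j => by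
    simp only [toMat_inv_entry]
    exact (contDiff_const.mul (Complex.conjCLE.contDiff.comp (h1 j i))).mul contDiff_const
  have h3 : ∀ i j, ContDiff ℝ ∞ fun x : ModelM =>
      (toMat (b * slice x)⁻¹ * N * toMat (b * slice x)) i j := fun i j => by
    simp only [Matrix.mul_apply]
    exact ContDiff.sum fun k _ => (ContDiff.sum fun l _ => (h2 i l).mul contDiff_const).mul (h1 k j)
  have h4 : ∀ i j, ContDiff ℝ ∞ fun x : ModelM =>
      ((toMat (b * slice x)⁻¹ * N * toMat (b * slice x)) i j).im :=
    fun i j => Complex.imCLM.contDiff.comp (h3 i j)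
  refine contDiff_mcM_inverse.clm_apply ((inertia c⁻¹).contDiff.comp ?_)
  simp only [projM_apply]
  exact ((h3 0 2).prodMk (h3 1 2)).prodMk ((((h4 0 0).sub (h4 1 1)).div_const 2).prodMk (h3 1 0))

/-- Curves with constant momentum `N` are integral curves of `geodesicField`, so the uniqueness theorem
for ordinary differential equations applies. -/
theorem eventuallyEq_of_momentumAlong {c : ℝ} (hc : 0 < c) {γ₁ γ₂ : ℝ → SpaceM} {s : ℝ} {N : Mat}
    (h₁ : ContMDiffAt 𝓘(ℝ, ℝ) 𝓘(ℝ, ModelM) ∞ γ₁ s) (h₂ : ContMDiffAt 𝓘(ℝ, ℝ) 𝓘(ℝ, ModelM) ∞ γ₂ s)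
    (hN₁ : ∀ᶠ r in 𝓝 s, momentumAlong c γ₁ r = N) (hN₂ : ∀ᶠ r in 𝓝 s, momentumAlong c γ₂ r = N)
    (hs : γ₁ s = γ₂ s) : γ₁ =ᶠ[𝓝 s] γ₂ := by
  have key : ∀ γ : ℝ → SpaceM, ContMDiffAt 𝓘(ℝ, ℝ) 𝓘(ℝ, ModelM) ∞ γ s →
      (∀ᶠ r in 𝓝 s, momentumAlong c γ r = N) → ∀ᶠ r in 𝓝 s,
        HasDerivAt (fun r => chartAt ModelM (γ s) (γ r))
          (geodesicField c (γ s).out N (chartAt ModelM (γ s) (γ r))) r := by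
    intro γ h hN
    filter_upwards [eventually_momentumAlong c h rfl, hN] with r hr hr'
    refine hr.1.hasDerivAt.congr_deriv ?_
    rw [← hr', hr.2, geodesicField_momentum hc]
  have k1 := key γ₁ h₁ hN₁
  have k2 := key γ₂ h₂ hN₂
  have c1 := (contMDiffAt_curve_iff.1 h₁)
  have c2 := (contMDiffAt_curve_iff.1 h₂)
  have e1 := eventually_eq_slice c1.1
  have e2 := eventually_eq_slice c2.1
  rw [← hs] at k2 c2 e2
  obtain ⟨K, U, hU, hK⟩ := (((contDiff_geodesicField c (γ₁ s).out N).of_le (by simp)).contDiffAt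
    (x := (0 : ModelM))).exists_lipschitzOnWith
  have m1 := c1.2.continuousAt.preimage_mem_nhds (t := U) (by rwa [chartAt_self])
  have m2 := c2.2.continuousAt.preimage_mem_nhds (t := U) (by rwa [← hs, chartAt_self])
  have h := ODE_solution_unique_of_eventually (v := fun _ => geodesicField c (γ₁ s).out N)
    (s := fun _ => U) (Filter.Eventually.of_forall fun _ => hK) (k1.and m1) (k2.and m2) (by rw [hs])
  filter_upwards [e1, e2, h] with r h1 h2 h3
  rw [h1, h2, h3]

instance isClosed_subH : IsClosed (subH : Set SU21) := by
  have h : Continuous circleEmb := by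
    apply continuous_ofMat
    intro i j
    have hz : ∀ z : Circle, ((z : ℂ) ^ 2)⁻¹ = conj (z : ℂ) ^ 2 := fun z => by
      apply inv_eq_of_mul_eq_one_left
      rw [← mul_pow, conj_mul_circle, one_pow]
    simp only [toMat_circleEmb, circleMat, hz]
    have hc : Continuous fun z : Circle => (z : ℂ) := continuous_subtype_val
    have hc' : Continuous fun z : Circle => conj (z : ℂ) ^ 2 :=
      (Complex.continuous_conj.comp hc).pow 2
    fin_cases i <;> fin_cases j <;> simp <;> first | exact continuous_const | assumption
  rw [subH, MonoidHom.coe_range]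
  exact (isCompact_range h).isClosed

/-- Curves with the same constant momentum which meet once agree. -/
theorem eqOn_of_momentumAlong {c : ℝ} (hc : 0 < c) {γ₁ γ₂ : ℝ → SpaceM} {J : Set ℝ} {N : Mat}
    (hJ : IsOpen J) (hJ' : J.OrdConnected)
    (h₁ : ContMDiffOn 𝓘(ℝ, ℝ) 𝓘(ℝ, ModelM) ∞ γ₁ J) (h₂ : ContMDiffOn 𝓘(ℝ, ℝ) 𝓘(ℝ, ModelM) ∞ γ₂ J)
    (hN₁ : ∀ r ∈ J, momentumAlong c γ₁ r = N) (hN₂ : ∀ r ∈ J, momentumAlong c γ₂ r = N)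
    {s : ℝ} (hsJ : s ∈ J) (hs : γ₁ s = γ₂ s) : Set.EqOn γ₁ γ₂ J := by
  have key : ∀ r ∈ J, γ₁ r = γ₂ r → γ₁ =ᶠ[𝓝 r] γ₂ := fun r hr h =>
    eventuallyEq_of_momentumAlong hc (h₁.contMDiffAt (hJ.mem_nhds hr))
      (h₂.contMDiffAt (hJ.mem_nhds hr)) (Filter.eventually_of_mem (hJ.mem_nhds hr) hN₁)
      (Filter.eventually_of_mem (hJ.mem_nhds hr) hN₂) h
  have hu : IsOpen {r | γ₁ =ᶠ[𝓝 r] γ₂} := isOpen_setOfPred_eventually_nhds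
  have hsub := hJ'.isPreconnected.subset_of_closure_inter_subset hu ⟨s, hsJ, key s hsJ hs⟩ (by
    rintro r ⟨hr, hrJ⟩
    exact key r hrJ (tendsto_nhds_unique_of_frequently_eq
      (h₁.continuousOn.continuousAt (hJ.mem_nhds hrJ))
      (h₂.continuousOn.continuousAt (hJ.mem_nhds hrJ))
      ((mem_closure_iff_frequently.1 hr).mono fun r' h => h.self_of_nhds)))
  exact fun r hr => (hsub hr).self_of_nhds

/-! ### The geodesics and completeness -/

theorem conjTranspose_toMat (k : SU21) : (toMat k)ᴴ = I21 * toMat k⁻¹ * I21 := by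
  rw [toMat_inv]
  calc _ = (I21 * I21) * (toMat k)ᴴ * (I21 * I21) := by rw [I21_mul_I21]; simp
    _ = _ := by noncomm_ring

theorem isLie_conj {X : Mat} (hX : IsLie X) (k : SU21) : IsLie (toMat k⁻¹ * X * toMat k) := by
  obtain ⟨h1, h2⟩ := hX
  refine ⟨?_, ?_⟩
  · have h3 : Xᴴ = I21 * -X * I21 := by
      rw [mul_neg, ← eq_neg_of_add_eq_zero_left h1, mul_assoc, I21_mul_I21, mul_one]
    rw [Matrix.conjTranspose_mul, Matrix.conjTranspose_mul, h3, conjTranspose_toMat,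
      conjTranspose_toMat, inv_inv]
    calc _ = -(I21 * toMat k⁻¹ * (I21 * I21) * X * (I21 * I21) * toMat k * (I21 * I21)) +
          I21 * (toMat k⁻¹ * X * toMat k) := by noncomm_ring
      _ = 0 := by rw [I21_mul_I21]; noncomm_ring
  · rw [Matrix.trace_mul_comm, ← mul_assoc, toMat_mul_inv, one_mul, h2]

/-- The group `K` preserves `𝔥₁` and `𝔥₂`, and hence commutes with the inertia operator. -/
theorem exists_conj_inertia {k : SU21} (hk : k ∈ subK) (v : ModelM) : ∃ w, ∀ c : ℝ,
    toMat k⁻¹ * lieMat (inertia c v) 0 * toMat k = lieMat (inertia c w) 0 := by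
  refine ⟨projM (toMat k⁻¹ * lieMat v 0 * toMat k), fun c => ?_⟩
  rw [(isLie_conj (isLie_lieMat (inertia c v) 0) k).eq_lieMat]
  obtain ⟨A, rfl⟩ := hk
  rw [toMat_kEmb_inv, toMat_kEmb]
  congr 1
  · simp only [projM_apply, inertia_apply]
    ext1
    · simp [kMat, lieMat, Matrix.mul_apply, Fin.sum_univ_three]
    · ext1
      · simp [kMat, lieMat, Matrix.mul_apply, Fin.sum_univ_three]
        ring
      · simp [kMat, lieMat, Matrix.mul_apply, Fin.sum_univ_three]
        ring
  · simp [kMat, lieMat, Matrix.mul_apply, Fin.sum_univ_three]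

section

open scoped Matrix.Norms.Operator

theorem contDiff_exp_smul (X : Mat) : ContDiff ℝ ∞ fun r : ℝ => NormedSpace.exp (r • X) := by
  have h : ContDiff ℝ ∞ (NormedSpace.exp : Mat → Mat) := contDiff_iff_contDiffAt.2 fun x =>
    (NormedSpace.exp_analytic (𝕂 := ℝ) x).contDiffAt
  exact h.comp (contDiff_id.smul contDiff_const)

theorem contDiff_expG_entry (X : Mat) (hX : IsLie X) (i j : Fin 3) :
    ContDiff ℝ ∞ fun r : ℝ => toMat (expG X hX r) i j :=
  (entryL i j).contDiff.comp (contDiff_exp_smul X)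

theorem contMDiffAt_mk {g : ℝ → SU21} {s : ℝ}
    (h : ∀ i j, ContDiffAt ℝ ∞ (fun r => toMat (g r) i j) s) :
    ContMDiffAt 𝓘(ℝ, ℝ) 𝓘(ℝ, ModelM) ∞ (fun r => (g r : SpaceM)) s := by
  refine contMDiffAt_curve_iff.2 ⟨?_, ?_⟩
  · refine QuotientGroup.continuous_mk.continuousAt.comp ?_
    rw [isInducing_toMat.continuousAt_iff]
    exact continuousAt_pi.2 fun i => continuousAt_pi.2 fun j => (h i j).continuousAt
  · have e : (fun r => chartAt ModelM (g s : SpaceM) (g r : SpaceM)) =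
      fun r => coords (toMat ((g s : SpaceM).out⁻¹ * g r)) := rfl
    rw [e]
    have hk : kTrace (toMat ((g s : SpaceM).out⁻¹ * g s)) ≠ 0 := by
      rw [← mk_mem_chartM_source]
      exact mem_chartM_out _
    refine contDiffAt_coords ?_ (toMat_22_ne _) hk
    simp only [toMat_mul]
    exact contDiffAt_mul (fun _ _ => contDiffAt_const) h

/-- The lift `b exp(r M) exp(r Z)` of the geodesic with initial vector `v` at `b H`, where
`M = c v₁ + v₂` is the momentum and `Z = (1 - c) v₁`. The second factor lies in `K` and makes
`M + Z = v`; as the inertia operator commutes with the conjugation by `exp(r Z)`, the momentum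
remains constant. -/
def geodesicLift (c : ℝ) (b : SU21) (v : ModelM) (r : ℝ) : SU21 :=
  b * expG (lieMat (inertia c v) 0) (isLie_lieMat _ _) r *
    expG (lieMat (0, (1 - c) • v.2) 0) (isLie_lieMat _ _) r

/-- The momentum of the explicit curve is constant. -/
theorem momentumAlong_geodesicLift (c : ℝ) (b : SU21) (v : ModelM) (r : ℝ) :
    momentumAlong c (fun r => (geodesicLift c b v r : SpaceM)) r = momentum c b v := by
  set M := lieMat (inertia c v) 0 with hM
  set Z := lieMat (0, (1 - c) • v.2) 0 with hZ
  set e₁ := expG M (isLie_lieMat _ _) with he₁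
  set e₂ := expG Z (isLie_lieMat _ _) with he₂
  have hMZ : M + Z = lieMat v 0 := by
    rw [hM, hZ, ← lieMat_add_zero, inertia_apply]
    congr 1
    ext1
    · simp
    · change c • v.2 + (1 - c) • v.2 = v.2
      rw [← add_smul, add_sub_cancel, one_smul]
  have hk : e₂ r ∈ subK := by
    obtain ⟨a, ha, ha'⟩ := lieMat_mem_lieAlg_subK ((1 - c) • v.2) 0 r
    have : a = e₂ r := toMat_injective ha'
    rwa [← this]
  obtain ⟨w, hw⟩ := exists_conj_inertia hk v
  have hw1 : toMat (e₂ r)⁻¹ * lieMat v 0 * toMat (e₂ r) = lieMat w 0 := by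
    have := hw 1
    simpa [inertia_apply] using this
  have c₁ : toMat (e₁ r) * M = M * toMat (e₁ r) :=
    (((Commute.refl M).smul_left r).exp_left).eq
  have c₂ : toMat (e₂ r) * Z = Z * toMat (e₂ r) :=
    (((Commute.refl Z).smul_left r).exp_left).eq
  have d₁ := (isOneParam_expG M (isLie_lieMat _ _)).hasDerivAt r
  have d₂ := (isOneParam_expG Z (isLie_lieMat _ _)).hasDerivAt r
  have d : HasDerivAt (fun r => toMat (geodesicLift c b v r))
      (toMat (geodesicLift c b v r) * lieMat w 0) r := by
    refine ((hasDerivAt_toMat_const_mul d₁ b).fun_mul d₂).congr_deriv ?_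
    rw [← hw1, ← hMZ, geodesicLift, toMat_mul, toMat_mul]
    have e : toMat (e₂ r) * toMat (e₂ r)⁻¹ = 1 := toMat_mul_inv _
    calc _ = toMat b * toMat (e₁ r) * (M * toMat (e₂ r)) +
          toMat b * toMat (e₁ r) * (toMat (e₂ r) * Z) := by rw [← he₁, ← he₂]; noncomm_ring
      _ = toMat b * toMat (e₁ r) * 1 * ((M + Z) * toMat (e₂ r)) := by
        rw [c₂]; noncomm_ring
      _ = _ := by rw [← e, ← he₁, ← he₂, toMat_mul]; noncomm_ring
  rw [momentumAlong_eq c d (Filter.Eventually.of_forall fun _ => rfl), ← mul_assoc, toMat_inv_mul,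
    one_mul, projM_lieMat, momentum, ← hw, geodesicLift, mul_inv_rev, mul_inv_rev, momentum]
  simp only [toMat_mul]
  rw [← he₁, ← he₂, ← hM]
  have e : toMat (e₂ r) * toMat (e₂ r)⁻¹ = 1 := toMat_mul_inv _
  have e' : toMat (e₁ r) * toMat (e₁ r)⁻¹ = 1 := toMat_mul_inv _
  calc _ = toMat b * toMat (e₁ r) * (toMat (e₂ r) * toMat (e₂ r)⁻¹) * M *
        (toMat (e₂ r) * toMat (e₂ r)⁻¹) * toMat (e₁ r)⁻¹ * toMat b⁻¹ := by noncomm_ring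
    _ = toMat b * (toMat (e₁ r) * M) * toMat (e₁ r)⁻¹ * toMat b⁻¹ := by
      rw [e]; noncomm_ring
    _ = toMat b * M * (toMat (e₁ r) * toMat (e₁ r)⁻¹) * toMat b⁻¹ := by
      rw [c₁]; noncomm_ring
    _ = _ := by rw [e', mul_one]

theorem momentumAlong_comp_sub (c : ℝ) (γ : ℝ → SpaceM) (s r : ℝ) :
    momentumAlong c (fun r => γ (r - s)) r = momentumAlong c γ (r - s) := by
  rw [momentumAlong, momentumAlong]
  congr 1
  exact deriv_comp_sub_const (f := fun x => chartAt ModelM (γ (r - s)) (γ x)) s r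

theorem contMDiff_geodesicLift (c : ℝ) (b : SU21) (v : ModelM) (s : ℝ) :
    ContMDiff 𝓘(ℝ, ℝ) 𝓘(ℝ, ModelM) ∞ (fun r => (geodesicLift c b v (r - s) : SpaceM)) := by
  intro r
  apply contMDiffAt_mk
  simp only [geodesicLift, toMat_mul]
  have h : ∀ X hX i j, ContDiffAt ℝ ∞ (fun r : ℝ => toMat (expG X hX (r - s)) i j) r :=
    fun X hX i j => ((contDiff_expG_entry X hX i j).comp (contDiff_id.sub contDiff_const)).contDiffAt
  exact contDiffAt_mul (contDiffAt_mul (fun _ _ => contDiffAt_const) (h _ _)) (h _ _)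

theorem momentum_zero (c : ℝ) (b : SU21) : momentum c b 0 = 0 := by
  have : lieMat (inertia c 0) 0 = 0 := by
    rw [map_zero]
    ext i j
    fin_cases i <;> fin_cases j <;> simp [lieMat]
  rw [momentum, this, mul_zero, zero_mul]

/-- A curve is a geodesic if its momentum is constant. -/
theorem IsFormQ.isGeodesicOn {c : ℝ} {g : SemiRiemannianMetric ModelM SpaceM}
    (hg : IsFormQ c g) (hc : 0 < c) {γ : ℝ → SpaceM} {N : Mat}
    (h : ContMDiff 𝓘(ℝ, ℝ) 𝓘(ℝ, ModelM) ∞ γ) (hN : ∀ r, momentumAlong c γ r = N) :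
    g.IsGeodesicOn γ Set.univ := by
  refine ⟨h.contMDiffOn, fun s _ => ?_⟩
  have h1 := hg.hasDerivAt_momentumAlong hc (h s)
  rw [funext hN] at h1
  apply momentum_injective hc (γ s).out
  rw [h1.unique (hasDerivAt_const s N)]
  exact (momentum_zero c _).symm

/-- A geodesic on `J` has constant momentum, so it coincides with the explicit geodesic of the same
momentum through one of its points. -/
theorem IsFormQ.geodesicallyComplete {c : ℝ} {g : SemiRiemannianMetric ModelM SpaceM}
    (hg : IsFormQ c g) (hc : 0 < c) : g.GeodesicallyComplete := by
  have key : ∀ (b : SU21) (v : ModelM) (s r : ℝ),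
      momentumAlong c (fun r => (geodesicLift c b v (r - s) : SpaceM)) r = momentum c b v := by
    intro b v s r
    rw [momentumAlong_comp_sub c (fun r => (geodesicLift c b v r : SpaceM)) s r,
      momentumAlong_geodesicLift]
  have hgeo : ∀ (b : SU21) (v : ModelM) (s : ℝ),
      g.IsGeodesicOn (fun r => (geodesicLift c b v (r - s) : SpaceM)) Set.univ :=
    fun b v s => hg.isGeodesicOn hc (contMDiff_geodesicLift c b v s) (key b v s)
  intro J γ hJ hJ' hγ
  rcases J.eq_empty_or_nonempty with rfl | ⟨s, hs⟩
  · exact ⟨_, hgeo 1 0 0, Set.eqOn_empty _ _⟩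
  have hd : ∀ r ∈ J, HasDerivAt (momentumAlong c γ) 0 r := by
    intro r hr
    have h1 := hg.hasDerivAt_momentumAlong hc (hγ.1.contMDiffAt (hJ.mem_nhds hr))
    exact h1.congr_deriv ((congrArg _ (hγ.2 r hr)).trans (momentum_zero c _))
  have hN : ∀ r ∈ J, momentumAlong c γ r = momentumAlong c γ s := fun r hr =>
    hJ.is_const_of_deriv_eq_zero hJ'.isPreconnected
      (fun r hr => (hd r hr).differentiableAt.differentiableWithinAt)
      (fun r hr => (hd r hr).deriv) hr hs
  refine ⟨_, hgeo (γ s).out (deriv (fun r => chartAt ModelM (γ s) (γ r)) s) s, ?_⟩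
  refine eqOn_of_momentumAlong hc hJ hJ' hγ.1 (contMDiff_geodesicLift c _ _ _).contMDiffOn hN
    (fun r _ => key _ _ s r) hs ?_
  have h0 : ∀ X hX, expG X hX 0 = 1 := fun X hX => (isOneParam_expG X hX).zero
  rw [sub_self, geodesicLift, h0, h0, mul_one, mul_one, mk_out]

end

/-! ### Spheres are simply connected -/

section Sphere

variable {E : Type*} [NormedAddCommGroup E] [InnerProductSpace ℝ E]

/-- A loop which misses a point is null-homotopic, since the complement of a point in a sphere is
contractible by the stereographic projection. -/
theorem homotopic_refl_of_forall_ne {x : Metric.sphere (0 : E) 1} (γ : Path x x)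
    {v : Metric.sphere (0 : E) 1} (hv : ∀ t, γ t ≠ v) : γ.Homotopic (Path.refl x) := by
  set φ := stereographic (norm_eq_of_mem_sphere v) with hφ
  have hs : ∀ t, γ t ∈ φ.source := fun t => hv t
  have hsc : ContractibleSpace φ.source :=
    ((φ.toHomeomorphSourceTarget.trans (Homeomorph.setCongr (stereographic_target _))).trans
      (Homeomorph.Set.univ _)).contractibleSpace
  have hx : x ∈ φ.source := by simpa using hs 0
  let γ' : Path (⟨x, hx⟩ : φ.source) ⟨x, hx⟩ :=
    { toFun := fun t => ⟨γ t, hs t⟩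
      continuous_toFun := γ.continuous.subtype_mk _
      source' := by simp
      target' := by simp }
  exact (SimplyConnectedSpace.paths_homotopic γ' (Path.refl _)).map
    ⟨Subtype.val, continuous_subtype_val⟩

/-- Every loop in the sphere can be approximated by a smooth one, which misses a point. -/
theorem exists_homotopic_forall_ne [FiniteDimensional ℝ E] (hE : 2 < Module.finrank ℝ E)
    {x : Metric.sphere (0 : E) 1} (γ : Path x x) :
    ∃ (δ : Path x x) (v : Metric.sphere (0 : E) 1), γ.Homotopic δ ∧ ∀ t, δ t ≠ v := by
  obtain ⟨f, hf, hd, -⟩ := (continuous_subtype_val.comp γ.continuous_extend).exists_contDiff_approx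
    (E := ℝ) (F := E) 1 (ε := fun _ => 1 / 4) continuous_const (by intro; norm_num)
  -- correct the approximation at the end points
  let g : ℝ → E := fun t => f t + (1 - t) • ((x : E) - f 0) + t • ((x : E) - f 1)
  have hg : ContDiff ℝ 1 g := by fun_prop
  have hd' : ∀ t : unitInterval, ‖f t - γ t‖ < 1 / 4 := by
    intro t
    have := hd t
    rwa [dist_eq_norm, Function.comp_apply, Path.extend_apply] at this
  have h0 : ‖(x : E) - f 0‖ < 1 / 4 := by
    have := hd' 0
    rwa [γ.source, norm_sub_rev] at this
  have h1 : ‖(x : E) - f 1‖ < 1 / 4 := by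
    have := hd' 1
    rwa [γ.target, norm_sub_rev] at this
  have hgγ : ∀ t : unitInterval, ‖g t - γ t‖ < 1 := by
    intro t
    have e : g t - γ t = (f t - γ t) + (1 - (t : ℝ)) • ((x : E) - f 0) +
        (t : ℝ) • ((x : E) - f 1) := by
      simp only [g]
      abel
    have n1 := norm_add₃_le (a := f t - γ t) (b := (1 - (t : ℝ)) • ((x : E) - f 0))
      (c := (t : ℝ) • ((x : E) - f 1))
    rw [norm_smul, norm_smul, Real.norm_of_nonneg t.2.1,
      Real.norm_of_nonneg (sub_nonneg.2 t.2.2), ← e] at n1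
    have n2 := hd' t
    nlinarith [t.2.1, t.2.2]
  -- the segment from `γ t` to `g t` does not contain the origin
  have hne : ∀ p : unitInterval × unitInterval, (γ p.2 : E) + (p.1 : ℝ) • (g p.2 - γ p.2) ≠ 0 := by
    intro p h
    have e : (γ p.2 : E) = -((p.1 : ℝ) • (g p.2 - γ p.2)) := eq_neg_of_add_eq_zero_left h
    have n1 : ‖(γ p.2 : E)‖ = 1 := norm_eq_of_mem_sphere _
    rw [e, norm_neg, norm_smul, Real.norm_of_nonneg p.1.2.1] at n1
    nlinarith [hgγ p.2, p.1.2.1, p.1.2.2, norm_nonneg (g p.2 - γ p.2)]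
  have hgc := hg.continuous
  let H : C(unitInterval × unitInterval, Metric.sphere (0 : E) 1) :=
    { toFun := fun p => ⟨‖(γ p.2 : E) + (p.1 : ℝ) • (g p.2 - γ p.2)‖⁻¹ •
          ((γ p.2 : E) + (p.1 : ℝ) • (g p.2 - γ p.2)), by
        rw [mem_sphere_zero_iff_norm, norm_smul, norm_inv, norm_norm,
          inv_mul_cancel₀ (norm_ne_zero_iff.2 (hne p))]⟩
      continuous_toFun := by
        apply Continuous.subtype_mk
        have hc : Continuous fun p : unitInterval × unitInterval =>
            (γ p.2 : E) + (p.1 : ℝ) • (g p.2 - γ p.2) := by fun_prop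
        exact (hc.norm.inv₀ fun p => norm_ne_zero_iff.2 (hne p)).smul hc }
  have hg0 : g 0 = x := by simp [g]
  have hg1 : g 1 = x := by simp [g]
  have hnx : ‖(x : E)‖ = 1 := norm_eq_of_mem_sphere _
  have hend : ∀ s t : unitInterval, t = 0 ∨ t = 1 → H (s, t) = x := by
    rintro s t (rfl | rfl) <;> apply Subtype.ext <;> simp [H, hg0, hg1, hnx]
  let δ : Path x x :=
    { toFun := fun t => H (1, t)
      continuous_toFun := by fun_prop
      source' := hend 1 0 (Or.inl rfl)
      target' := hend 1 1 (Or.inr rfl) }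
  have hδ : ∀ t, (δ t : E) = ‖g t‖⁻¹ • g t := by
    intro t
    change ‖(γ t : E) + ((1 : unitInterval) : ℝ) • (g t - γ t)‖⁻¹ •
          ((γ t : E) + ((1 : unitInterval) : ℝ) • (g t - γ t)) = _
    simp
  -- the cone over `g` is the image of a plane under a `C¹` map, so it is not the whole space
  have hcone : ContDiff ℝ 1 fun p : ℝ × ℝ => p.1 • g p.2 :=
    contDiff_fst.smul (hg.comp contDiff_snd)
  obtain ⟨v, hv⟩ := (hcone.dense_compl_range_of_finrank_lt_finrank (by simpa using hE)).nonempty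
  have hv0 : v ≠ 0 := by
    rintro rfl
    exact hv ⟨(0, 0), zero_smul _ _⟩
  refine ⟨δ, ⟨‖v‖⁻¹ • v, ?_⟩, ⟨⟨⟨H, ?_, ?_⟩, ?_⟩⟩, ?_⟩
  · rw [mem_sphere_zero_iff_norm, norm_smul, norm_inv, norm_norm,
      inv_mul_cancel₀ (norm_ne_zero_iff.2 hv0)]
  · intro t
    apply Subtype.ext
    have := norm_eq_of_mem_sphere (γ t)
    simp [H, this]
  · intro t
    rfl
  · intro s t ht
    rcases ht with rfl | ht
    · exact (hend s 0 (Or.inl rfl)).trans γ.source.symm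
    · rw [Set.mem_singleton_iff] at ht
      subst ht
      exact (hend s 1 (Or.inr rfl)).trans γ.target.symm
  · intro t ht
    apply hv
    refine ⟨(‖v‖ * ‖g t‖⁻¹, t), ?_⟩
    have e : (δ t : E) = ‖v‖⁻¹ • v := congrArg Subtype.val ht
    change (‖v‖ * ‖g t‖⁻¹) • g t = v
    rw [mul_smul, ← hδ, e, smul_smul, mul_inv_cancel₀ (norm_ne_zero_iff.2 hv0), one_smul]

/-- The unit sphere of a space of dimension at least `3` is simply connected. -/
theorem simplyConnectedSpace_sphere [FiniteDimensional ℝ E] (hE : 2 < Module.finrank ℝ E) :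
    SimplyConnectedSpace (Metric.sphere (0 : E) 1) := by
  rw [simply_connected_iff_loops_nullhomotopic]
  refine ⟨isPathConnected_iff_pathConnectedSpace.1 (isPathConnected_sphere ?_ 0 zero_le_one), ?_⟩
  · rw [← Module.finrank_eq_rank]
    exact_mod_cast (by omega : 1 < Module.finrank ℝ E)
  · intro x γ
    obtain ⟨δ, v, h, hv⟩ := exists_homotopic_forall_ne hE γ
    exact h.trans (homotopic_refl_of_forall_ne δ hv)

end Sphere

/-! ### The fibers of the projection -/

/-- The unit sphere in `ℂ²`. -/
abbrev SphereC2 : Type := Metric.sphere (0 : EuclideanSpace ℂ (Fin 2)) 1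

instance simplyConnectedSpace_sphereC2 : SimplyConnectedSpace SphereC2 := by
  apply simplyConnectedSpace_sphere
  rw [(WithLp.linearEquiv 2 ℝ (Fin 2 → ℂ)).finrank_eq, Module.finrank_pi_fintype]
  simp

namespace SphereC2

/-- The first coordinate of a point in the unit sphere of `ℂ²`. -/
def fst (x : SphereC2) : ℂ := x.1 0

/-- The second coordinate of a point in the unit sphere of `ℂ²`. -/
def snd (x : SphereC2) : ℂ := x.1 1

theorem continuous_fst : Continuous fst := by unfold fst; fun_prop

theorem continuous_snd : Continuous snd := by unfold snd; fun_prop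

theorem ext {x y : SphereC2} (h₁ : fst x = fst y) (h₂ : snd x = snd y) : x = y := by
  apply Subtype.ext
  ext i
  fin_cases i
  · exact h₁
  · exact h₂

theorem normSq_eq (x : SphereC2) : fst x * conj (fst x) + snd x * conj (snd x) = 1 := by
  have h := norm_eq_of_mem_sphere x
  have h2 := EuclideanSpace.norm_sq_eq x.1
  rw [h, Fin.sum_univ_two, one_pow] at h2
  rw [Complex.mul_conj', Complex.mul_conj', fst, snd]
  exact_mod_cast congrArg Complex.ofReal h2.symm

/-- The point of the unit sphere of `ℂ²` with given coordinates. -/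
def mk (a b : ℂ) (h : a * conj a + b * conj b = 1) : SphereC2 :=
  ⟨!₂[a, b], by
    rw [mem_sphere_zero_iff_norm, ← sq_eq_sq₀ (norm_nonneg _) zero_le_one,
      EuclideanSpace.norm_sq_eq, Fin.sum_univ_two, one_pow]
    rw [Complex.mul_conj', Complex.mul_conj'] at h
    exact_mod_cast h⟩

theorem fst_mk (a b : ℂ) (h : a * conj a + b * conj b = 1) : fst (mk a b h) = a := rfl

theorem snd_mk (a b : ℂ) (h : a * conj a + b * conj b = 1) : snd (mk a b h) = b := rfl

/-- The identification of the unit sphere in `ℂ²` with `SU(2)`. -/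
def toSU (x : SphereC2) : Matrix.unitaryGroup (Fin 2) ℂ :=
  ⟨!![fst x, -conj (snd x); snd x, conj (fst x)], by
    have h := normSq_eq x
    rw [Matrix.mem_unitaryGroup_iff]
    ext i j
    fin_cases i <;> fin_cases j <;> simp [Matrix.mul_apply, Fin.sum_univ_two] <;>
      first | linear_combination h | ring⟩

theorem toMat_toSU (x : SphereC2) : toMat (kEmb (toSU x)) =
    !![fst x, -conj (snd x), 0; snd x, conj (fst x), 0; 0, 0, 1] := by
  have h := normSq_eq x
  rw [toMat_kEmb, toSU, kMat, Matrix.det_fin_two]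
  have : fst x * conj (fst x) + conj (snd x) * snd x = 1 := by linear_combination h
  simp [this]

/-- The map `SU(2) → K/H = U(2)/S¹`. -/
def toKH (x : SphereC2) : subK ⧸ subH.subgroupOf subK :=
  ((⟨kEmb (toSU x), toSU x, rfl⟩ : subK) : subK ⧸ subH.subgroupOf subK)

theorem continuous_toKH : Continuous toKH := by
  refine QuotientGroup.continuous_mk.comp (Continuous.subtype_mk ?_ _)
  apply continuous_ofMat
  intro i j
  simp only [toMat_toSU]
  have h1 := continuous_fst
  have h2 := continuous_snd
  fin_cases i <;> fin_cases j <;> simp <;> fun_prop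

/-- Equality in `K/H` written in terms of the embeddings of `U(2)` and `S¹`. -/
theorem toKH_eq_iff (x : SphereC2) (U : Matrix.unitaryGroup (Fin 2) ℂ) :
    toKH x = ((⟨kEmb U, U, rfl⟩ : subK) : subK ⧸ subH.subgroupOf subK) ↔
      ∃ z : Circle, kEmb U = kEmb (toSU x) * circleEmb z := by
  rw [toKH, QuotientGroup.eq, Subgroup.mem_subgroupOf]
  constructor
  · rintro ⟨z, hz⟩
    refine ⟨z, ?_⟩
    rw [hz]
    simp
  · rintro ⟨z, hz⟩
    refine ⟨z, ?_⟩
    simp [hz]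

theorem exists_circle {z : ℂ} (hz : ‖z‖ = 1) : ∃ w : Circle, (w : ℂ) = z :=
  ⟨⟨z, mem_sphere_zero_iff_norm.2 hz⟩, rfl⟩

theorem toKH_surjective : Function.Surjective toKH := by
  intro p
  obtain ⟨⟨_, U, rfl⟩, rfl⟩ := QuotientGroup.mk_surjective p
  have hU := Matrix.mem_unitaryGroup_iff'.1 U.2
  -- a square root of the determinant makes the determinant equal to one
  obtain ⟨z, hz⟩ := IsAlgClosed.exists_pow_nat_eq U.1.det (n := 2) (by norm_num)
  have hd : star U.1.det * U.1.det = 1 := by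
    have := congrArg Matrix.det hU
    rwa [Matrix.det_mul, Matrix.star_eq_conjTranspose, Matrix.det_conjTranspose,
      Matrix.det_one] at this
  have hz1 : ‖z‖ = 1 := by
    have h := congrArg norm hd
    rw [norm_mul, norm_star, ← hz, norm_pow, ← pow_add, norm_one] at h
    exact (pow_eq_one_iff_of_nonneg (norm_nonneg z) (by norm_num)).1 h
  have hzz : z * conj z = 1 := by
    rw [Complex.mul_conj', hz1]; norm_num
  have e : ∀ i j, (star U.1 * U.1) i j = (1 : Matrix (Fin 2) (Fin 2) ℂ) i j := fun i j => by rw [hU]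
  have e00 := e 0 0
  have e01 := e 0 1
  simp only [Matrix.mul_apply, Fin.sum_univ_two, Matrix.star_apply, RCLike.star_def,
    Matrix.one_apply_eq, Matrix.one_apply_ne zero_ne_one] at e00 e01
  refine ⟨mk (conj z * U.1 0 0) (conj z * U.1 1 0) ?_, ?_⟩
  · rw [map_mul, map_mul, Complex.conj_conj]
    linear_combination e00 + (conj (U.1 0 0) * U.1 0 0 + conj (U.1 1 0) * U.1 1 0) * hzz
  · rw [toKH_eq_iff]
    obtain ⟨w, rfl⟩ := exists_circle hz1
    refine ⟨w, toMat_injective ?_⟩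
    rw [toMat_mul, toMat_toSU, toMat_kEmb, toMat_circleEmb, fst_mk, snd_mk, kMat, ← hz]
    rw [Matrix.det_fin_two] at hz
    ext i j
    fin_cases i <;> fin_cases j <;> simp [circleMat, Matrix.mul_apply, Fin.sum_univ_three]
    · linear_combination (-U.1 0 0) * hzz
    · linear_combination conj (U.1 1 0) * hz + U.1 0 0 * e01 - U.1 0 1 * e00
    · linear_combination (-U.1 1 0) * hzz
    · linear_combination -conj (U.1 0 0) * hz + U.1 1 0 * e01 - U.1 1 1 * e00

/-- The unit sphere of `ℝ` is the group `{±1}`, which acts on the sphere of `ℂ²`. -/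
theorem sphere_eq_one_or (g : Metric.sphere (0 : ℝ) 1) : (g : ℝ) = 1 ∨ (g : ℝ) = -1 := by
  have h := norm_eq_of_mem_sphere g
  rw [Real.norm_eq_abs] at h
  exact eq_or_eq_neg_of_abs_eq h

instance : Finite (Metric.sphere (0 : ℝ) 1) :=
  Finite.Set.subset {1, -1} fun x hx => sphere_eq_one_or ⟨x, hx⟩

theorem fst_smul (g : Metric.sphere (0 : ℝ) 1) (x : SphereC2) : fst (g • x) = (g : ℝ) * fst x := by
  change (g : ℝ) • fst x = _
  rw [Complex.real_smul]

theorem snd_smul (g : Metric.sphere (0 : ℝ) 1) (x : SphereC2) : snd (g • x) = (g : ℝ) * snd x := by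
  change (g : ℝ) • snd x = _
  rw [Complex.real_smul]

/-- `H ∩ SU(2) = {±1}`. -/
theorem toKH_eq_toKH_iff {x y : SphereC2} :
    toKH x = toKH y ↔ x ∈ MulAction.orbit (Metric.sphere (0 : ℝ) 1) y := by
  rw [eq_comm]
  refine (toKH_eq_iff y (toSU x)).trans ?_
  constructor
  · rintro ⟨z, hz⟩
    have h := congrArg toMat hz
    rw [toMat_mul, toMat_toSU, toMat_toSU, toMat_circleEmb] at h
    have h00 := congrFun (congrFun h 0) 0
    have h10 := congrFun (congrFun h 1) 0
    have h22 := congrFun (congrFun h 2) 2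
    simp [circleMat, Matrix.mul_apply, Fin.sum_univ_three] at h00 h10 h22
    obtain ⟨g, hg⟩ : ∃ g : Metric.sphere (0 : ℝ) 1, ((g : ℝ) : ℂ) = z := by
      rcases h22 with h | h
      · exact ⟨⟨1, by simp⟩, by simp [h]⟩
      · exact ⟨⟨-1, by simp⟩, by simp [h]⟩
    refine ⟨g, ext ?_ ?_⟩
    · change fst (g • y) = _
      rw [fst_smul, hg, h00, mul_comm]
    · change snd (g • y) = _
      rw [snd_smul, hg, h10, mul_comm]
  · rintro ⟨g, rfl⟩
    have hg : ((g : ℝ) : ℂ) ^ 2 = 1 := by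
      rcases sphere_eq_one_or g with h | h <;> simp [h]
    obtain ⟨w, hw⟩ := exists_circle (z := (g : ℝ)) (by simp)
    refine ⟨w, toMat_injective ?_⟩
    rw [toMat_mul, toMat_toSU, toMat_toSU, toMat_circleEmb, hw]
    change !![fst (g • y), -conj (snd (g • y)), 0; snd (g • y), conj (fst (g • y)), 0; 0, 0, 1] = _
    rw [fst_smul, snd_smul, circleMat, hg]
    ext i j
    fin_cases i <;> fin_cases j <;> simp [Matrix.mul_apply, Fin.sum_univ_three, mul_comm]

instance isClosed_subH_subgroupOf : IsClosed (subH.subgroupOf subK : Set subK) :=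
  isClosed_subH.preimage continuous_subtype_val

/-- `SU(2) → U(2)/S¹` is a covering with the group `{±1}` of deck transformations: a ball of radius `1`
does not meet its antipode. -/
theorem isQuotientCoveringMap_toKH :
    IsQuotientCoveringMap toKH (Metric.sphere (0 : ℝ) 1) where
  toIsQuotientMap := continuous_toKH.isClosedMap.isQuotientMap continuous_toKH toKH_surjective
  toContinuousConstSMul := inferInstance
  apply_eq_iff_mem_orbit := toKH_eq_toKH_iff
  disjoint e := by
    refine ⟨Metric.ball e 1, Metric.ball_mem_nhds _ one_pos, ?_⟩
    rintro g ⟨_, ⟨x, hx, rfl⟩, hy⟩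
    rcases sphere_eq_one_or g with h | h
    · exact Subtype.ext h
    · exfalso
      have h1 : dist (x : EuclideanSpace ℂ (Fin 2)) e < 1 := hx
      have h2 : dist ((g : ℝ) • (x : EuclideanSpace ℂ (Fin 2))) e < 1 := hy
      have h3 : ‖(x : EuclideanSpace ℂ (Fin 2))‖ = 1 := norm_eq_of_mem_sphere x
      rw [h, dist_eq_norm] at h2
      rw [dist_eq_norm] at h1
      have h4 := norm_sub_le ((x : EuclideanSpace ℂ (Fin 2)) - e)
        ((-1 : ℝ) • (x : EuclideanSpace ℂ (Fin 2)) - e)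
      have h5 : ((x : EuclideanSpace ℂ (Fin 2)) - e) -
          ((-1 : ℝ) • (x : EuclideanSpace ℂ (Fin 2)) - e) = (2 : ℝ) • (x : EuclideanSpace ℂ (Fin 2)) := by module
      rw [h5, norm_smul, h3, Real.norm_two] at h4
      linarith

/-- The fundamental group of `U(2)/S¹` is finite, since the covering of it by `SU(2)` has two
sheets. -/
theorem finite_fundamentalGroup {X : Type*} [TopologicalSpace X]
    (φ : subK ⧸ subH.subgroupOf subK ≃ₜ X) (p : X) : Finite (FundamentalGroup X p) := by
  have h := isQuotientCoveringMap_toKH.homeomorph_comp φ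
  obtain ⟨e, he⟩ := h.surjective p
  have : Finite (Metric.sphere (0 : ℝ) 1)ᵐᵒᵖ := Finite.of_equiv _ MulOpposite.opEquiv
  exact Finite.of_injective _ (h.fundamentalGroupToMulOpposite_injective ⟨e, he⟩)

instance : CompactSpace (subK ⧸ subH.subgroupOf subK) where
  isCompact_univ := by
    rw [← toKH_surjective.range_eq]
    exact isCompact_range continuous_toKH

end SphereC2

theorem projMB_mk_eq_iff (a g : SU21) : projMB (g : SpaceM) = (a : SpaceB) ↔ a⁻¹ * g ∈ subK := by
  rw [eq_comm]
  exact QuotientGroup.eq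

/-- The orbit map from `K/H` to the fiber over `a K`. -/
def fiberMap (a : SU21) : subK ⧸ subH.subgroupOf subK → (projMB ⁻¹' {(a : SpaceB)} : Set SpaceM) :=
  Quotient.lift (fun k : subK => ⟨((a * k : SU21) : SpaceM), by
    rw [Set.mem_preimage, Set.mem_singleton_iff, projMB_mk_eq_iff, inv_mul_cancel_left]
    exact k.2⟩) (by
    intro k l h
    apply Subtype.ext
    refine QuotientGroup.eq.2 ?_
    have h1 := Subgroup.mem_subgroupOf.1 (QuotientGroup.leftRel_apply.1 h)
    rwa [mul_inv_rev, mul_assoc, inv_mul_cancel_left])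

theorem continuous_fiberMap (a : SU21) : Continuous (fiberMap a) :=
  Continuous.quotient_lift (Continuous.subtype_mk (QuotientGroup.continuous_mk.comp
    (continuous_const.mul continuous_subtype_val)) _) _

theorem fiberMap_bijective (a : SU21) : Function.Bijective (fiberMap a) := by
  constructor
  · intro p q h
    obtain ⟨k, rfl⟩ := QuotientGroup.mk_surjective p
    obtain ⟨l, rfl⟩ := QuotientGroup.mk_surjective q
    have h1 : ((a * k : SU21) : SpaceM) = (a * l : SU21) := congrArg Subtype.val h
    have h2 := QuotientGroup.eq.1 h1
    rw [mul_inv_rev, mul_assoc, inv_mul_cancel_left] at h2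
    exact QuotientGroup.eq.2 (Subgroup.mem_subgroupOf.2 h2)
  · rintro ⟨p, hp⟩
    obtain ⟨g, rfl⟩ := QuotientGroup.mk_surjective p
    refine ⟨((⟨a⁻¹ * g, (projMB_mk_eq_iff a g).1 hp⟩ : subK) : subK ⧸ subH.subgroupOf subK),
      Subtype.ext ?_⟩
    change ((a * (a⁻¹ * g) : SU21) : SpaceM) = g
    rw [mul_inv_cancel_left]

/-- `fiberMap` is a continuous bijection from a compact space to a Hausdorff space. -/
theorem nonempty_fiber_homeomorph (x : SpaceB) :
    Nonempty ((projMB ⁻¹' {x} : Set SpaceM) ≃ₜ subK ⧸ subH.subgroupOf subK) := by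
  obtain ⟨a, rfl⟩ := QuotientGroup.mk_surjective x
  exact ⟨(Continuous.homeoOfEquivCompactToT2
    (f := Equiv.ofBijective _ (fiberMap_bijective a)) (continuous_fiberMap a)).symm⟩

end

theorem mainTheorem3 (t : ℝ) (ht : -1 < t) (ht' : t < -(3 / 5)) :
    (1 + t) / 8 < etaBound t ∧
    (∃! g : SemiRiemannianMetric ModelM SpaceM, IsMetricM t g) ∧
    (∃! h : SemiRiemannianMetric ModelB SpaceB, IsMetricB h) ∧
    ∀ (g : SemiRiemannianMetric ModelM SpaceM) (h : SemiRiemannianMetric ModelB SpaceB),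
      IsMetricM t g → IsMetricB h →
      (∀ k : ℝ, (1 + t) / 8 < k → k < etaBound t → 0 < k ∧ g.CurvatureGE k) ∧
      g.GeodesicallyComplete ∧
      (∀ (x : SpaceB) (u : TangentSpace (modelWithCornersSelf ℝ ModelB) x),
        u ≠ 0 → h.form x u u < 0) ∧
      IsSemiRiemannianSubmersion g h projMB ∧
      (∀ (p : SpaceM) (u : TangentSpace (modelWithCornersSelf ℝ ModelM) p),
        mfderiv (modelWithCornersSelf ℝ ModelM) (modelWithCornersSelf ℝ ModelB) projMB p u = 0 →
        u ≠ 0 → 0 < g.form p u u) ∧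
      ¬ IsIntegrableDistribution (horizontalSpace ModelB g projMB) ∧
      ∀ x : SpaceB,
        Nonempty ((projMB ⁻¹' {x} : Set SpaceM) ≃ₜ subK ⧸ subH.subgroupOf subK) ∧
        ∀ p : (projMB ⁻¹' {x} : Set SpaceM),
          Finite (FundamentalGroup (projMB ⁻¹' {x} : Set SpaceM) p) := by
  have hc : 0 < 1 + t := by linarith
  refine ⟨(etaBound_spec ht ht').1, ?_, ?_, ?_⟩
  · obtain ⟨g, hg⟩ := exists_isFormQ hc
    exact ⟨g, hg.isMetricM, fun g' hg' => hg'.isFormQ.unique hg⟩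
  · obtain ⟨h, hh⟩ := exists_isFormP
    exact ⟨h, hh.isMetricB, fun h' hh' => hh'.isFormP.unique hh⟩
  · intro g h hg hh
    have hg := hg.isFormQ
    have hh := hh.isFormP
    refine ⟨fun k hk hk' => ⟨by linarith, hg.curvatureGE ht ht' hk hk'⟩, ?_, hh.neg,
      hg.isSemiRiemannianSubmersion hc hh, hg.vertical_pos hc,
      hg.not_isIntegrableDistribution hc, ?_⟩
    · exact hg.geodesicallyComplete hc
    · intro x
      obtain ⟨φ⟩ := nonempty_fiber_homeomorph x
      exact ⟨⟨φ⟩, SphereC2.finite_fundamentalGroup φ.symm⟩
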